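/- **Setting.** Let $d\in\mathbb N$, $\bar r>12$, $T\in C^\infty(\mathbb T^d,\mathbb T^d)$, $\alpha\in C^\infty(\mathbb T^d,\mathbb R)$, $\beta\in C^\infty(\mathbb T^d,\mathbb R^d)$. For $\nu\in\mathbb R$ and $h\in C^{\bar r}(\mathbb T^d,\mathbb R)'$ with $h(1)=1$ put $T_{\nu,h}(x)=T(x)+\nu\beta(x)h(\alpha)$ mod $1$. For $S\in C^{\bar r}(\mathbb T^d,\mathbb T^d)$ let $(\mathcal L_Sh)(\varphi)=h(\varphi\circ S)$, and let $\widetilde{\mathcal L}_\nu h=\mathcal L_{T_{\nu,h}}h$. Write $\int\varphi h=h(\varphi)$ and $\int h=h(1)$; $h\ge 0$ means $h(\varphi)\ge0$ for all $0\le\varphi\in C^{\bar r}$. Let $\mathcal T\subset C^{\bar r}(\mathbb T^d,\mathbb T^d)$ be a set of surjective maps closed under composition, and let $\nu_*>0$ be such that $T_{\nu,\mu}\in\mathcal T$ for all $\nu\in[0,\nu_*]$ and all probability measures $\mu$. Let $\mathcal B_0\supset\mathcal B_1\supset\mathcal B_2\supset\mathcal B_3$ be real Banach spaces, $\|\cdot\|_{\mathcal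 B_i}\le\|\cdot\|_{\mathcal B_{i+1}}$, with continuous embeddings $C^{\bar r}\subset\mathcal B_i\subset (C^{\bar r})'$ that extend $f\mapsto(\varphi\mapsto\int f\varphi\,dx)$, and such that $C^{\bar r}$ is dense in each $\mathcal B_i$ and in each dual $\mathcal B_i'$. Assume that there are $C_*,K\ge1$, $\vartheta\in(0,1)$, integers $\bar c,\hat c\ge1$ and $\bar n\in\mathbb N$ such that: 1. $\mathcal L_S\in L(\mathcal B_i,\mathcal B_i)$ for $S\in\mathcal T$, $0\le i\le 3$; 2. $\partial_{x_k}\in L(\mathcal B_{i+1},\mathcal B_i)$ for $1\le k\le d$, $0\le i\le2$; 3. $\|ah\|_{\mathcal B_i}\le C_*\|a\|_{C^{\bar ci+\hat c}}\|h\|_{\mathcal B_i}$ for $a\in C^{\bar r}\cap C^{\bar ci+\hat c}$, $0\le i\le3$, and $|\int h|\le C_*\|h\|_{\mathcal B_0}$; 4. the inclusions $\mathcal B_{i+1}\to\mathcal B_i$ are compact; 5. for all $n$ and $S_1,\dots,S_n\in\mathcal T$, $\|\mathcal L_{S_n}\cdots\mathcal L_{S_1}\phi\|_{\mathcal B_0}\le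 C_*\|\phi\|_{\mathcal B_0}$ for $\phi\in\mathcal B_1$, and $\|\mathcal L_{S_n}\cdots\mathcal L_{S_1}\phi\|_{\mathcal B_i}\le C_*\vartheta^n\|\phi\|_{\mathcal B_i}+K\|\phi\|_{\mathcal B_{i-1}}$ for $\phi\in\mathcal B_i$, $1\le i\le3$; 6. for all $n\ge\bar n$, $S_1,\dots,S_n\in\mathcal T$ and $1\le i\le 3$, the norm of $\mathcal L_{S_n}\cdots\mathcal L_{S_1}$ on $\{f\in\mathcal B_i:\int f=0\}$ is less than $\vartheta^n$. For $K_\star>0$ let $\mathbb W=\{h\in\mathcal B_1:\|h\|_{\mathcal B_1}\le K_\star,\ h\ge0,\ \int h=1\}$ and $\mathbb V=\{f\in\mathcal B_1:\int f=0\}$. For $\nu\in[0,\nu_*]$ and $h\in\mathbb W$ let $H(\nu,h)$ be the invariant probability measure of $T_{\nu,h}$ in $\mathbb W$ (it exists and is unique for $K_\star$ large), let $F(\nu,h)=h-H(\nu,h)$, and let $\Theta(\nu,h)=-(\mathrm{Id}-\mathcal L_{T_{\nu,h}})^{-1}\sum_k\partial_{x_k}\mathcal L_{T_{\nu,h}}(\beta_kH(\nu,h))\in\mathbb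 V$. Let $D_hF:\mathbb V\to\mathbb V$ and $D_\nu F$ be the partial derivatives of $F:[0,\nu_*]\times\mathbb W\to\mathcal B_1$, and let $D_h^2F$ be the second derivative in $h$ of $F$ as a map into $\mathcal B_0$. (All derivatives in $h$ are Fréchet derivatives within $\mathbb W$, along $\mathbb V$, for the $\mathcal B_1$ norm on $\mathbb W$; derivatives in $\nu$ are within $[0,\nu_*]$.) A zero $(\nu,h)$ of $F$ is *regular* if $D_hF(\nu,h):\mathbb V\to\mathbb V$ is invertible, and a *nondegenerate fold* if $$\operatorname{Range}D_hF(\nu,h)\oplus\mathbb R\,D_\nu F(\nu,h)=\mathbb V,\qquad \int\alpha\, D^2_hF(\nu,h)(\Theta(\nu,h),\Theta(\nu,h))\ne0,\qquad\int\alpha h\neq0 .$$ A *fixed point* of $\widetilde{\mathcal L}_\nu$ in $\mathcal B_1$ is an $h\in\mathcal B_1$ with $\int h=1$, $T_{\nu,h}\in\mathcal T$ (automatic if $h\ge0$) and $\widetilde{\mathcal L}_\nu h=h$. **Theorem.** For all sufficiently large $K_\star$ the following holds. Suppose that every zero $(\nu,h)\in[0,\nu_*]\times\mathbb W$ of $F$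 is regular or a nondegenerate fold. Then there are finitely many nonempty intervals $I_k\subset\mathbb R$ (an interval may be reduced to a point, but only if $G_k=\nu_*$ there) and differentiable curves $(G_k,\mathbf h_k):I_k\to[0,\nu_*]\times\mathcal B_1$ such that: * for every $\nu\in[0,\nu_*]$ and every fixed point $h\in\mathcal B_1$ of $\widetilde{\mathcal L}_\nu$ there are $k$ and $y\in I_k$ with $(G_k(y),\mathbf h_k(y))=(\nu,h)$; * for all $k$ and $y\in I_k$, $\mathbf h_k(y)\in\mathbb W\cap\mathcal B_3$ and $\mathbf h_k(y)$ is a fixed point of $\widetilde{\mathcal L}_{G_k(y)}$; * $G_k^{-1}(\nu)$ is finite for every $k$ and every $\nu\in[0,\nu_*]$; * if $F(\nu,h)=0$ and $D_hF(\nu,h)$ is not invertible for some $\nu\in(0,\nu_*)$ and $h\in\mathbb W$, then there is $\nu_1\in(0,\nu_*)$ such that $\bigcup_kG_k^{-1}(\nu_1)$ has at least three elements and the set $\{\mathbf h_k(y): k,\ y\in I_k,\ G_k(y)=\nu_1\}$ of invariant probability measures of $\widetilde{\mathcal L}_{\nu_1}$ has at least three elements. -/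

import Mathlib

open Set MeasureTheory
open scoped ContDiff

noncomputable section

namespace MeanField

/-! ### Functions, maps and distributions on the torus -/

/-- The projection of `ℝ^d` onto the torus `ℝ^d / ℤ^d`. -/
def toTorus {d : ℕ} (x : Fin d → ℝ) : UnitAddTorus (Fin d) := fun k => (x k : UnitAddCircle)

/-- Real functions of class `C^n` on the torus. -/
def torusFun (d : ℕ) (n : WithTop ℕ∞) : Submodule ℝ (UnitAddTorus (Fin d) → ℝ) where
  carrier := {f | ContDiff ℝ n (fun x : Fin d → ℝ => f (toTorus x))}
  add_mem' hf hg := ContDiff.add hf hg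
  zero_mem' := contDiff_const
  smul_mem' c _ hf := ContDiff.const_smul c hf

/-- The `C^m` norm: the supremum over the torus of all derivatives of order at most `m`. -/
def crNorm {d : ℕ} (m : ℕ) (f : UnitAddTorus (Fin d) → ℝ) : ℝ :=
  ⨆ p : Fin (m + 1) × (Fin d → ℝ),
    ‖iteratedFDeriv ℝ (p.1 : ℕ) (fun x : Fin d → ℝ => f (toTorus x)) p.2‖

theorem mem_torusFun {d : ℕ} {n : WithTop ℕ∞} {f : UnitAddTorus (Fin d) → ℝ} :
    f ∈ torusFun d n ↔ ContDiff ℝ n (fun x : Fin d → ℝ => f (toTorus x)) := Iff.rfl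

/-- Maps of class `C^n` of the torus to itself, i.e. maps with a `C^n` lift to `ℝ^d`. -/
@[ext]
structure TorusMap (d : ℕ) (n : WithTop ℕ∞) where
  toFun : UnitAddTorus (Fin d) → UnitAddTorus (Fin d)
  exists_lift : ∃ S' : (Fin d → ℝ) → (Fin d → ℝ), ContDiff ℝ n S' ∧
    ∀ x, toFun (toTorus x) = toTorus (S' x)

/-- Composition `S ∘ S'`. -/
def TorusMap.comp {d : ℕ} {n : WithTop ℕ∞} (S S' : TorusMap d n) : TorusMap d n :=
  ⟨S.toFun ∘ S'.toFun, by
    obtain ⟨A, hA, hA'⟩ := S.exists_lift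
    obtain ⟨A₂, hA₂, hA₂'⟩ := S'.exists_lift
    exact ⟨A ∘ A₂, hA.comp hA₂, fun x => by simp [hA', hA₂']⟩⟩

theorem torusFun_mono {d : ℕ} {m n : WithTop ℕ∞} (h : m ≤ n) : torusFun d n ≤ torusFun d m :=
  fun _ hf => ContDiff.of_le hf h

/-- A smooth function, seen as a function of class `C^r`. -/
def ofSmooth {d : ℕ} (r : ℕ) (f : torusFun d ∞) : torusFun d r :=
  ⟨f.1, torusFun_mono (by exact_mod_cast le_top) f.2⟩

/-- The constant function `1`. -/
def oneFun (d r : ℕ) : torusFun d r := ⟨fun _ => 1, mem_torusFun.2 contDiff_const⟩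

/-- A function of class `C^(r+1)`, seen as a function of class `C^r`. -/
def lowerFun (d r : ℕ) : torusFun d ((r + 1 : ℕ) : WithTop ℕ∞) →ₗ[ℝ] torusFun d r :=
  Submodule.inclusion (torusFun_mono (by exact_mod_cast Nat.le_succ r))

/-- `φ ↦ φ ∘ S`. -/
def compFun {d r : ℕ} (S : TorusMap d r) : torusFun d r →ₗ[ℝ] torusFun d r where
  toFun φ := ⟨fun x => φ.1 (S.toFun x), by
    obtain ⟨A, hA, hA'⟩ := S.exists_lift
    have h : (fun x : Fin d → ℝ => φ.1 (S.toFun (toTorus x))) =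
        (fun x : Fin d → ℝ => φ.1 (toTorus x)) ∘ A := by
      funext x; simp [hA']
    change ContDiff ℝ r _
    rw [h]
    exact ContDiff.comp φ.2 hA⟩
  map_add' _ _ := rfl
  map_smul' _ _ := rfl

/-- `φ ↦ a φ`. -/
def mulFun {d r : ℕ} (a : torusFun d r) : torusFun d r →ₗ[ℝ] torusFun d r where
  toFun φ := ⟨fun x => a.1 x * φ.1 x, mem_torusFun.2 ((mem_torusFun.1 a.2).mul (mem_torusFun.1 φ.2))⟩
  map_add' φ ψ := Subtype.ext (funext fun x => mul_add (a.1 x) (φ.1 x) (ψ.1 x))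
  map_smul' c φ := Subtype.ext (funext fun x => mul_left_comm (a.1 x) c (φ.1 x))

/-- The partial derivative `∂f/∂x_k` at a point of the torus. -/
def partialDeriv {d : ℕ} (k : Fin d) (f : UnitAddTorus (Fin d) → ℝ) (t : UnitAddTorus (Fin d)) : ℝ :=
  deriv (fun s : ℝ => f (t + toTorus (s • (Pi.single k (1 : ℝ) : Fin d → ℝ)))) 0

theorem toTorus_add {d : ℕ} (x y : Fin d → ℝ) : toTorus (x + y) = toTorus x + toTorus y := by
  funext k; simp [toTorus]

theorem toTorus_surjective {d : ℕ} : Function.Surjective (toTorus (d := d)) := by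
  intro t
  choose x hx using fun k => QuotientAddGroup.mk_surjective (t k)
  exact ⟨x, funext hx⟩

theorem hasDerivAt_partial {d r : ℕ} (k : Fin d) (f : torusFun d ((r + 1 : ℕ) : WithTop ℕ∞))
    (x : Fin d → ℝ) :
    HasDerivAt (fun s : ℝ => f.1 (toTorus x + toTorus (s • (Pi.single k (1 : ℝ) : Fin d → ℝ))))
      (fderiv ℝ (fun x : Fin d → ℝ => f.1 (toTorus x)) x (Pi.single k 1)) 0 := by
  have hf : ContDiff ℝ ((r + 1 : ℕ) : WithTop ℕ∞) (fun x : Fin d → ℝ => f.1 (toTorus x)) := f.2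
  have h1 : HasFDerivAt (fun x : Fin d → ℝ => f.1 (toTorus x))
      (fderiv ℝ (fun x : Fin d → ℝ => f.1 (toTorus x)) x) x :=
    ((hf.differentiable (by simp)) x).hasFDerivAt
  have h2 := h1.hasLineDerivAt (Pi.single k (1 : ℝ) : Fin d → ℝ)
  simpa [HasLineDerivAt, toTorus_add] using h2

/-- `φ ↦ ∂φ/∂x_k`, from `C^(r+1)` to `C^r`. -/
def partialFun {d r : ℕ} (k : Fin d) :
    torusFun d ((r + 1 : ℕ) : WithTop ℕ∞) →ₗ[ℝ] torusFun d r where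
  toFun f := ⟨partialDeriv k f.1, by
    have hf : ContDiff ℝ ((r + 1 : ℕ) : WithTop ℕ∞) (fun x : Fin d → ℝ => f.1 (toTorus x)) := f.2
    have h : (fun x : Fin d → ℝ => partialDeriv k f.1 (toTorus x)) = fun x =>
        fderiv ℝ (fun x : Fin d → ℝ => f.1 (toTorus x)) x (Pi.single k 1) :=
      funext fun x => (hasDerivAt_partial k f x).deriv
    change ContDiff ℝ r _
    rw [h]
    exact (hf.fderiv_right (m := r) (by norm_cast)).clm_apply contDiff_const⟩
  map_add' f g := Subtype.ext (funext fun t => by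
    obtain ⟨x, rfl⟩ := toTorus_surjective t
    exact ((hasDerivAt_partial k f x).add (hasDerivAt_partial k g x)).deriv.trans
      (congrArg₂ (· + ·) (hasDerivAt_partial k f x).deriv (hasDerivAt_partial k g x).deriv).symm)
  map_smul' c f := Subtype.ext (funext fun t => by
    obtain ⟨x, rfl⟩ := toTorus_surjective t
    exact ((hasDerivAt_partial k f x).const_mul c).deriv.trans
      (congrArg (c * ·) (hasDerivAt_partial k f x).deriv).symm)

/-- Linear functionals on `C^r`. The elements of the Banach spaces considered below act on `C^r`
through such functionals, which are then bounded (see `BanachScale.toDistr_bounded`). -/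
abbrev Distr (d r : ℕ) : Type := torusFun d r →ₗ[ℝ] ℝ

/-- The transfer operator: `∫ φ · L_S h = ∫ φ ∘ S · h`. -/
def transfer {d r : ℕ} (S : TorusMap d r) (h : Distr d r) : Distr d r := h ∘ₗ compFun S

/-- The product `a h` of a distribution with a function. -/
def mulDistr {d r : ℕ} (a : torusFun d r) (h : Distr d r) : Distr d r := h ∘ₗ mulFun a

/-- The functional `h` on `C^r`, restricted to `C^(r+1)`. -/
def restrictDistr {d r : ℕ} (h : Distr d r) : Distr d (r + 1) := h ∘ₗ lowerFun d r

/-- The distributional derivative `∂h/∂x_k`; it acts on `C^(r+1)`. -/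
def partialDistr {d r : ℕ} (k : Fin d) (h : Distr d r) : Distr d (r + 1) := -(h ∘ₗ partialFun k)

/-- `h ≥ 0`. -/
def Distr.Nonneg {d r : ℕ} (h : Distr d r) : Prop :=
  ∀ φ : torusFun d r, (∀ x, 0 ≤ φ.1 x) → 0 ≤ h φ

/-- `∫ h = h(1)`. -/
def Distr.mass {d r : ℕ} (h : Distr d r) : ℝ := h (oneFun d r)

/-! ### Globally coupled maps -/

/-- The data `T`, `α`, `β` of a globally coupled map. -/
structure CoupledSystem (d : ℕ) where
  T : TorusMap d ∞
  α : torusFun d ∞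
  β : Fin d → torusFun d ∞

/-- The map `x ↦ T x + c β(x) mod 1`. -/
def CoupledSystem.shifted {d : ℕ} (P : CoupledSystem d) (r : ℕ) (c : ℝ) : TorusMap d r :=
  ⟨fun x => P.T.toFun x + fun k => ((c * (P.β k).1 x : ℝ) : UnitAddCircle), by
    obtain ⟨A, hA, hA'⟩ := P.T.exists_lift
    refine ⟨fun x => A x + fun k => c * (P.β k).1 (toTorus x), ?_, ?_⟩
    · refine ContDiff.add (hA.of_le (by exact_mod_cast le_top)) (contDiff_pi.2 fun k => ?_)
      exact contDiff_const.mul (ofSmooth r (P.β k)).2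
    · intro x
      change P.T.toFun (toTorus x) + _ = _
      rw [hA', toTorus_add]
      rfl⟩

/-- `T_{ν,h}(x) = T(x) + ν β(x) h(α) mod 1`. -/
def CoupledSystem.map {d r : ℕ} (P : CoupledSystem d) (ν : ℝ) (h : Distr d r) : TorusMap d r :=
  P.shifted r (ν * h (ofSmooth r P.α))

/-- The nonlinear transfer operator `h ↦ L_{T_{ν,h}} h`. -/
def CoupledSystem.nonlinearTransfer {d r : ℕ} (P : CoupledSystem d) (ν : ℝ) (h : Distr d r) :
    Distr d r := transfer (P.map ν h) h

/-! ### Scales of Banach spaces -/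

/-- Continuous dense embeddings
`C^r ⊂ B_3 ⊂ B_2 ⊂ B_1 ⊂ B_0 ⊂ (C^r)'` and `C^r ⊂ B_i'`, compatible with the embedding
`f ↦ (φ ↦ ∫ f φ)` of `C^r` in `(C^r)'`, with norms that increase with the index. -/
structure BanachScale (d r : ℕ) (B : Fin 4 → Type*) [∀ i, NormedAddCommGroup (B i)]
    [∀ i, NormedSpace ℝ (B i)] where
  toDistr : ∀ i, B i →ₗ[ℝ] Distr d r
  toDistr_injective : ∀ i, Function.Injective (toDistr i)
  toDistr_bounded : ∀ i, ∃ C : ℝ, ∀ (h : B i) (φ : torusFun d r),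
    |toDistr i h φ| ≤ C * ‖h‖ * crNorm r φ.1
  incl : ∀ i : Fin 3, B i.succ →L[ℝ] B i.castSucc
  toDistr_incl : ∀ (i : Fin 3) (h : B i.succ), toDistr i.castSucc (incl i h) = toDistr i.succ h
  norm_incl_le : ∀ (i : Fin 3) (h : B i.succ), ‖incl i h‖ ≤ ‖h‖
  ofFun : ∀ i, torusFun d r →ₗ[ℝ] B i
  toDistr_ofFun : ∀ (i : Fin 4) (f φ : torusFun d r),
    toDistr i (ofFun i f) φ = ∫ x, f.1 x * φ.1 x
  ofFun_bounded : ∀ i, ∃ C : ℝ, ∀ f : torusFun d r, ‖ofFun i f‖ ≤ C * crNorm r f.1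
  dense_ofFun : ∀ i, DenseRange (ofFun i)
  dense_dual : ∀ i, Dense {l : B i →L[ℝ] ℝ | ∃ φ : torusFun d r, ∀ h, l h = toDistr i h φ}

namespace BanachScale

variable {d r : ℕ} {B : Fin 4 → Type*} [∀ i, NormedAddCommGroup (B i)]
  [∀ i, NormedSpace ℝ (B i)]

/-- The elements of `B_i` with zero integral. For `i = 1` this is the space `V`. -/
def V (E : BanachScale d r B) (i : Fin 4) : Submodule ℝ (B i) where
  carrier := {f | (E.toDistr i f).mass = 0}
  add_mem' {f g} hf hg := by
    simp only [Distr.mass, mem_ofPred_eq] at hf hg ⊢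
    simp [hf, hg]
  zero_mem' := by simp [Distr.mass]
  smul_mem' c f hf := by
    simp only [Distr.mass, mem_ofPred_eq] at hf ⊢
    simp [hf]

/-- `A` is the restriction of the transfer operator `L_S` to `B_i`. -/
def IsTransferOp (E : BanachScale d r B) (i : Fin 4) (S : TorusMap d r) (A : B i →L[ℝ] B i) :
    Prop :=
  ∀ h, E.toDistr i (A h) = transfer S (E.toDistr i h)

open Classical in
/-- The restriction of `L_S` to `B_i`, as an element of `L(B_i, B_i)`; the value is `0` if `L_S`
does not restrict to a bounded operator. -/
def transferOp (E : BanachScale d r B) (i : Fin 4) (S : TorusMap d r) : B i →L[ℝ] B i :=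
  if h : ∃ A, E.IsTransferOp i S A then h.choose else 0

/-- The composition `L_{S_n} ⋯ L_{S_1}` on `B_i` for the list `[S_n, …, S_1]`. -/
def transferProd (E : BanachScale d r B) (i : Fin 4) (l : List (TorusMap d r)) : B i →L[ℝ] B i :=
  (l.map (E.transferOp i)).prod

/-- The set `W` of the elements `h ≥ 0` of `B_1` with `∫ h = 1` and norm at most `Ks`. -/
def W (E : BanachScale d r B) (Ks : ℝ) : Set (B 1) :=
  {h | ‖h‖ ≤ Ks ∧ (E.toDistr 1 h).Nonneg ∧ (E.toDistr 1 h).mass = 1}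

/-- `H(ν,h)`: the invariant probability measure of `T_{ν,h}` that belongs to `W`. -/
def H (E : BanachScale d r B) (P : CoupledSystem d) (Ks ν : ℝ) (h : B 1) : B 1 :=
  Classical.epsilon fun g : B 1 =>
    g ∈ E.W Ks ∧ transfer (P.map ν (E.toDistr 1 h)) (E.toDistr 1 g) = E.toDistr 1 g

/-- `F(ν,h) = h - H(ν,h)`. -/
def F (E : BanachScale d r B) (P : CoupledSystem d) (Ks ν : ℝ) (h : B 1) : B 1 :=
  h - E.H P Ks ν h

/-- `Θ(ν,h) = -(Id - L)⁻¹ div (L β H(ν,h))`, with `L` the transfer operator of `T_{ν,h}`: the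
element `θ` of `V` with `(Id - L) θ = -∑ₖ ∂ₖ L (βₖ H(ν,h))`. -/
def Theta (E : BanachScale d r B) (P : CoupledSystem d) (Ks ν : ℝ) (h : B 1) : E.V 1 :=
  Classical.epsilon fun θ : E.V 1 =>
    restrictDistr (E.toDistr 1 (θ : B 1) -
        transfer (P.map ν (E.toDistr 1 h)) (E.toDistr 1 (θ : B 1))) =
      -∑ k, partialDistr k (transfer (P.map ν (E.toDistr 1 h))
        (mulDistr (ofSmooth r (P.β k)) (E.toDistr 1 (E.H P Ks ν h))))

/-- The displacements `φ ∈ V` with `h + φ ∈ W`. -/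
def shiftedW (E : BanachScale d r B) (Ks : ℝ) (h : B 1) : Set (E.V 1) :=
  {φ | h + (φ : B 1) ∈ E.W Ks}

/-- `D_h F(ν,h)`: the Fréchet derivative at `h` of `F(ν,·) : W → B_1` (along `V`, as `W` lies in
an affine space directed by `V`). -/
def DhF (E : BanachScale d r B) (P : CoupledSystem d) (Ks ν : ℝ) (h : B 1) :
    E.V 1 →L[ℝ] B 1 :=
  fderivWithin ℝ (fun φ : E.V 1 => E.F P Ks ν (h + (φ : B 1))) (E.shiftedW Ks h) 0

/-- `D_ν F(ν,h)`: the derivative at `ν` of `F(·,h) : [0,ν_*] → B_1`. -/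
def DnuF (E : BanachScale d r B) (P : CoupledSystem d) (Ks νs ν : ℝ) (h : B 1) : B 1 :=
  derivWithin (fun ν' : ℝ => E.F P Ks ν' h) (Icc 0 νs) ν

/-- `D_h² F(ν,h)`: the second Fréchet derivative at `h` of `F(ν,·)`, seen as a map from `W` to
`B_0`. -/
def D2hF (E : BanachScale d r B) (P : CoupledSystem d) (Ks ν : ℝ) (h : B 1) :
    E.V 1 →L[ℝ] E.V 1 →L[ℝ] B 0 :=
  fderivWithin ℝ (fderivWithin ℝ
    (fun φ : E.V 1 => (E.incl 0 (E.F P Ks ν (h + (φ : B 1))) : B 0)) (E.shiftedW Ks h))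
    (E.shiftedW Ks h) 0

/-- `D_h F(ν,h)` is an invertible operator from `V` to `V`. -/
def IsRegular (E : BanachScale d r B) (P : CoupledSystem d) (Ks ν : ℝ) (h : B 1) : Prop :=
  ∃ e : E.V 1 ≃L[ℝ] E.V 1, ∀ φ, ((e φ : E.V 1) : B 1) = E.DhF P Ks ν h φ

/-- The nondegenerate fold conditions:
`Range D_h F ⊕ ℝ D_ν F = V`, `∫ α D_h² F(Θ,Θ) ≠ 0` and `∫ α h ≠ 0`. -/
structure IsFold (E : BanachScale d r B) (P : CoupledSystem d) (Ks νs ν : ℝ) (h : B 1) :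
    Prop where
  disjoint : Disjoint (E.DhF P Ks ν h).range (Submodule.span ℝ {E.DnuF P Ks νs ν h})
  sup_eq : (E.DhF P Ks ν h).range ⊔ Submodule.span ℝ {E.DnuF P Ks νs ν h} = E.V 1
  second_order : E.toDistr 0 (E.D2hF P Ks ν h (E.Theta P Ks ν h) (E.Theta P Ks ν h))
    (ofSmooth r P.α) ≠ 0
  nontrivial : E.toDistr 1 h (ofSmooth r P.α) ≠ 0

/-- `h ∈ B_1` is a fixed point of the nonlinear transfer operator with parameter `ν`: `∫ h = 1`,
`T_{ν,h}` belongs to the class `𝒯` on which the transfer operators are controlled (which is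
automatic if `h` is a probability measure and `ν ∈ [0,ν_*]`), and `L_{T_{ν,h}} h = h`. -/
def IsFixed (E : BanachScale d r B) (P : CoupledSystem d) (𝒯 : Set (TorusMap d r)) (ν : ℝ)
    (h : B 1) : Prop :=
  (E.toDistr 1 h).mass = 1 ∧ P.map ν (E.toDistr 1 h) ∈ 𝒯 ∧
    P.nonlinearTransfer ν (E.toDistr 1 h) = E.toDistr 1 h

/-- The standing assumptions on the coupled system, on the class `𝒯` of maps and on the scale
of Banach spaces. -/
structure StandingAssumptions (E : BanachScale d r B) (P : CoupledSystem d)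
    (𝒯 : Set (TorusMap d r)) (νs Cs K θ : ℝ) (cbar chat nbar : ℕ) : Prop where
  νs_pos : 0 < νs
  one_le_Cs : 1 ≤ Cs
  one_le_K : 1 ≤ K
  θ_pos : 0 < θ
  θ_lt_one : θ < 1
  cbar_pos : 0 < cbar
  chat_pos : 0 < chat
  surj : ∀ S ∈ 𝒯, Function.Surjective S.toFun
  comp_mem : ∀ S ∈ 𝒯, ∀ S' ∈ 𝒯, S.comp S' ∈ 𝒯
  map_mem : ∀ ν ∈ Icc 0 νs, ∀ μ : Measure (UnitAddTorus (Fin d)), IsProbabilityMeasure μ →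
    P.shifted r (ν * ∫ x, P.α.1 x ∂μ) ∈ 𝒯
  transfer_bounded : ∀ S ∈ 𝒯, ∀ i, ∃ A, E.IsTransferOp i S A
  partial_bounded : ∀ (k : Fin d) (i : Fin 3), ∃ D : B i.succ →L[ℝ] B i.castSucc,
    ∀ h, restrictDistr (E.toDistr i.castSucc (D h)) = partialDistr k (E.toDistr i.succ h)
  mul_bounded : ∀ (i : Fin 4) (a : torusFun d r),
    a.1 ∈ torusFun d ((cbar * (i : ℕ) + chat : ℕ) : WithTop ℕ∞) →
    ∀ h : B i, ∃ g : B i, E.toDistr i g = mulDistr a (E.toDistr i h) ∧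
      ‖g‖ ≤ Cs * crNorm (cbar * (i : ℕ) + chat) a.1 * ‖h‖
  mass_bounded : ∀ h : B 0, |(E.toDistr 0 h).mass| ≤ Cs * ‖h‖
  compact_incl : ∀ i : Fin 3, IsCompactOperator (E.incl i)
  weak_bound : ∀ l : List (TorusMap d r), (∀ S ∈ l, S ∈ 𝒯) → ∀ φ : B 1,
    ‖E.transferProd 0 l (E.incl 0 φ)‖ ≤ Cs * ‖(E.incl 0 φ : B 0)‖
  lasota_yorke : ∀ l : List (TorusMap d r), (∀ S ∈ l, S ∈ 𝒯) → ∀ (i : Fin 3) (φ : B i.succ),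
    ‖E.transferProd i.succ l φ‖ ≤ Cs * θ ^ l.length * ‖φ‖ + K * ‖E.incl i φ‖
  contraction : ∀ l : List (TorusMap d r), (∀ S ∈ l, S ∈ 𝒯) → nbar ≤ l.length → ∀ i : Fin 3,
    ‖(E.transferProd i.succ l).comp (E.V i.succ).subtypeL‖ < θ ^ l.length

end BanachScale

end MeanField

end

/-!
The coupling is one-dimensional: `T_{ν,h}` depends on `h` only through the number `c = ν ∫ α h`, and
equals `S_c = T + c β`. By the contraction on elements of zero integral, `L_{S_c}` has exactly one
invariant element `h_c` of integral `1`, the limit of `L_{S_c}^n 1`; it lies in `B_3`, is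
nonnegative, and is bounded uniformly in `c` (`exists_invariant`). Hence `H(ν,h) = h_{ν ∫ α h}`, and
the fixed points for the parameter `ν` correspond to the solutions `c` of the scalar equation
`c = ν a(c)`, where `a(c) = ∫ α h_c`, with `c` in a compact interval `C` that contains `0`.

Linear response (`exists_linearResponse`, `LinearResponse.hasDerivWithinAt`,
`LinearResponse.hasDerivWithinAt_deriv`) shows that `c ↦ h_c` is differentiable into `B_1` with a
derivative that is differentiable into `B_0`. The transfer operators are differentiable in `c` with
the loss of one derivative, `∂_c L_{S_c} h = -∑ₖ ∂ₖ L_{S_c} (βₖ h)`. This is an identity between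
functionals on `C^(r+1)` only, and it determines an element of `B_i` because `C^(r+1)` is dense in
`C^r` (`exists_crNorm_sub_le`); norm estimates follow by testing against the functionals of `B_i'`
that are given by functions. The derivatives of `h_c` are then obtained from the inverse of
`Id - L_{S_c}` on `V`. That inverse is not bounded on `B_0`, where the second derivative lives:
there, its Neumann series is cut into a finite part, bounded in `B_0`, and a tail that is small
in `B_1`.

Consequently `D_h F(ν,h) φ = φ - ν (∫ α φ) h_c'` is a rank one perturbation of the identity, which
is invertible if and only if `1 ≠ ν a'(c)` (`isRegular_iff`), and `D_h² F(ν,h)(φ,φ)` is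
`-ν² (∫ α φ)² h_c''`, so that a fold has `a(c) ≠ 0` and `a''(c) ≠ 0` (`IsFold.ne_zero`). These Fréchet
derivatives within `W` are well defined as `W` spans a dense subspace (`uniqueDiffOn_shiftedW`).

It remains to study the scalar equation. Where `a(c) ≠ 0`, the solutions form the graph of
`ν = c / a(c)`, whose critical points are nondegenerate; if `a(0) = 0`, there is moreover the line
`c = 0`, which is isolated from the other solutions since a fold has `a(c) ≠ 0`. Compactness gives
finitely many curves (`ScalarProblem.exists_curves`). At a fold, `c - ν a(c)` has a strict extremum;
a small change of `ν` produces two zeros near it, and the signs of `c - ν a(c)` at the ends of `C`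
force a third one (`ScalarProblem.exists_three_solutions`).
-/

noncomputable section

namespace MeanField

open Filter Topology

/-! ### Analysis on the torus -/

theorem isOpenQuotientMap_toTorus {d : ℕ} : IsOpenQuotientMap (toTorus (d := d)) :=
  IsOpenQuotientMap.piMap fun _ => QuotientAddGroup.isOpenQuotientMap_mk

theorem continuous_toTorus {d : ℕ} : Continuous (toTorus (d := d)) :=
  isOpenQuotientMap_toTorus.continuous

theorem toTorus_sub {d : ℕ} (x y : Fin d → ℝ) : toTorus (x - y) = toTorus x - toTorus y := by
  funext k; simp [toTorus]

theorem continuous_of_mem_torusFun {d : ℕ} {n : WithTop ℕ∞} {f : UnitAddTorus (Fin d) → ℝ}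
    (hf : f ∈ torusFun d n) : Continuous f :=
  isOpenQuotientMap_toTorus.isQuotientMap.continuous_iff.2 (mem_torusFun.1 hf).continuous

theorem integrable_torus {d : ℕ} {f : UnitAddTorus (Fin d) → ℝ} (hf : Continuous f) :
    Integrable f :=
  hf.integrable_of_hasCompactSupport (HasCompactSupport.of_compactSpace f)

theorem uniformContinuous_toTorus {d : ℕ} : UniformContinuous (toTorus (d := d)) :=
  uniformContinuous_addMonoidHom_of_continuous (f := AddMonoidHom.mk' toTorus toTorus_add)
    continuous_toTorus

/-- A continuous `ℤ^d`-periodic function is uniformly continuous. -/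
theorem uniformContinuous_of_periodic {d : ℕ} {F : Type*} [NormedAddCommGroup F]
    {v : (Fin d → ℝ) → F} (hv : Continuous v) (hp : ∀ x y, toTorus x = toTorus y → v x = v y) :
    UniformContinuous v := by
  set v' : UnitAddTorus (Fin d) → F := fun t => v (Function.surjInv toTorus_surjective t)
  have h : v' ∘ toTorus = v := funext fun x =>
    hp _ _ (Function.surjInv_eq toTorus_surjective (toTorus x))
  have hv' : Continuous v' := by
    rw [isOpenQuotientMap_toTorus.isQuotientMap.continuous_iff, h]; exact hv
  rw [← h]
  exact (CompactSpace.uniformContinuous_of_continuous hv').comp uniformContinuous_toTorus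

theorem iteratedFDeriv_periodic {d : ℕ} (f : UnitAddTorus (Fin d) → ℝ) (m : ℕ)
    (x y : Fin d → ℝ) (h : toTorus x = toTorus y) :
    iteratedFDeriv ℝ m (fun z => f (toTorus z)) x =
      iteratedFDeriv ℝ m (fun z => f (toTorus z)) y := by
  have h0 : (fun z : Fin d → ℝ => f (toTorus (z + (y - x)))) = fun z => f (toTorus z) := by
    funext z; rw [toTorus_add, toTorus_sub, h, sub_self, add_zero]
  have h1 := iteratedFDeriv_comp_add_right (𝕜 := ℝ)
    (f := fun z : Fin d → ℝ => f (toTorus z)) m (y - x) x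
  rw [h0] at h1
  rw [h1]; congr 1; abel

open scoped Convolution in
/-- Convolution with a compactly supported kernel commutes with differentiation, without any decay
of the function that is differentiated. -/
theorem fderiv_convolution_of_kernel {d : ℕ} {F : Type*} [NormedAddCommGroup F] [NormedSpace ℝ F]
    [CompleteSpace F] {ρ : (Fin d → ℝ) → ℝ} (hρ : Continuous ρ) (hc : HasCompactSupport ρ)
    {v : (Fin d → ℝ) → F} (hv : ContDiff ℝ 1 v) :
    fderiv ℝ (ρ ⋆[ContinuousLinearMap.lsmul ℝ ℝ] v) =
      ρ ⋆[ContinuousLinearMap.lsmul ℝ ℝ] (fderiv ℝ v) := by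
  funext x
  have hv' : Continuous (fderiv ℝ v) := hv.continuous_fderiv (by simp)
  have hcpt : IsCompact ((fun p : (Fin d → ℝ) × (Fin d → ℝ) => p.1 - p.2) ''
      (Metric.closedBall x 1 ×ˢ tsupport ρ)) :=
    ((isCompact_closedBall x 1).prod hc).image (by fun_prop)
  obtain ⟨M, hM⟩ := hcpt.exists_bound_of_continuousOn hv'.continuousOn
  have hint : ∀ {G : Type _} [NormedAddCommGroup G] [NormedSpace ℝ G] (u : (Fin d → ℝ) → G),
      Continuous u → ∀ x, Integrable fun y => ρ y • u (x - y) := by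
    intro G _ _ u hu x
    refine Continuous.integrable_of_hasCompactSupport (by fun_prop) ?_
    exact hc.smul_right
  refine HasFDerivAt.fderiv ?_
  refine hasFDerivAt_integral_of_dominated_of_fderiv_le (F := fun x y => ρ y • v (x - y))
    (F' := fun x y => ρ y • fderiv ℝ v (x - y)) (bound := fun y => ‖ρ y‖ * M)
    (Metric.ball_mem_nhds x one_pos) (Eventually.of_forall fun z => ?_) (hint v hv.continuous x)
    (hint _ hv' x).aestronglyMeasurable (Eventually.of_forall fun y z hz => ?_) ?_
    (Eventually.of_forall fun y z _ => ?_)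
  · exact (hint v hv.continuous z).aestronglyMeasurable
  · rw [norm_smul]
    by_cases hy : y ∈ tsupport ρ
    · exact mul_le_mul_of_nonneg_left
        (hM _ ⟨(z, y), ⟨Metric.ball_subset_closedBall hz, hy⟩, rfl⟩) (norm_nonneg _)
    · simp [image_eq_zero_of_notMem_tsupport hy]
  · exact ((hρ.integrable_of_hasCompactSupport hc).norm).mul_const M
  · have h1 : HasFDerivAt v (fderiv ℝ v (z - y)) (z - y) :=
      ((hv.differentiable (by simp)) _).hasFDerivAt
    have h2 := h1.comp z ((hasFDerivAt_id z).sub_const y)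
    rw [ContinuousLinearMap.comp_id] at h2
    exact h2.const_smul (ρ y)

open scoped Convolution in
theorem iteratedFDeriv_convolution_of_kernel {d : ℕ} {F : Type*} [NormedAddCommGroup F]
    [NormedSpace ℝ F] [CompleteSpace F] {ρ : (Fin d → ℝ) → ℝ} (hρ : Continuous ρ)
    (hc : HasCompactSupport ρ) {v : (Fin d → ℝ) → F} (m : ℕ) (hv : ContDiff ℝ m v) :
    iteratedFDeriv ℝ m (ρ ⋆[ContinuousLinearMap.lsmul ℝ ℝ] v) =
      ρ ⋆[ContinuousLinearMap.lsmul ℝ ℝ] (iteratedFDeriv ℝ m v) := by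
  have key : ∀ {G G' : Type _} [NormedAddCommGroup G] [NormedSpace ℝ G] [CompleteSpace G]
      [NormedAddCommGroup G'] [NormedSpace ℝ G'] [CompleteSpace G'] (e : G ≃ₗᵢ[ℝ] G')
      (u : (Fin d → ℝ) → G), Continuous u →
      (e ∘ (ρ ⋆[ContinuousLinearMap.lsmul ℝ ℝ] u)) =
        ρ ⋆[ContinuousLinearMap.lsmul ℝ ℝ] (e ∘ u) := by
    intro G G' _ _ _ _ _ _ e u _
    funext x
    have := (e.toContinuousLinearEquiv.integral_comp_comm (μ := volume)
      fun y => ρ y • u (x - y))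
    simpa [convolution] using this.symm
  induction m with
  | zero =>
    rw [iteratedFDeriv_zero_eq_comp, iteratedFDeriv_zero_eq_comp]
    exact key _ v hv.continuous
  | succ m ih =>
    rw [iteratedFDeriv_succ_eq_comp_left, ih (hv.of_le (by norm_cast; omega)),
      fderiv_convolution_of_kernel hρ hc (hv.iteratedFDeriv_right (by norm_cast; omega)),
      iteratedFDeriv_succ_eq_comp_left]
    exact key _ _ ((hv.iteratedFDeriv_right (m := 1) (by norm_cast; omega)).continuous_fderiv
      (by simp))

open scoped Convolution in
/-- Functions of class `C^(r+1)` are dense in `C^r`, by mollification. -/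
theorem exists_crNorm_sub_le {d r : ℕ} (φ : torusFun d r) {ε : ℝ} (hε : 0 < ε) :
    ∃ ψ : torusFun d ((r + 1 : ℕ) : WithTop ℕ∞), crNorm r (φ - lowerFun d r ψ).1 ≤ ε := by
  set f : (Fin d → ℝ) → ℝ := fun x => φ.1 (toTorus x) with hf
  have hfr : ContDiff ℝ r f := φ.2
  have huc : ∀ m : Fin (r + 1), ∃ δ > 0, ∀ x y, dist x y < δ →
      dist (iteratedFDeriv ℝ (m : ℕ) f x) (iteratedFDeriv ℝ (m : ℕ) f y) < ε := fun m =>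
    Metric.uniformContinuous_iff.1 (uniformContinuous_of_periodic
      (hfr.continuous_iteratedFDeriv (by exact_mod_cast m.is_le))
      (iteratedFDeriv_periodic φ.1 m)) ε hε
  choose δ hδ hδ' using huc
  obtain ⟨δ0, hδ0, hle⟩ : ∃ δ0 > 0, ∀ m, δ0 ≤ δ m := by
    obtain ⟨m0, hm0⟩ := Finite.exists_min δ
    exact ⟨δ m0, hδ m0, hm0⟩
  let b : ContDiffBump (0 : Fin d → ℝ) := ⟨δ0 / 2, δ0, by positivity, by linarith⟩
  set ρ : (Fin d → ℝ) → ℝ := b.normed volume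
  have hρ : ContDiff ℝ ∞ ρ := b.contDiff_normed
  have hc : HasCompactSupport ρ := b.hasCompactSupport_normed
  let g : UnitAddTorus (Fin d) → ℝ := fun t => ∫ y, ρ y * φ.1 (t - toTorus y)
  have hg : (fun x => g (toTorus x)) = ρ ⋆[ContinuousLinearMap.lsmul ℝ ℝ] f := by
    funext x; simp [g, f, convolution, toTorus_sub]
  have hgC : ContDiff ℝ ∞ (fun x => g (toTorus x)) := by
    rw [hg]
    exact hc.contDiff_convolution_left _ hρ hfr.continuous.locallyIntegrable
  refine ⟨⟨g, mem_torusFun.2 (hgC.of_le (by exact_mod_cast le_top))⟩, ?_⟩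
  refine ciSup_le fun p => ?_
  have h1 : ContDiff ℝ (p.1 : ℕ) f := hfr.of_le (by exact_mod_cast p.1.is_le)
  have h2 : ContDiff ℝ (p.1 : ℕ) (fun x => g (toTorus x)) :=
    hgC.of_le (by exact_mod_cast le_top)
  have h3 : (fun x : Fin d → ℝ => (φ - lowerFun d r ⟨g, mem_torusFun.2
      (hgC.of_le (by exact_mod_cast le_top))⟩).1 (toTorus x)) =
      f - fun x => g (toTorus x) := rfl
  rw [h3, iteratedFDeriv_sub_apply h1.contDiffAt h2.contDiffAt, hg,
    iteratedFDeriv_convolution_of_kernel hρ.continuous hc _ h1, ← dist_eq_norm, dist_comm]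
  refine ContDiffBump.dist_normed_convolution_le
    (h1.continuous_iteratedFDeriv le_rfl).aestronglyMeasurable fun x hx => ?_
  exact (hδ' p.1 x p.2 (lt_of_lt_of_le hx (hle _))).le

theorem TorusMap.continuous {d : ℕ} {n : WithTop ℕ∞} (S : TorusMap d n) : Continuous S.toFun := by
  obtain ⟨A, hA, hA'⟩ := S.exists_lift
  rw [isOpenQuotientMap_toTorus.isQuotientMap.continuous_iff]
  have : S.toFun ∘ toTorus = toTorus ∘ A := funext hA'
  rw [this]
  exact continuous_toTorus.comp hA.continuous

theorem hasDerivAt_comp_shifted {d r : ℕ} (P : CoupledSystem d)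
    (φ : torusFun d ((r + 1 : ℕ) : WithTop ℕ∞)) (t : UnitAddTorus (Fin d)) (s : ℝ) :
    HasDerivAt (fun s : ℝ => φ.1 ((P.shifted r s).toFun t))
      (∑ k, (P.β k).1 t * (partialFun k φ).1 ((P.shifted r s).toFun t)) s := by
  obtain ⟨z, hz⟩ := toTorus_surjective (P.T.toFun t)
  set b : Fin d → ℝ := fun k => (P.β k).1 t
  set f : (Fin d → ℝ) → ℝ := fun x => φ.1 (toTorus x) with hf
  have hS : ∀ s : ℝ, (P.shifted r s).toFun t = toTorus (z + s • b) := by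
    intro s
    rw [toTorus_add, hz]; rfl
  have hfC : ContDiff ℝ ((r + 1 : ℕ) : WithTop ℕ∞) f := φ.2
  have h1 : HasFDerivAt f (fderiv ℝ f (z + s • b)) (z + s • b) :=
    ((hfC.differentiable (by simp)) _).hasFDerivAt
  have h2 : HasDerivAt (fun s : ℝ => z + s • b) b s := by
    simpa using ((hasDerivAt_id s).smul_const b).const_add z
  have h3 := h1.comp_hasDerivAt s h2
  have h4 : ∀ k, (partialFun k φ).1 (toTorus (z + s • b)) =
      fderiv ℝ f (z + s • b) (Pi.single k 1) := fun k =>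
    (hasDerivAt_partial k φ (z + s • b)).deriv
  have h5 : fderiv ℝ f (z + s • b) b =
      ∑ k, b k * (partialFun k φ).1 (toTorus (z + s • b)) := by
    refine (congrArg (fderiv ℝ f (z + s • b)) (pi_eq_sum_univ' b)).trans ?_
    simp only [h4, map_sum, map_smul, smul_eq_mul]
  rw [h5] at h3
  simp only [hS]
  exact h3

theorem hasDerivAt_integral_comp_shifted {d r : ℕ} (P : CoupledSystem d) (f : torusFun d r)
    (φ : torusFun d ((r + 1 : ℕ) : WithTop ℕ∞)) (s : ℝ) :
    HasDerivAt (fun s : ℝ => ∫ t, f.1 t * φ.1 ((P.shifted r s).toFun t))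
      (∑ k, ∫ t, f.1 t * ((P.β k).1 t * (partialFun k φ).1 ((P.shifted r s).toFun t))) s := by
  have hfc := continuous_of_mem_torusFun f.2
  have hφc := continuous_of_mem_torusFun φ.2
  have hβc := fun k => continuous_of_mem_torusFun (P.β k).2
  have hpc := fun k => continuous_of_mem_torusFun (partialFun (r := r) k φ).2
  have hSc := fun s => (P.shifted r s).continuous
  have hc : ∀ s k, Continuous fun t =>
      f.1 t * ((P.β k).1 t * (partialFun k φ).1 ((P.shifted r s).toFun t)) := fun s k =>
    hfc.mul ((hβc k).mul ((hpc k).comp (hSc s)))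
  rw [← integral_finsetSum _ fun k _ => integrable_torus (hc s k)]
  have hb : ∀ u : UnitAddTorus (Fin d) → ℝ, Continuous u → ∃ M, ∀ t, ‖u t‖ ≤ M := fun u hu => by
    obtain ⟨M, hM⟩ := isCompact_univ.exists_bound_of_continuousOn hu.continuousOn
    exact ⟨M, fun t => hM t (mem_univ _)⟩
  obtain ⟨M1, hM1⟩ := hb _ hfc
  choose M2 hM2 using fun k => hb _ (hβc k)
  choose M3 hM3 using fun k => hb _ (hpc k)
  refine (hasDerivAt_integral_of_dominated_loc_of_deriv_le (μ := volume)
    (F := fun s t => f.1 t * φ.1 ((P.shifted r s).toFun t))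
    (F' := fun s t => ∑ k, f.1 t * ((P.β k).1 t * (partialFun k φ).1 ((P.shifted r s).toFun t)))
    (bound := fun _ => ∑ k, M1 * (M2 k * M3 k)) (s := univ) univ_mem
    (Eventually.of_forall fun s => (hfc.mul (hφc.comp (hSc s))).aestronglyMeasurable)
    (integrable_torus (hfc.mul (hφc.comp (hSc s))))
    (continuous_finsetSum _ fun k _ => hc s k).aestronglyMeasurable
    (Eventually.of_forall fun t s _ => ?_) (integrable_const _)
    (Eventually.of_forall fun t s _ => ?_)).2
  · refine (norm_sum_le _ _).trans (Finset.sum_le_sum fun k _ => ?_)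
    rw [norm_mul, norm_mul]
    have := (norm_nonneg _).trans (hM1 t)
    have := (norm_nonneg _).trans (hM2 k t)
    gcongr
    exacts [hM1 t, hM2 k t, hM3 k _]
  · rw [← Finset.mul_sum]
    exact (hasDerivAt_comp_shifted P φ t s).const_mul _

namespace BanachScale

variable {d r : ℕ} {B : Fin 4 → Type*} [∀ i, NormedAddCommGroup (B i)] [∀ i, NormedSpace ℝ (B i)]

/-! ### Test functions as elements of the dual spaces -/

theorem crNorm_nonneg {m : ℕ} (f : UnitAddTorus (Fin d) → ℝ) : 0 ≤ crNorm m f :=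
  Real.iSup_nonneg fun _ => norm_nonneg _

/-- The functional `h ↦ ∫ φ h` on `B_i`. -/
def testFun (E : BanachScale d r B) (i : Fin 4) (φ : torusFun d r) : B i →L[ℝ] ℝ :=
  LinearMap.mkContinuousOfExistsBound ((E.toDistr i).flip φ) (by
    obtain ⟨C, hC⟩ := E.toDistr_bounded i
    exact ⟨C * crNorm r φ.1, fun h => (hC h φ).trans_eq (by ring)⟩)

@[simp] theorem testFun_apply (E : BanachScale d r B) (i : Fin 4) (φ : torusFun d r) (h : B i) :
    E.testFun i φ h = E.toDistr i h φ := rfl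

/-- Test functions with one more derivative are still dense in the dual of `B_i`. -/
theorem dense_testFun (E : BanachScale d r B) (i : Fin 4) :
    Dense (range fun ψ : torusFun d ((r + 1 : ℕ) : WithTop ℕ∞) =>
      E.testFun i (lowerFun d r ψ)) := by
  rw [← dense_closure]
  refine (E.dense_dual i).mono ?_
  rintro l ⟨φ, hφ⟩
  have hl : l = E.testFun i φ := ContinuousLinearMap.ext hφ
  obtain ⟨C, hC⟩ := E.toDistr_bounded i
  rw [hl, Metric.mem_closure_range_iff]
  intro ε hε
  obtain ⟨ψ, hψ⟩ := exists_crNorm_sub_le φ (ε := ε / (2 * (|C| + 1))) (by positivity)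
  refine ⟨ψ, ?_⟩
  rw [dist_eq_norm]
  refine lt_of_le_of_lt (ContinuousLinearMap.opNorm_le_bound _ (half_pos hε).le fun h => ?_)
    (half_lt_self hε)
  have h1 : (E.testFun i φ - E.testFun i (lowerFun d r ψ)) h =
      E.toDistr i h (φ - lowerFun d r ψ) := by simp
  rw [h1, Real.norm_eq_abs]
  calc _ ≤ C * ‖h‖ * crNorm r (φ - lowerFun d r ψ).1 := hC _ _
    _ ≤ (|C| + 1) * ‖h‖ * (ε / (2 * (|C| + 1))) := by
        have := crNorm_nonneg (m := r) (φ - lowerFun d r ψ).1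
        gcongr
        linarith [le_abs_self C]
    _ = ε / 2 * ‖h‖ := by field_simp

theorem norm_le_of_testFun_le (E : BanachScale d r B) {i : Fin 4} {u : B i} {b : ℝ} (hb : 0 ≤ b)
    (h : ∀ ψ : torusFun d ((r + 1 : ℕ) : WithTop ℕ∞),
      |E.testFun i (lowerFun d r ψ) u| ≤ ‖E.testFun i (lowerFun d r ψ)‖ * b) : ‖u‖ ≤ b := by
  refine NormedSpace.norm_le_dual_bound ℝ u hb fun l => ?_
  have hcl : IsClosed {l : StrongDual ℝ (B i) | ‖l u‖ ≤ b * ‖l‖} :=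
    isClosed_le (by fun_prop) (by fun_prop)
  have := (E.dense_testFun i).closure_eq ▸ mem_univ l
  refine closure_minimal ?_ hcl this
  rintro _ ⟨ψ, rfl⟩
  exact (h ψ).trans_eq (mul_comm _ _)

theorem eq_of_restrictDistr_eq (E : BanachScale d r B) {i : Fin 4} {u v : B i}
    (h : restrictDistr (E.toDistr i u) = restrictDistr (E.toDistr i v)) : u = v := by
  rw [← sub_eq_zero, ← norm_le_zero_iff]
  refine E.norm_le_of_testFun_le le_rfl fun ψ => ?_
  have h1 : E.toDistr i u (lowerFun d r ψ) = E.toDistr i v (lowerFun d r ψ) :=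
    LinearMap.congr_fun h ψ
  simp [h1]

/-! ### Operators on the scale -/

open Classical in
/-- Multiplication by `a` on `B_i`; the value is `0` if it is not a bounded operator. -/
def mulOp (E : BanachScale d r B) (i : Fin 4) (a : torusFun d r) : B i →L[ℝ] B i :=
  if h : ∃ A : B i →L[ℝ] B i, ∀ h, E.toDistr i (A h) = mulDistr a (E.toDistr i h) then h.choose
  else 0

open Classical in
/-- The partial derivative `∂ₖ : B_{i+1} → B_i`; the value is `0` if it is not a bounded
operator. -/
def partialOp (E : BanachScale d r B) (k : Fin d) (i : Fin 3) : B i.succ →L[ℝ] B i.castSucc :=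
  if h : ∃ D : B i.succ →L[ℝ] B i.castSucc,
    ∀ h, restrictDistr (E.toDistr i.castSucc (D h)) = partialDistr k (E.toDistr i.succ h)
  then h.choose else 0

/-- The transfer operator on `B_i` of the map `T + c β`. -/
def lop (E : BanachScale d r B) (P : CoupledSystem d) (i : Fin 4) (c : ℝ) : B i →L[ℝ] B i :=
  E.transferOp i (P.shifted r c)

/-- The derivative in `c` of the transfer operator of `T + c β`, from `B_{i+1}` to `B_i`. It is
`h ↦ -∑ₖ ∂ₖ L_c (βₖ h)`. -/
def derivOp (E : BanachScale d r B) (P : CoupledSystem d) (i : Fin 3) (c : ℝ) :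
    B i.succ →L[ℝ] B i.castSucc :=
  -∑ k, (E.partialOp k i).comp
    ((E.lop P i.succ c).comp (E.mulOp i.succ (ofSmooth r (P.β k))))

section

variable {E : BanachScale d r B} {P : CoupledSystem d} {𝒯 : Set (TorusMap d r)}
  {νs Cs K θ : ℝ} {cbar chat nbar : ℕ}

theorem toDistr_transferOp (hA : E.StandingAssumptions P 𝒯 νs Cs K θ cbar chat nbar)
    {S : TorusMap d r} (hS : S ∈ 𝒯) (i : Fin 4) (h : B i) :
    E.toDistr i (E.transferOp i S h) = transfer S (E.toDistr i h) := by
  have := hA.transfer_bounded S hS i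
  rw [transferOp, dif_pos this]
  exact this.choose_spec h

theorem toDistr_mulOp (hA : E.StandingAssumptions P 𝒯 νs Cs K θ cbar chat nbar)
    (i : Fin 4) (a : torusFun d ∞) (h : B i) :
    E.toDistr i (E.mulOp i (ofSmooth r a) h) = mulDistr (ofSmooth r a) (E.toDistr i h) := by
  have hex : ∃ A : B i →L[ℝ] B i,
      ∀ h, E.toDistr i (A h) = mulDistr (ofSmooth r a) (E.toDistr i h) := by
    choose g hg hg' using hA.mul_bounded i (ofSmooth r a)
      (torusFun_mono (by exact_mod_cast le_top) a.2)
    refine ⟨LinearMap.mkContinuous ⟨⟨g, fun h h' => ?_⟩, fun c h => ?_⟩ _ hg', hg⟩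
    · refine E.toDistr_injective i ?_
      simp only [map_add, hg]
      rfl
    · refine E.toDistr_injective i ?_
      simp only [map_smul, hg]
      rfl
  rw [mulOp, dif_pos hex]
  exact hex.choose_spec h

theorem restrictDistr_partialOp (hA : E.StandingAssumptions P 𝒯 νs Cs K θ cbar chat nbar)
    (k : Fin d) (i : Fin 3) (h : B i.succ) :
    restrictDistr (E.toDistr i.castSucc (E.partialOp k i h)) =
      partialDistr k (E.toDistr i.succ h) := by
  have := hA.partial_bounded k i
  rw [partialOp, dif_pos this]
  exact this.choose_spec h

theorem incl_transferOp (hA : E.StandingAssumptions P 𝒯 νs Cs K θ cbar chat nbar)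
    {S : TorusMap d r} (hS : S ∈ 𝒯) (i : Fin 3) (h : B i.succ) :
    E.incl i (E.transferOp i.succ S h) = E.transferOp i.castSucc S (E.incl i h) := by
  refine E.toDistr_injective _ ?_
  rw [E.toDistr_incl, toDistr_transferOp hA hS, toDistr_transferOp hA hS, E.toDistr_incl]

theorem incl_mulOp (hA : E.StandingAssumptions P 𝒯 νs Cs K θ cbar chat nbar)
    (i : Fin 3) (a : torusFun d ∞) (h : B i.succ) :
    E.incl i (E.mulOp i.succ (ofSmooth r a) h) =
      E.mulOp i.castSucc (ofSmooth r a) (E.incl i h) := by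
  refine E.toDistr_injective _ ?_
  rw [E.toDistr_incl, toDistr_mulOp hA, toDistr_mulOp hA, E.toDistr_incl]

theorem toDistr_derivOp (hA : E.StandingAssumptions P 𝒯 νs Cs K θ cbar chat nbar)
    {c : ℝ} (hc : P.shifted r c ∈ 𝒯) (i : Fin 3) (h : B i.succ)
    (ψ : torusFun d ((r + 1 : ℕ) : WithTop ℕ∞)) :
    E.toDistr i.castSucc (E.derivOp P i c h) (lowerFun d r ψ) =
      ∑ k, E.toDistr i.succ h
        (mulFun (ofSmooth r (P.β k)) (compFun (P.shifted r c) (partialFun k ψ))) := by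
  have h1 : ∀ k, E.toDistr i.castSucc (E.partialOp k i (E.lop P i.succ c
      (E.mulOp i.succ (ofSmooth r (P.β k)) h))) (lowerFun d r ψ) = -E.toDistr i.succ h
        (mulFun (ofSmooth r (P.β k)) (compFun (P.shifted r c) (partialFun k ψ))) := by
    intro k
    have h2 := LinearMap.congr_fun (restrictDistr_partialOp hA k i (E.lop P i.succ c
      (E.mulOp i.succ (ofSmooth r (P.β k)) h))) ψ
    rw [lop, toDistr_transferOp hA hc, toDistr_mulOp hA] at h2
    exact h2
  simp [derivOp, h1]

/-- The operators `derivOp` on consecutive spaces agree: their values on test functions in `C^(r+1)`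
are given by the same formula. -/
theorem incl_derivOp_one (hA : E.StandingAssumptions P 𝒯 νs Cs K θ cbar chat nbar)
    {c : ℝ} (hc : P.shifted r c ∈ 𝒯) (h : B 2) :
    (E.incl 0 (E.derivOp P 1 c h) : B 0) = E.derivOp P 0 c (E.incl 1 h) := by
  refine E.eq_of_restrictDistr_eq (i := 0) (LinearMap.ext fun ψ => ?_)
  have h1 := toDistr_derivOp hA hc 0 (E.incl 1 h) ψ
  have h2 := toDistr_derivOp hA hc 1 h ψ
  have h3 := E.toDistr_incl 0 (E.derivOp P 1 c h)
  have h4 := E.toDistr_incl 1 h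
  refine (LinearMap.congr_fun h3 (lowerFun d r ψ)).trans (h2.trans (Eq.trans ?_ h1.symm))
  exact Finset.sum_congr rfl fun k _ => (LinearMap.congr_fun h4 _).symm

theorem incl_derivOp_two (hA : E.StandingAssumptions P 𝒯 νs Cs K θ cbar chat nbar)
    {c : ℝ} (hc : P.shifted r c ∈ 𝒯) (h : B 3) :
    (E.incl 1 (E.derivOp P 2 c h) : B 1) = E.derivOp P 1 c (E.incl 2 h) := by
  refine E.eq_of_restrictDistr_eq (i := 1) (LinearMap.ext fun ψ => ?_)
  have h1 := toDistr_derivOp hA hc 1 (E.incl 2 h) ψ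
  have h2 := toDistr_derivOp hA hc 2 h ψ
  have h3 := E.toDistr_incl 1 (E.derivOp P 2 c h)
  have h4 := E.toDistr_incl 2 h
  refine (LinearMap.congr_fun h3 (lowerFun d r ψ)).trans (h2.trans (Eq.trans ?_ h1.symm))
  exact Finset.sum_congr rfl fun k _ => (LinearMap.congr_fun h4 _).symm

theorem mass_derivOp_one (hA : E.StandingAssumptions P 𝒯 νs Cs K θ cbar chat nbar)
    {c : ℝ} (hc : P.shifted r c ∈ 𝒯) (i : Fin 3) (h : B i.succ) :
    (E.toDistr i.castSucc (E.derivOp P i c h)).mass = 0 := by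
  have h1 := toDistr_derivOp hA hc i h ⟨fun _ => 1, mem_torusFun.2 contDiff_const⟩
  refine h1.trans (Finset.sum_eq_zero fun k _ => ?_)
  have h2 : mulFun (ofSmooth r (P.β k)) (compFun (P.shifted r c) (partialFun k
      (⟨fun _ => 1, mem_torusFun.2 contDiff_const⟩ :
        torusFun d ((r + 1 : ℕ) : WithTop ℕ∞)))) = 0 := by
    refine Subtype.ext (funext fun t => ?_)
    change _ * partialDeriv k (fun _ => (1 : ℝ)) ((P.shifted r c).toFun t) = 0
    simp [partialDeriv]
  rw [h2, map_zero]

/-! ### Dependence of the transfer operators on the parameter -/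

/-- For a function `f`, the pairing `c ↦ ∫ ψ · L_c f` is differentiable with derivative
`∫ ψ · D_c f`. -/
theorem hasDerivAt_toDistr_lop (hA : E.StandingAssumptions P 𝒯 νs Cs K θ cbar chat nbar)
    {C : Set ℝ} (hC : ∀ c ∈ C, P.shifted r c ∈ 𝒯) (i : Fin 3) (f : torusFun d r)
    (ψ : torusFun d ((r + 1 : ℕ) : WithTop ℕ∞)) {c : ℝ} (hc : c ∈ C) :
    HasDerivWithinAt (fun s => E.testFun i.castSucc (lowerFun d r ψ)
        (E.incl i (E.lop P i.succ s (E.ofFun i.succ f))))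
      (E.testFun i.castSucc (lowerFun d r ψ) (E.derivOp P i c (E.ofFun i.succ f))) C c := by
  have h1 := (hasDerivAt_integral_comp_shifted P f ψ c).hasDerivWithinAt (s := C)
  rw [testFun_apply, toDistr_derivOp hA (hC c hc)]
  have h2 : ∀ k, E.toDistr i.succ (E.ofFun i.succ f)
        (mulFun (ofSmooth r (P.β k)) (compFun (P.shifted r c) (partialFun k ψ))) =
      ∫ t, f.1 t * ((P.β k).1 t * (partialFun k ψ).1 ((P.shifted r c).toFun t)) := fun k => by
    rw [E.toDistr_ofFun]; rfl
  simp only [h2]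
  have h3 : ∀ s ∈ C, E.testFun i.castSucc (lowerFun d r ψ)
        (E.incl i (E.lop P i.succ s (E.ofFun i.succ f))) =
      ∫ t, f.1 t * ψ.1 ((P.shifted r s).toFun t) := fun s hs => by
    rw [testFun_apply, E.toDistr_incl, lop, toDistr_transferOp hA (hC s hs)]
    exact E.toDistr_ofFun _ f _
  exact h1.congr h3 (h3 c hc)

/-- The transfer operators are Lipschitz in `c`, with the loss of one derivative. -/
theorem norm_lop_sub_le (hA : E.StandingAssumptions P 𝒯 νs Cs K θ cbar chat nbar)
    {C : Set ℝ} (hC : ∀ c ∈ C, P.shifted r c ∈ 𝒯) (hconv : Convex ℝ C) (i : Fin 3) {M : ℝ}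
    (hM : 0 ≤ M) (hD : ∀ c ∈ C, ∀ h, ‖E.derivOp P i c h‖ ≤ M * ‖h‖)
    {c c' : ℝ} (hc : c ∈ C) (hc' : c' ∈ C) (h : B i.succ) :
    ‖E.incl i (E.lop P i.succ c' h) - E.incl i (E.lop P i.succ c h)‖ ≤ M * |c' - c| * ‖h‖ := by
  refine (isClosed_le (f := fun h =>
    ‖E.incl i (E.lop P i.succ c' h) - E.incl i (E.lop P i.succ c h)‖)
    (g := fun h => M * |c' - c| * ‖h‖) (by fun_prop) (by fun_prop)).closure_subset_iff.2 ?_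
    ((E.dense_ofFun i.succ).closure_eq ▸ mem_univ h)
  rintro _ ⟨f, rfl⟩
  refine E.norm_le_of_testFun_le (by positivity) fun ψ => ?_
  have := Convex.norm_image_sub_le_of_norm_hasDerivWithin_le
    (C := ‖E.testFun i.castSucc (lowerFun d r ψ)‖ * (M * ‖E.ofFun i.succ f‖))
    (fun s hs => hasDerivAt_toDistr_lop hA hC i f ψ hs) (fun s hs => ?_) hconv hc hc'
  · rw [map_sub]
    refine this.trans_eq ?_
    rw [Real.norm_eq_abs]; ring
  · exact (ContinuousLinearMap.le_opNorm _ _).trans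
      (mul_le_mul_of_nonneg_left (hD s hs _) (norm_nonneg _))

/-- The second order Taylor estimate of `c ↦ L_c`, on a space `Z` on which `D_c` is Lipschitz in
`c`. -/
theorem norm_lop_sub_sub_le (hA : E.StandingAssumptions P 𝒯 νs Cs K θ cbar chat nbar)
    {C : Set ℝ} (hC : ∀ c ∈ C, P.shifted r c ∈ 𝒯) (hconv : Convex ℝ C) (i : Fin 3)
    {Z : Type*} [NormedAddCommGroup Z] [NormedSpace ℝ Z] (j : Z →L[ℝ] B i.succ)
    {e : torusFun d r → Z} (he : DenseRange e) (hj : ∀ f, j (e f) = E.ofFun i.succ f)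
    {M : ℝ} (hM : 0 ≤ M)
    (hD : ∀ c ∈ C, ∀ c' ∈ C, ∀ z,
      ‖E.derivOp P i c' (j z) - E.derivOp P i c (j z)‖ ≤ M * |c' - c| * ‖z‖)
    {c c' : ℝ} (hc : c ∈ C) (hc' : c' ∈ C) (z : Z) :
    ‖E.incl i (E.lop P i.succ c' (j z)) - E.incl i (E.lop P i.succ c (j z)) -
      (c' - c) • E.derivOp P i c (j z)‖ ≤ M * (c' - c) ^ 2 * ‖z‖ := by
  refine (isClosed_le (f := fun z =>
    ‖E.incl i (E.lop P i.succ c' (j z)) - E.incl i (E.lop P i.succ c (j z)) -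
      (c' - c) • E.derivOp P i c (j z)‖)
    (g := fun z => M * (c' - c) ^ 2 * ‖z‖) (by fun_prop) (by fun_prop)).closure_subset_iff.2 ?_
    (he.closure_eq ▸ mem_univ z)
  rintro _ ⟨f, rfl⟩
  refine E.norm_le_of_testFun_le (by positivity) fun ψ => ?_
  have hsub : uIcc c c' ⊆ C := hconv.ordConnected.uIcc_subset hc hc'
  set l := E.testFun i.castSucc (lowerFun d r ψ)
  have hder : ∀ s ∈ uIcc c c', HasDerivWithinAt
      (fun s => l (E.incl i (E.lop P i.succ s (E.ofFun i.succ f))) -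
        s * l (E.derivOp P i c (E.ofFun i.succ f)))
      (l (E.derivOp P i s (E.ofFun i.succ f)) - l (E.derivOp P i c (E.ofFun i.succ f)))
      (uIcc c c') s := fun s hs => by
    have h1 := (hasDerivAt_toDistr_lop hA hC i f ψ (hsub hs)).mono hsub
    have h2 := (hasDerivWithinAt_id s (uIcc c c')).mul_const
      (l (E.derivOp P i c (E.ofFun i.succ f)))
    rw [one_mul] at h2
    exact h1.sub h2
  have := Convex.norm_image_sub_le_of_norm_hasDerivWithin_le
    (C := ‖l‖ * (M * |c' - c| * ‖e f‖)) hder (fun s hs => ?_) (convex_uIcc c c')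
    left_mem_uIcc right_mem_uIcc
  · rw [map_sub, map_sub, map_smul, smul_eq_mul, hj]
    refine le_trans (le_of_eq ?_) (this.trans_eq ?_)
    · rw [Real.norm_eq_abs]; congr 1; ring
    · rw [Real.norm_eq_abs, ← sq_abs (c' - c)]; ring
  · rw [← map_sub]
    refine (ContinuousLinearMap.le_opNorm _ _).trans
      (mul_le_mul_of_nonneg_left ?_ (norm_nonneg _))
    have h1 := hD c hc s (hsub hs) (e f)
    rw [hj] at h1
    refine h1.trans ?_
    have h2 : |s - c| ≤ |c' - c| := abs_sub_left_of_mem_uIcc hs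
    gcongr

/-- `c ↦ D_c` inherits Lipschitz bounds from `c ↦ L_c`. -/
theorem norm_derivOp_sub_le {C : Set ℝ} (i : Fin 3)
    {Z : Type*} [NormedAddCommGroup Z] [NormedSpace ℝ Z] (j : Z →L[ℝ] B i.succ)
    (m : Fin d → Z →L[ℝ] Z)
    (hm : ∀ k z, E.mulOp i.succ (ofSmooth r (P.β k)) (j z) = j (m k z)) {M : ℝ}
    (hL : ∀ c ∈ C, ∀ c' ∈ C, ∀ z,
      ‖E.lop P i.succ c' (j z) - E.lop P i.succ c (j z)‖ ≤ M * |c' - c| * ‖z‖)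
    (hM : 0 ≤ M) {c c' : ℝ} (hc : c ∈ C) (hc' : c' ∈ C) (z : Z) :
    ‖E.derivOp P i c' (j z) - E.derivOp P i c (j z)‖ ≤
      (∑ k, ‖E.partialOp k i‖ * (M * ‖m k‖)) * |c' - c| * ‖z‖ := by
  have h1 : E.derivOp P i c' (j z) - E.derivOp P i c (j z) =
      -∑ k, E.partialOp k i (E.lop P i.succ c' (j (m k z)) - E.lop P i.succ c (j (m k z))) := by
    simp only [derivOp, neg_apply, sum_apply,
      ContinuousLinearMap.comp_apply, hm, map_sub, Finset.sum_sub_distrib]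
    abel
  rw [h1, norm_neg, Finset.sum_mul, Finset.sum_mul]
  refine norm_sum_le_of_le _ fun k _ => ?_
  calc _ ≤ ‖E.partialOp k i‖ * (M * |c' - c| * ‖m k z‖) :=
        (ContinuousLinearMap.le_opNorm _ _).trans
          (mul_le_mul_of_nonneg_left (hL c hc c' hc' _) (norm_nonneg _))
    _ ≤ ‖E.partialOp k i‖ * (M * |c' - c| * (‖m k‖ * ‖z‖)) := by
        gcongr; exact ContinuousLinearMap.le_opNorm _ _
    _ = _ := by ring

theorem norm_transferOp_le (hA : E.StandingAssumptions P 𝒯 νs Cs K θ cbar chat nbar)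
    {S : TorusMap d r} (hS : S ∈ 𝒯) (i : Fin 3) (n : ℕ) (h : B i.succ) :
    ‖(E.transferOp i.succ S ^ n) h‖ ≤ (Cs + K) * ‖h‖ := by
  have h1 := hA.lasota_yorke (List.replicate n S)
    (fun S' hS' => (List.eq_of_mem_replicate hS') ▸ hS) i h
  rw [transferProd, List.map_replicate, List.prod_replicate, List.length_replicate] at h1
  have h2 : Cs * θ ^ n ≤ Cs * 1 :=
    mul_le_mul_of_nonneg_left (pow_le_one₀ hA.θ_pos.le hA.θ_lt_one.le) (by linarith [hA.one_le_Cs])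
  have h3 := E.norm_incl_le i h
  have := hA.one_le_K
  calc _ ≤ _ := h1
    _ ≤ Cs * 1 * ‖h‖ + K * ‖h‖ := by gcongr
    _ = _ := by ring

theorem exists_norm_derivOp_le (hA : E.StandingAssumptions P 𝒯 νs Cs K θ cbar chat nbar)
    (i : Fin 3) : ∃ M, 0 ≤ M ∧ ∀ c, P.shifted r c ∈ 𝒯 → ∀ h, ‖E.derivOp P i c h‖ ≤ M * ‖h‖ := by
  have hK := hA.one_le_K
  have hCs := hA.one_le_Cs
  refine ⟨∑ k, ‖E.partialOp k i‖ * ((Cs + K) * ‖E.mulOp i.succ (ofSmooth r (P.β k))‖),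
    Finset.sum_nonneg fun k _ => by positivity, fun c hc h => ?_⟩
  rw [derivOp, neg_apply, norm_neg, sum_apply, Finset.sum_mul]
  refine norm_sum_le_of_le _ fun k _ => ?_
  calc _ ≤ ‖E.partialOp k i‖ * ‖E.lop P i.succ c (E.mulOp i.succ (ofSmooth r (P.β k)) h)‖ :=
        ContinuousLinearMap.le_opNorm _ _
    _ ≤ ‖E.partialOp k i‖ * ((Cs + K) * (‖E.mulOp i.succ (ofSmooth r (P.β k))‖ * ‖h‖)) := by
        have h1 := norm_transferOp_le hA hc i 1 (E.mulOp i.succ (ofSmooth r (P.β k)) h)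
        rw [pow_one] at h1
        have h2 := ContinuousLinearMap.le_opNorm (E.mulOp i.succ (ofSmooth r (P.β k))) h
        refine mul_le_mul_of_nonneg_left (h1.trans ?_) (norm_nonneg _)
        gcongr
    _ = _ := by ring

end

end BanachScale

/-! ### Abstract linear response -/

section Neumann

variable {X : Type*} [NormedAddCommGroup X] [NormedSpace ℝ X]

theorem geom_sum_apply_sub (A : X →L[ℝ] X) (v : X) (n : ℕ) :
    ∑ m ∈ Finset.range n, (A ^ m) (v - A v) = v - (A ^ n) v := by
  induction n with
  | zero => simp
  | succ n ih =>
    rw [Finset.sum_range_succ, ih, map_sub, pow_succ, mul_apply_eq_comp]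
    abel

/-- If the iterates of `A` contract the closed invariant subspace `V`, then `Id - A` is onto `V`:
its inverse is the Neumann series. -/
theorem exists_sub_apply_eq [CompleteSpace X] {A : X →L[ℝ] X} {V : Submodule ℝ X}
    (hV : IsClosed (V : Set X)) (hAV : ∀ v ∈ V, A v ∈ V) {θ : ℝ} (h0 : 0 < θ) (h1 : θ < 1) {N : ℕ}
    (h : ∀ n ≥ N, ∀ v ∈ V, ‖(A ^ n) v‖ ≤ θ ^ n * ‖v‖) {w : X} (hw : w ∈ V) :
    ∃ v ∈ V, v - A v = w := by
  have hs : Summable fun n => (A ^ n) w := by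
    refine Summable.of_norm_bounded_eventually_nat (g := fun n => θ ^ n * ‖w‖)
      ((summable_geometric_of_lt_one h0.le h1).mul_right _) ?_
    filter_upwards [eventually_ge_atTop N] with n hn using h n hn w hw
  have hpow : ∀ n, (A ^ n) w ∈ V := fun n => by
    induction n with
    | zero => simpa using hw
    | succ n ih => rw [pow_succ', mul_apply_eq_comp]; exact hAV _ ih
  refine ⟨∑' n, (A ^ n) w, hV.mem_of_tendsto hs.hasSum
    (Eventually.of_forall fun s => V.sum_mem fun n _ => hpow n), ?_⟩
  rw [A.map_tsum hs, hs.tsum_eq_zero_add]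
  simp [pow_succ']

theorem exists_norm_le_norm_sub_apply {θ : ℝ} (h0 : 0 < θ) (h1 : θ < 1) (N : ℕ) {M : ℝ}
    (hM : 0 ≤ M) : ∃ M', 0 ≤ M' ∧ ∀ (A : X →L[ℝ] X) (V : Submodule ℝ X),
      (∀ n ≥ N, ∀ v ∈ V, ‖(A ^ n) v‖ ≤ θ ^ n * ‖v‖) → (∀ n v, ‖(A ^ n) v‖ ≤ M * ‖v‖) →
      ∀ v ∈ V, ‖v‖ ≤ M' * ‖v - A v‖ := by
  obtain ⟨n, hn, hθ⟩ : ∃ n ≥ N, θ ^ n ≤ 1 / 2 := by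
    obtain ⟨n, hn⟩ := exists_pow_lt_of_lt_one (show (0 : ℝ) < 1 / 2 by norm_num) h1
    exact ⟨max n N, le_max_right _ _,
      (pow_le_pow_of_le_one h0.le h1.le (le_max_left _ _)).trans hn.le⟩
  refine ⟨2 * (n * M), by positivity, fun A V hA hb v hv => ?_⟩
  have h2 : v = ∑ m ∈ Finset.range n, (A ^ m) (v - A v) + (A ^ n) v := by
    rw [geom_sum_apply_sub]; abel
  have h3 : ‖∑ m ∈ Finset.range n, (A ^ m) (v - A v)‖ ≤ n * (M * ‖v - A v‖) := by
    refine (norm_sum_le_of_le _ fun m _ => hb m _).trans_eq ?_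
    simp
  have h4 : ‖v‖ ≤ n * (M * ‖v - A v‖) + 1 / 2 * ‖v‖ := by
    calc ‖v‖ = ‖∑ m ∈ Finset.range n, (A ^ m) (v - A v) + (A ^ n) v‖ := by rw [← h2]
      _ ≤ _ := norm_add_le _ _
      _ ≤ _ := add_le_add h3 ((hA n hn v hv).trans
        (mul_le_mul_of_nonneg_right hθ (norm_nonneg _)))
  linarith

end Neumann

theorem hasDerivWithinAt_of_norm_sub_sub_le {X : Type*} [NormedAddCommGroup X] [NormedSpace ℝ X]
    {f : ℝ → X} {f' : X} {C : Set ℝ} {c : ℝ}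
    (h : ∀ ε > 0, ∃ K, 0 ≤ K ∧ ∀ c' ∈ C,
      ‖f c' - f c - (c' - c) • f'‖ ≤ K * (c' - c) ^ 2 + ε * |c' - c|) :
    HasDerivWithinAt f f' C c := by
  rw [hasDerivWithinAt_iff_isLittleO, Asymptotics.isLittleO_iff]
  intro ε hε
  obtain ⟨K, hK, hf⟩ := h (ε / 2) (by positivity)
  have hball : Metric.ball c (ε / (2 * (K + 1))) ∈ 𝓝[C] c :=
    mem_nhdsWithin_of_mem_nhds (Metric.ball_mem_nhds _ (by positivity))
  filter_upwards [hball, self_mem_nhdsWithin] with c' h1 h2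
  have h3 : |c' - c| < ε / (2 * (K + 1)) := by simpa [Real.dist_eq] using h1
  refine (hf c' h2).trans ?_
  have h4 : K * |c' - c| ≤ ε / 2 := by
    calc K * |c' - c| ≤ (K + 1) * (ε / (2 * (K + 1))) := by gcongr; linarith
      _ = ε / 2 := by field_simp
  rw [Real.norm_eq_abs, ← sq_abs]
  nlinarith [abs_nonneg (c' - c)]

/-- The data from which a family `u c ∈ X₃` of fixed vectors of operators `L c`, on a chain
`X₃ → X₂ → X₁ → X₀` of spaces, is seen to be twice differentiable: `D0`, `D1` are the first
derivative of `L`, from `X₁` to `X₀` and from `X₂` to `X₁`, and `Q0` is its second derivative, from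
`X₂` to `X₀`. The vectors `u' c` and `u'' c` solve the formally differentiated equations. -/
structure LinearResponse {X0 X1 X2 X3 : Type*}
    [NormedAddCommGroup X0] [NormedSpace ℝ X0] [NormedAddCommGroup X1] [NormedSpace ℝ X1]
    [NormedAddCommGroup X2] [NormedSpace ℝ X2] [NormedAddCommGroup X3] [NormedSpace ℝ X3]
    (C : Set ℝ) (j0 : X1 →L[ℝ] X0) (j1 : X2 →L[ℝ] X1) (j2 : X3 →L[ℝ] X2)
    (L1 : ℝ → X1 →L[ℝ] X1) (L2 : ℝ → X2 →L[ℝ] X2) (D0 : ℝ → X1 →L[ℝ] X0)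
    (D1 : ℝ → X2 →L[ℝ] X1) (Q0 : ℝ → X2 →L[ℝ] X0) (V1 : Submodule ℝ X1) (V2 : Submodule ℝ X2)
    (u : ℝ → X3) (u' : ℝ → X2) (u'' : ℝ → X1) : Prop where
  map_V : ∀ v ∈ V2, j1 v ∈ V1
  u_bound : ∃ M, 0 ≤ M ∧ ∀ c ∈ C, ‖u c‖ ≤ M
  u'_bound : ∃ M, 0 ≤ M ∧ ∀ c ∈ C, ‖u' c‖ ≤ M
  u''_bound : ∃ M, 0 ≤ M ∧ ∀ c ∈ C, ‖u'' c‖ ≤ M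
  sub_mem : ∀ c ∈ C, ∀ c' ∈ C, j2 (u c') - j2 (u c) ∈ V2
  u'_mem : ∀ c ∈ C, u' c ∈ V2
  u''_mem : ∀ c ∈ C, u'' c ∈ V1
  u_eq : ∀ c ∈ C, L2 c (j2 (u c)) = j2 (u c)
  u'_eq : ∀ c ∈ C, j1 (u' c) - L1 c (j1 (u' c)) = D1 c (j2 (u c))
  u''_eq : ∀ c ∈ C, j0 (u'' c - L1 c (u'' c)) = (2 : ℝ) • D0 c (j1 (u' c)) + Q0 c (j2 (u c))
  L_comm : ∀ c ∈ C, ∀ v, L1 c (j1 v) = j1 (L2 c v)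
  D_comm : ∀ c ∈ C, ∀ v, j0 (D1 c v) = D0 c (j1 v)
  L2_lip : ∃ M, 0 ≤ M ∧ ∀ c ∈ C, ∀ c' ∈ C, ∀ z,
    ‖L2 c' (j2 z) - L2 c (j2 z)‖ ≤ M * |c' - c| * ‖z‖
  L1_lip : ∃ M, 0 ≤ M ∧ ∀ c ∈ C, ∀ c' ∈ C, ∀ z,
    ‖L1 c' (j1 z) - L1 c (j1 z)‖ ≤ M * |c' - c| * ‖z‖
  L2_taylor : ∃ M, 0 ≤ M ∧ ∀ c ∈ C, ∀ c' ∈ C, ∀ z,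
    ‖j1 (L2 c' (j2 z)) - j1 (L2 c (j2 z)) - (c' - c) • D1 c (j2 z)‖ ≤ M * (c' - c) ^ 2 * ‖z‖
  L1_taylor : ∃ M, 0 ≤ M ∧ ∀ c ∈ C, ∀ c' ∈ C, ∀ z,
    ‖j0 (L1 c' (j1 z)) - j0 (L1 c (j1 z)) - (c' - c) • D0 c (j1 z)‖ ≤ M * (c' - c) ^ 2 * ‖z‖
  D1_lip : ∃ M, 0 ≤ M ∧ ∀ c ∈ C, ∀ c' ∈ C, ∀ z,
    ‖D1 c' (j2 z) - D1 c (j2 z)‖ ≤ M * |c' - c| * ‖z‖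
  D0_taylor : ∃ M, 0 ≤ M ∧ ∀ c ∈ C, ∀ c' ∈ C, ∀ z,
    ‖D0 c' (j1 (j2 z)) - D0 c (j1 (j2 z)) - (c' - c) • Q0 c (j2 z)‖ ≤ M * (c' - c) ^ 2 * ‖z‖
  D0_bound : ∃ M, 0 ≤ M ∧ ∀ c ∈ C, ∀ z, ‖D0 c z‖ ≤ M * ‖z‖
  D1_bound : ∃ M, 0 ≤ M ∧ ∀ c ∈ C, ∀ z, ‖D1 c z‖ ≤ M * ‖z‖
  Q0_bound : ∃ M, 0 ≤ M ∧ ∀ c ∈ C, ∀ z, ‖Q0 c z‖ ≤ M * ‖z‖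
  inv1 : ∃ M, 0 ≤ M ∧ ∀ c ∈ C, ∀ v ∈ V1, ‖v‖ ≤ M * ‖v - L1 c v‖
  inv2 : ∃ M, 0 ≤ M ∧ ∀ c ∈ C, ∀ v ∈ V2, ‖v‖ ≤ M * ‖v - L2 c v‖
  weak_inv : ∀ ε > 0, ∃ M, 0 ≤ M ∧ ∀ c ∈ C, ∀ v ∈ V1,
    ‖j0 v‖ ≤ M * ‖j0 (v - L1 c v)‖ + ε * ‖v‖

namespace LinearResponse

variable {X0 X1 X2 X3 : Type*}
  [NormedAddCommGroup X0] [NormedSpace ℝ X0] [NormedAddCommGroup X1] [NormedSpace ℝ X1]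
  [NormedAddCommGroup X2] [NormedSpace ℝ X2] [NormedAddCommGroup X3] [NormedSpace ℝ X3]
  {C : Set ℝ} {j0 : X1 →L[ℝ] X0} {j1 : X2 →L[ℝ] X1} {j2 : X3 →L[ℝ] X2}
  {L1 : ℝ → X1 →L[ℝ] X1} {L2 : ℝ → X2 →L[ℝ] X2} {D0 : ℝ → X1 →L[ℝ] X0}
  {D1 : ℝ → X2 →L[ℝ] X1} {Q0 : ℝ → X2 →L[ℝ] X0} {V1 : Submodule ℝ X1} {V2 : Submodule ℝ X2}
  {u : ℝ → X3} {u' : ℝ → X2} {u'' : ℝ → X1}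

theorem exists_lip (R : LinearResponse C j0 j1 j2 L1 L2 D0 D1 Q0 V1 V2 u u' u'') :
    ∃ M, 0 ≤ M ∧ ∀ c ∈ C, ∀ c' ∈ C, ‖j2 (u c') - j2 (u c)‖ ≤ M * |c' - c| := by
  obtain ⟨K, hK, hu⟩ := R.u_bound
  obtain ⟨M1, hM1, h1⟩ := R.L2_lip
  obtain ⟨M2, hM2, h2⟩ := R.inv2
  refine ⟨M2 * (M1 * K), by positivity, fun c hc c' hc' => ?_⟩
  have e : j2 (u c') - j2 (u c) - L2 c (j2 (u c') - j2 (u c)) =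
      L2 c' (j2 (u c')) - L2 c (j2 (u c')) := by
    rw [map_sub, R.u_eq c hc, R.u_eq c' hc']; abel
  calc _ ≤ M2 * ‖L2 c' (j2 (u c')) - L2 c (j2 (u c'))‖ := e ▸ h2 c hc _ (R.sub_mem c hc c' hc')
    _ ≤ M2 * (M1 * |c' - c| * K) := by
      refine mul_le_mul_of_nonneg_left ((h1 c hc c' hc' _).trans ?_) hM2
      have := hu c' hc'
      gcongr
    _ = _ := by ring

theorem exists_taylor (R : LinearResponse C j0 j1 j2 L1 L2 D0 D1 Q0 V1 V2 u u' u'') :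
    ∃ M, 0 ≤ M ∧ ∀ c ∈ C, ∀ c' ∈ C,
      ‖j1 (j2 (u c')) - j1 (j2 (u c)) - (c' - c) • j1 (u' c)‖ ≤ M * (c' - c) ^ 2 := by
  obtain ⟨K, hK, hu⟩ := R.u_bound
  obtain ⟨M0, hM0, h0⟩ := R.exists_lip
  obtain ⟨M1, hM1, h1⟩ := R.L2_taylor
  obtain ⟨M2, hM2, h2⟩ := R.inv1
  obtain ⟨M3, hM3, h3⟩ := R.D1_bound
  refine ⟨M2 * (M1 * K + M3 * M0), by positivity, fun c hc c' hc' => ?_⟩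
  set v := j1 (j2 (u c')) - j1 (j2 (u c)) - (c' - c) • j1 (u' c) with hv
  have hvV : v ∈ V1 := by
    rw [hv, ← map_sub]
    exact V1.sub_mem (R.map_V _ (R.sub_mem c hc c' hc'))
      (V1.smul_mem _ (R.map_V _ (R.u'_mem c hc)))
  have e : v - L1 c v =
      (j1 (L2 c' (j2 (u c'))) - j1 (L2 c (j2 (u c'))) - (c' - c) • D1 c (j2 (u c'))) +
        (c' - c) • D1 c (j2 (u c') - j2 (u c)) := by
    simp only [hv, map_sub, map_smul, ← R.u'_eq c hc, smul_sub]
    rw [R.L_comm c hc (j2 (u c')), R.L_comm c hc (j2 (u c)), R.u_eq c hc, R.u_eq c' hc']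
    abel
  calc ‖v‖ ≤ M2 * ‖v - L1 c v‖ := h2 c hc v hvV
    _ ≤ M2 * (M1 * (c' - c) ^ 2 * K + |c' - c| * (M3 * (M0 * |c' - c|))) := by
      rw [e]
      refine mul_le_mul_of_nonneg_left (norm_add_le_of_le ((h1 c hc c' hc' _).trans ?_) ?_) hM2
      · have := hu c' hc'
        gcongr
      · rw [norm_smul, Real.norm_eq_abs]
        have := (h3 c hc (j2 (u c') - j2 (u c))).trans
          (mul_le_mul_of_nonneg_left (h0 c hc c' hc') hM3)
        gcongr
    _ = _ := by rw [← sq_abs (c' - c)]; ring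

/-- The equation satisfied by the increments of `u'`. -/
theorem sub_apply_eq (R : LinearResponse C j0 j1 j2 L1 L2 D0 D1 Q0 V1 V2 u u' u'')
    {c c' : ℝ} (hc : c ∈ C) (hc' : c' ∈ C) :
    j1 (u' c') - j1 (u' c) - L1 c (j1 (u' c') - j1 (u' c)) =
      (D1 c' (j2 (u c')) - D1 c (j2 (u c'))) + D1 c (j2 (u c') - j2 (u c)) +
        (L1 c' (j1 (u' c')) - L1 c (j1 (u' c'))) := by
  simp only [map_sub, ← R.u'_eq c hc, ← R.u'_eq c' hc']
  abel

theorem exists_lip_deriv (R : LinearResponse C j0 j1 j2 L1 L2 D0 D1 Q0 V1 V2 u u' u'') :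
    ∃ M, 0 ≤ M ∧ ∀ c ∈ C, ∀ c' ∈ C, ‖j1 (u' c') - j1 (u' c)‖ ≤ M * |c' - c| := by
  obtain ⟨K, hK, hu⟩ := R.u_bound
  obtain ⟨K', hK', hu'⟩ := R.u'_bound
  obtain ⟨M0, hM0, h0⟩ := R.exists_lip
  obtain ⟨M1, hM1, h1⟩ := R.D1_lip
  obtain ⟨M2, hM2, h2⟩ := R.inv1
  obtain ⟨M3, hM3, h3⟩ := R.D1_bound
  obtain ⟨M4, hM4, h4⟩ := R.L1_lip
  refine ⟨M2 * (M1 * K + M3 * M0 + M4 * K'), by positivity, fun c hc c' hc' => ?_⟩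
  have hvV : j1 (u' c') - j1 (u' c) ∈ V1 :=
    V1.sub_mem (R.map_V _ (R.u'_mem c' hc')) (R.map_V _ (R.u'_mem c hc))
  have := hu c' hc'
  have := hu' c' hc'
  calc _ ≤ M2 * _ := h2 c hc _ hvV
    _ ≤ M2 * (M1 * |c' - c| * K + M3 * (M0 * |c' - c|) + M4 * |c' - c| * K') := by
      rw [R.sub_apply_eq hc hc']
      refine mul_le_mul_of_nonneg_left (norm_add_le_of_le (norm_add_le_of_le
        ((h1 c hc c' hc' _).trans ?_) ((h3 c hc _).trans ?_))
        ((h4 c hc c' hc' _).trans ?_)) hM2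
      · gcongr
      · have := h0 c hc c' hc'
        gcongr
      · gcongr
    _ = _ := by ring

theorem hasDerivWithinAt (R : LinearResponse C j0 j1 j2 L1 L2 D0 D1 Q0 V1 V2 u u' u'')
    {c : ℝ} (hc : c ∈ C) :
    HasDerivWithinAt (fun c => j1 (j2 (u c))) (j1 (u' c)) C c := by
  obtain ⟨M, hM, h⟩ := R.exists_taylor
  refine hasDerivWithinAt_of_norm_sub_sub_le fun ε hε => ⟨M, hM, fun c' hc' => ?_⟩
  exact (h c hc c' hc').trans (le_add_of_nonneg_right (by positivity))

/-- The second derivative exists in the weakest norm: the increments of `u'` solve an equation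
whose right-hand side is bounded in `X₁` and converges only in `X₀`, and `weak_inv` interpolates
between the two. -/
theorem hasDerivWithinAt_deriv (R : LinearResponse C j0 j1 j2 L1 L2 D0 D1 Q0 V1 V2 u u' u'')
    {c : ℝ} (hc : c ∈ C) :
    HasDerivWithinAt (fun c => j0 (j1 (u' c))) (j0 (u'' c)) C c := by
  obtain ⟨K, hK, hu⟩ := R.u_bound
  obtain ⟨K', hK', hu'⟩ := R.u'_bound
  obtain ⟨K'', hK'', hu''⟩ := R.u''_bound
  obtain ⟨M0, hM0, h0⟩ := R.exists_lip
  obtain ⟨M1, hM1, h1⟩ := R.exists_taylor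
  obtain ⟨M2, hM2, h2⟩ := R.exists_lip_deriv
  obtain ⟨M3, hM3, h3⟩ := R.D0_taylor
  obtain ⟨M4, hM4, h4⟩ := R.Q0_bound
  obtain ⟨M5, hM5, h5⟩ := R.D0_bound
  obtain ⟨M6, hM6, h6⟩ := R.L1_taylor
  refine hasDerivWithinAt_of_norm_sub_sub_le fun ε hε => ?_
  obtain ⟨M7, hM7, h7⟩ := R.weak_inv (ε / (M2 + K'' + 1)) (by positivity)
  refine ⟨M7 * (M3 * K + M4 * M0 + M5 * M1 + M6 * K' + M5 * M2), by positivity,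
    fun c' hc' => ?_⟩
  set v := j1 (u' c') - j1 (u' c) - (c' - c) • u'' c with hv
  have hvV : v ∈ V1 := V1.sub_mem
    (V1.sub_mem (R.map_V _ (R.u'_mem c' hc')) (R.map_V _ (R.u'_mem c hc)))
    (V1.smul_mem _ (R.u''_mem c hc))
  have hvn : ‖v‖ ≤ (M2 + K'' + 1) * |c' - c| := by
    refine (norm_sub_le_of_le (h2 c hc c' hc') (?_ : _ ≤ |c' - c| * K'')).trans ?_
    · rw [norm_smul, Real.norm_eq_abs]
      have := hu'' c hc
      gcongr
    · nlinarith [abs_nonneg (c' - c)]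
  have e : j0 (v - L1 c v) =
      (D0 c' (j1 (j2 (u c'))) - D0 c (j1 (j2 (u c'))) - (c' - c) • Q0 c (j2 (u c'))) +
      (c' - c) • Q0 c (j2 (u c') - j2 (u c)) +
      D0 c (j1 (j2 (u c')) - j1 (j2 (u c)) - (c' - c) • j1 (u' c)) +
      (j0 (L1 c' (j1 (u' c'))) - j0 (L1 c (j1 (u' c'))) - (c' - c) • D0 c (j1 (u' c'))) +
      (c' - c) • D0 c (j1 (u' c') - j1 (u' c)) := by
    have e1 : v - L1 c v = (j1 (u' c') - j1 (u' c) - L1 c (j1 (u' c') - j1 (u' c))) -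
        (c' - c) • (u'' c - L1 c (u'' c)) := by
      simp only [hv, map_sub, map_smul, smul_sub]; abel
    rw [e1, R.sub_apply_eq hc hc', map_sub, map_smul, R.u''_eq c hc]
    simp only [map_sub, map_add, map_smul, R.D_comm c hc, R.D_comm c' hc', smul_sub, smul_add,
      two_smul]
    abel
  have hn : ‖j0 (v - L1 c v)‖ ≤ M3 * (c' - c) ^ 2 * K + |c' - c| * (M4 * (M0 * |c' - c|)) +
      M5 * (M1 * (c' - c) ^ 2) + M6 * (c' - c) ^ 2 * K' +
      |c' - c| * (M5 * (M2 * |c' - c|)) := by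
    have := hu c' hc'
    have := hu' c' hc'
    rw [e]
    refine norm_add_le_of_le (norm_add_le_of_le (norm_add_le_of_le (norm_add_le_of_le
      ((h3 c hc c' hc' _).trans ?_) ?_) ((h5 c hc _).trans ?_))
      ((h6 c hc c' hc' _).trans ?_)) ?_
    · gcongr
    · rw [norm_smul, Real.norm_eq_abs]
      have := (h4 c hc (j2 (u c') - j2 (u c))).trans
        (mul_le_mul_of_nonneg_left (h0 c hc c' hc') hM4)
      gcongr
    · have := h1 c hc c' hc'
      gcongr
    · gcongr
    · rw [norm_smul, Real.norm_eq_abs]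
      have := (h5 c hc (j1 (u' c') - j1 (u' c))).trans
        (mul_le_mul_of_nonneg_left (h2 c hc c' hc') hM5)
      gcongr
  have e2 : j0 (j1 (u' c')) - j0 (j1 (u' c)) - (c' - c) • j0 (u'' c) = j0 v := by
    simp only [hv, map_sub, map_smul]
  rw [e2]
  refine (h7 c hc v hvV).trans ((add_le_add (mul_le_mul_of_nonneg_left hn hM7)
    (mul_le_mul_of_nonneg_left hvn (by positivity))).trans_eq ?_)
  rw [← sq_abs (c' - c)]
  field_simp

end LinearResponse

namespace BanachScale

variable {d r : ℕ} {B : Fin 4 → Type*} [∀ i, NormedAddCommGroup (B i)] [∀ i, NormedSpace ℝ (B i)]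

/-! ### The invariant densities of the maps `T + c β` -/

theorem mem_V {E : BanachScale d r B} {i : Fin 4} {f : B i} :
    f ∈ E.V i ↔ (E.toDistr i f).mass = 0 := Iff.rfl

theorem isClosed_V (E : BanachScale d r B) (i : Fin 4) : IsClosed (E.V i : Set (B i)) :=
  isClosed_eq (E.testFun i (oneFun d r)).continuous continuous_const

theorem mass_incl (E : BanachScale d r B) (i : Fin 3) (h : B i.succ) :
    (E.toDistr i.castSucc (E.incl i h)).mass = (E.toDistr i.succ h).mass := by
  rw [E.toDistr_incl]

theorem mass_transfer (S : TorusMap d r) (h : Distr d r) : (transfer S h).mass = h.mass := rfl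

theorem mass_ofFun_one (E : BanachScale d r B) (i : Fin 4) :
    (E.toDistr i (E.ofFun i (oneFun d r))).mass = 1 := by
  have h : (volume : Measure (UnitAddTorus (Fin d))) univ = 1 := by
    rw [← Set.pi_univ univ, show (volume : Measure (UnitAddTorus (Fin d))) =
      Measure.pi fun _ => volume from rfl, Measure.pi_pi]
    simp
  rw [Distr.mass, E.toDistr_ofFun]
  simp [oneFun, Measure.real, h]

theorem nonneg_ofFun (E : BanachScale d r B) (i : Fin 4) {f : torusFun d r}
    (hf : ∀ x, 0 ≤ f.1 x) : (E.toDistr i (E.ofFun i f)).Nonneg := fun φ hφ => by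
  rw [E.toDistr_ofFun]
  exact integral_nonneg fun x => mul_nonneg (hf x) (hφ x)

theorem nonneg_transfer {S : TorusMap d r} {h : Distr d r} (hh : h.Nonneg) :
    (transfer S h).Nonneg := fun _ hφ => hh _ fun _ => hφ _

theorem isClosed_nonneg (E : BanachScale d r B) (i : Fin 4) :
    IsClosed {h : B i | (E.toDistr i h).Nonneg} := by
  have : {h : B i | (E.toDistr i h).Nonneg} =
      ⋂ φ : torusFun d r, ⋂ _ : ∀ x, 0 ≤ φ.1 x, {h | 0 ≤ E.testFun i φ h} := by
    ext h; simp [Distr.Nonneg]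
  rw [this]
  exact isClosed_iInter fun φ => isClosed_iInter fun _ =>
    isClosed_le continuous_const (E.testFun i φ).continuous

/-- The element of mass `1` of `B_3` that is invariant under the transfer operator of
`T + c β`. -/
def density (E : BanachScale d r B) (P : CoupledSystem d) (c : ℝ) : B 3 :=
  Classical.epsilon fun h => (E.toDistr 3 h).mass = 1 ∧
    transfer (P.shifted r c) (E.toDistr 3 h) = E.toDistr 3 h

/-- The second derivative in `c` of the transfer operator of `T + c β`, from `B_2` to `B_0`. -/
def secondOp (E : BanachScale d r B) (P : CoupledSystem d) (c : ℝ) : B 2 →L[ℝ] B 0 :=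
  -∑ k, (E.partialOp k 0 : B 1 →L[ℝ] B 0).comp
    ((E.derivOp P 1 c : B 2 →L[ℝ] B 1).comp (E.mulOp 2 (ofSmooth r (P.β k))))

/-- The second derivative in `c` of the transfer operator of `T + c β`, from `B_3` to `B_1`. -/
def secondOpUpper (E : BanachScale d r B) (P : CoupledSystem d) (c : ℝ) : B 3 →L[ℝ] B 1 :=
  -∑ k, (E.partialOp k 1 : B 2 →L[ℝ] B 1).comp
    ((E.derivOp P 2 c : B 3 →L[ℝ] B 2).comp (E.mulOp 3 (ofSmooth r (P.β k))))

section

variable {E : BanachScale d r B} {P : CoupledSystem d} {𝒯 : Set (TorusMap d r)}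
  {νs Cs K θ : ℝ} {cbar chat nbar : ℕ}

theorem transferOp_mem_V (hA : E.StandingAssumptions P 𝒯 νs Cs K θ cbar chat nbar)
    {S : TorusMap d r} (hS : S ∈ 𝒯) (i : Fin 4) {v : B i} (hv : v ∈ E.V i) :
    E.transferOp i S v ∈ E.V i := by
  rw [mem_V, toDistr_transferOp hA hS, mass_transfer]; exact hv

theorem norm_transferOp_pow_le (hA : E.StandingAssumptions P 𝒯 νs Cs K θ cbar chat nbar)
    {S : TorusMap d r} (hS : S ∈ 𝒯) (i : Fin 3) {n : ℕ} (hn : nbar ≤ n) {v : B i.succ}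
    (hv : v ∈ E.V i.succ) : ‖(E.transferOp i.succ S ^ n) v‖ ≤ θ ^ n * ‖v‖ := by
  have h1 := hA.contraction (List.replicate n S)
    (fun S' hS' => (List.eq_of_mem_replicate hS') ▸ hS) (by simpa using hn) i
  rw [transferProd, List.map_replicate, List.prod_replicate, List.length_replicate] at h1
  exact ContinuousLinearMap.le_of_opNorm_le _ h1.le (⟨v, hv⟩ : E.V i.succ)

theorem exists_sub_transferOp_eq [∀ i, CompleteSpace (B i)]
    (hA : E.StandingAssumptions P 𝒯 νs Cs K θ cbar chat nbar)
    {S : TorusMap d r} (hS : S ∈ 𝒯) (i : Fin 3) {w : B i.succ} (hw : w ∈ E.V i.succ) :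
    ∃ v ∈ E.V i.succ, v - E.transferOp i.succ S v = w :=
  exists_sub_apply_eq (E.isClosed_V _) (fun _ => transferOp_mem_V hA hS _) hA.θ_pos hA.θ_lt_one
    (fun _ hn _ => norm_transferOp_pow_le hA hS i hn) hw

theorem exists_norm_le_norm_sub_transferOp
    (hA : E.StandingAssumptions P 𝒯 νs Cs K θ cbar chat nbar) (i : Fin 3) :
    ∃ M, 0 ≤ M ∧ ∀ S ∈ 𝒯, ∀ v ∈ E.V i.succ, ‖v‖ ≤ M * ‖v - E.transferOp i.succ S v‖ := by
  obtain ⟨M, hM, h⟩ := exists_norm_le_norm_sub_apply (X := B i.succ) hA.θ_pos hA.θ_lt_one nbar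
    (M := Cs + K) (by linarith [hA.one_le_Cs, hA.one_le_K])
  exact ⟨M, hM, fun S hS => h _ _ (fun n hn v hv => norm_transferOp_pow_le hA hS i hn hv)
    fun n v => norm_transferOp_le hA hS i n v⟩

/-- The invariant element is the limit of the iterates of the constant function `1`, and therefore
nonnegative, with a norm that is bounded uniformly over `𝒯`. -/
theorem exists_invariant [∀ i, CompleteSpace (B i)]
    (hA : E.StandingAssumptions P 𝒯 νs Cs K θ cbar chat nbar) {S : TorusMap d r} (hS : S ∈ 𝒯) :
    ∃ h : B 3, (E.toDistr 3 h).mass = 1 ∧ transfer S (E.toDistr 3 h) = E.toDistr 3 h ∧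
      (E.toDistr 3 h).Nonneg ∧ ‖h‖ ≤ (Cs + K) * ‖E.ofFun 3 (oneFun d r)‖ := by
  set A := E.transferOp 3 S
  set e := E.ofFun 3 (oneFun d r)
  have hA' : ∀ g : B 3, E.toDistr 3 (A g) = transfer S (E.toDistr 3 g) :=
    toDistr_transferOp hA hS 3
  have he1 : (E.toDistr 3 e).mass = 1 := E.mass_ofFun_one 3
  have hw : A e - e ∈ E.V 3 := by
    rw [mem_V, map_sub, hA']
    change (transfer S (E.toDistr 3 e)).mass - (E.toDistr 3 e).mass = 0
    rw [mass_transfer, sub_self]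
  obtain ⟨v, hv, hve⟩ : ∃ v ∈ E.V 3, v - A v = A e - e := exists_sub_transferOp_eq hA hS 2 hw
  have hinv : A (e + v) = e + v := by
    rw [map_add, add_comm e, ← sub_eq_zero]
    have : A v = v - (A e - e) := by rw [← hve]; abel
    rw [this]; abel
  have hpow : ∀ n, (A ^ n) e = (e + v) - (A ^ n) v := fun n => by
    have h1 : (A ^ n) (e + v) = e + v := by
      induction n with
      | zero => simp
      | succ n ih => rw [pow_succ, mul_apply_eq_comp, hinv, ih]
    rw [← h1, map_add, add_sub_cancel_right]
  have hlim : Tendsto (fun n => (A ^ n) e) atTop (𝓝 (e + v)) := by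
    have h1 : Tendsto (fun n => (A ^ n) v) atTop (𝓝 0) := by
      refine squeeze_zero_norm' (a := fun n => θ ^ n * ‖v‖) ?_ ?_
      · filter_upwards [eventually_ge_atTop nbar] with n hn
          using norm_transferOp_pow_le hA hS 2 hn hv
      · simpa using (tendsto_pow_atTop_nhds_zero_of_lt_one hA.θ_pos.le hA.θ_lt_one).mul_const ‖v‖
    simpa [hpow] using (tendsto_const_nhds (x := e + v)).sub h1
  refine ⟨e + v, ?_, ?_, ?_, ?_⟩
  · have : (E.toDistr 3 v).mass = 0 := hv
    rw [map_add]
    change (E.toDistr 3 e).mass + (E.toDistr 3 v).mass = 1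
    rw [he1, this, add_zero]
  · rw [← hA', hinv]
  · refine (E.isClosed_nonneg 3).mem_of_tendsto hlim (Eventually.of_forall fun n => ?_)
    induction n with
    | zero => exact E.nonneg_ofFun 3 fun x => zero_le_one
    | succ n ih =>
      rw [mem_ofPred_eq] at ih ⊢
      rw [pow_succ', mul_apply_eq_comp, hA']
      exact nonneg_transfer ih
  · exact le_of_tendsto hlim.norm (Eventually.of_forall fun n => norm_transferOp_le hA hS 2 n e)

theorem eq_of_invariant (hA : E.StandingAssumptions P 𝒯 νs Cs K θ cbar chat nbar)
    {S : TorusMap d r} (hS : S ∈ 𝒯) (i : Fin 3) {g h : B i.succ}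
    (hm : (E.toDistr i.succ g).mass = (E.toDistr i.succ h).mass)
    (hg : transfer S (E.toDistr i.succ g) = E.toDistr i.succ g)
    (hh : transfer S (E.toDistr i.succ h) = E.toDistr i.succ h) : g = h := by
  obtain ⟨M, hM, hb⟩ := exists_norm_le_norm_sub_transferOp hA i
  have hv : g - h ∈ E.V i.succ := by
    rw [mem_V, map_sub]
    exact sub_eq_zero.2 hm
  have h0 := hb S hS _ hv
  have h1 : E.transferOp i.succ S (g - h) = g - h := by
    refine E.toDistr_injective _ ?_
    rw [toDistr_transferOp hA hS, map_sub, ← hg, ← hh]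
    simp only [hg, hh]
    rw [show transfer S (E.toDistr i.succ g - E.toDistr i.succ h) =
      transfer S (E.toDistr i.succ g) - transfer S (E.toDistr i.succ h) from rfl, hg, hh]
  rw [h1, sub_self, norm_zero, mul_zero] at h0
  exact sub_eq_zero.1 (norm_le_zero_iff.1 h0)

theorem density_spec [∀ i, CompleteSpace (B i)]
    (hA : E.StandingAssumptions P 𝒯 νs Cs K θ cbar chat nbar) {c : ℝ}
    (hc : P.shifted r c ∈ 𝒯) :
    (E.toDistr 3 (E.density P c)).mass = 1 ∧
      transfer (P.shifted r c) (E.toDistr 3 (E.density P c)) = E.toDistr 3 (E.density P c) ∧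
      (E.toDistr 3 (E.density P c)).Nonneg ∧
      ‖E.density P c‖ ≤ (Cs + K) * ‖E.ofFun 3 (oneFun d r)‖ := by
  obtain ⟨h, h1, h2, h3, h4⟩ := exists_invariant hA hc
  obtain ⟨h5, h6⟩ : (E.toDistr 3 (E.density P c)).mass = 1 ∧
      transfer (P.shifted r c) (E.toDistr 3 (E.density P c)) = E.toDistr 3 (E.density P c) :=
    Classical.epsilon_spec (p := fun h => (E.toDistr 3 h).mass = 1 ∧
      transfer (P.shifted r c) (E.toDistr 3 h) = E.toDistr 3 h) ⟨h, h1, h2⟩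
  have : E.density P c = h := eq_of_invariant hA hc 2 (h5.trans h1.symm) h6 h2
  exact ⟨h5, h6, this ▸ h3, this ▸ h4⟩

theorem exists_norm_incl_le_add (hA : E.StandingAssumptions P 𝒯 νs Cs K θ cbar chat nbar)
    {ε : ℝ} (hε : 0 < ε) : ∃ M, 0 ≤ M ∧ ∀ S ∈ 𝒯, ∀ v ∈ E.V 1,
      ‖(E.incl 0 v : B 0)‖ ≤ M * ‖(E.incl 0 (v - E.transferOp 1 S v) : B 0)‖ + ε * ‖v‖ := by
  obtain ⟨n, hn, hθ⟩ : ∃ n ≥ nbar, θ ^ n ≤ ε := by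
    obtain ⟨n, hn⟩ := exists_pow_lt_of_lt_one hε hA.θ_lt_one
    exact ⟨max n nbar, le_max_right _ _, (pow_le_pow_of_le_one hA.θ_pos.le hA.θ_lt_one.le
      (le_max_left _ _)).trans hn.le⟩
  have hCs := hA.one_le_Cs
  refine ⟨n * Cs, by positivity, fun S hS v hv => ?_⟩
  set j : B 1 →L[ℝ] B 0 := E.incl 0
  set A := E.transferOp 1 S
  have hcomm : ∀ m (w : B 1), j ((A ^ m) w) = (E.transferOp 0 S ^ m) (j w) := fun m w => by
    induction m generalizing w with
    | zero => simp
    | succ m ih =>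
      rw [pow_succ, mul_apply_eq_comp, ih, pow_succ, mul_apply_eq_comp]
      exact congrArg _ (incl_transferOp hA hS 0 w)
  have hweak : ∀ m (w : B 1), ‖j ((A ^ m) w)‖ ≤ Cs * ‖j w‖ := fun m w => by
    have h1 := hA.weak_bound (List.replicate m S)
      (fun S' hS' => (List.eq_of_mem_replicate hS') ▸ hS) w
    rw [transferProd, List.map_replicate, List.prod_replicate] at h1
    rw [hcomm]
    exact h1
  have h2 : v = ∑ m ∈ Finset.range n, (A ^ m) (v - A v) + (A ^ n) v := by
    rw [geom_sum_apply_sub]; abel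
  have h3 : ‖∑ m ∈ Finset.range n, j ((A ^ m) (v - A v))‖ ≤ n * Cs * ‖j (v - A v)‖ := by
    refine (norm_sum_le_of_le _ fun m _ => hweak m _).trans_eq ?_
    simp [mul_assoc]
  calc ‖j v‖ = ‖∑ m ∈ Finset.range n, j ((A ^ m) (v - A v)) + j ((A ^ n) v)‖ := by
        rw [← map_sum, ← map_add, ← h2]
    _ ≤ _ := norm_add_le _ _
    _ ≤ n * Cs * ‖j (v - A v)‖ + ε * ‖v‖ := by
      refine add_le_add h3 ((E.norm_incl_le 0 _).trans ?_)
      exact (norm_transferOp_pow_le hA hS 0 hn hv).trans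
        (mul_le_mul_of_nonneg_right hθ (norm_nonneg _))

theorem incl_partialOp (hA : E.StandingAssumptions P 𝒯 νs Cs K θ cbar chat nbar) (k : Fin d)
    (h : B 2) : (E.incl 0 (E.partialOp k 1 h) : B 0) = E.partialOp k 0 (E.incl 1 h) := by
  refine E.eq_of_restrictDistr_eq (i := 0) (LinearMap.ext fun ψ => ?_)
  have h1 := LinearMap.congr_fun (restrictDistr_partialOp hA k 0 (E.incl 1 h)) ψ
  have h2 := LinearMap.congr_fun (restrictDistr_partialOp hA k 1 h) ψ
  have h3 := E.toDistr_incl 0 (E.partialOp k 1 h)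
  have h4 := E.toDistr_incl 1 h
  refine (LinearMap.congr_fun h3 (lowerFun d r ψ)).trans (h2.trans (Eq.trans ?_ h1.symm))
  exact congrArg Neg.neg (LinearMap.congr_fun h4 _).symm

theorem partialOp_mem_V (hA : E.StandingAssumptions P 𝒯 νs Cs K θ cbar chat nbar) (k : Fin d)
    (i : Fin 3) (h : B i.succ) : E.partialOp k i h ∈ E.V i.castSucc := by
  have h1 := LinearMap.congr_fun (restrictDistr_partialOp hA k i h)
    ⟨fun _ => 1, mem_torusFun.2 contDiff_const⟩
  refine h1.trans ?_
  have h2 : partialFun k (⟨fun _ => 1, mem_torusFun.2 contDiff_const⟩ :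
        torusFun d ((r + 1 : ℕ) : WithTop ℕ∞)) = 0 := by
    refine Subtype.ext (funext fun t => ?_)
    change partialDeriv k (fun _ => (1 : ℝ)) t = 0
    simp [partialDeriv]
  change -(E.toDistr i.succ h (partialFun k _)) = 0
  rw [h2, map_zero, neg_zero]

theorem incl_secondOpUpper (hA : E.StandingAssumptions P 𝒯 νs Cs K θ cbar chat nbar)
    {c : ℝ} (hc : P.shifted r c ∈ 𝒯) (h : B 3) :
    (E.incl 0 (E.secondOpUpper P c h) : B 0) = E.secondOp P c (E.incl 2 h) := by
  have h1 : ∀ k, (E.incl 0 (E.partialOp k 1 (E.derivOp P 2 c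
      (E.mulOp 3 (ofSmooth r (P.β k)) h))) : B 0) = E.partialOp k 0 (E.derivOp P 1 c
      (E.mulOp 2 (ofSmooth r (P.β k)) (E.incl 2 h))) := fun k => by
    refine (incl_partialOp hA k _).trans (congrArg (E.partialOp k 0) ?_)
    refine (incl_derivOp_two hA hc _).trans (congrArg (E.derivOp P 1 c) ?_)
    exact incl_mulOp hA 2 (P.β k) h
  have h2 : E.secondOpUpper P c h = -∑ k, (E.partialOp k 1 (E.derivOp P 2 c
      (E.mulOp 3 (ofSmooth r (P.β k)) h)) : B 1) := by
    rw [secondOpUpper, neg_apply, sum_apply]; rfl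
  have h3 : E.secondOp P c (E.incl 2 h) = -∑ k, (E.partialOp k 0 (E.derivOp P 1 c
      (E.mulOp 2 (ofSmooth r (P.β k)) (E.incl 2 h))) : B 0) := by
    rw [secondOp, neg_apply, sum_apply]; rfl
  rw [h2, h3, map_neg, map_sum]
  exact congrArg Neg.neg (Finset.sum_congr rfl fun k _ => h1 k)

/-- Linear response for the invariant densities of the maps `T + c β`. -/
theorem exists_linearResponse [∀ i, CompleteSpace (B i)]
    (hA : E.StandingAssumptions P 𝒯 νs Cs K θ cbar chat nbar)
    {C : Set ℝ} (hC : ∀ c ∈ C, P.shifted r c ∈ 𝒯) (hconv : Convex ℝ C) :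
    ∃ (u' : ℝ → B 2) (u'' : ℝ → B 1), LinearResponse (X0 := B 0) (X1 := B 1) (X2 := B 2)
      (X3 := B 3) C (E.incl 0) (E.incl 1) (E.incl 2) (E.lop P 1) (E.lop P 2) (E.derivOp P 0)
      (E.derivOp P 1) (E.secondOp P) (E.V 1) (E.V 2) (E.density P) u' u'' := by
  have hspec := fun c (hc : c ∈ C) => density_spec hA (hC c hc)
  -- the same operators, with the types of their source and target in normal form
  let j1 : B 2 →L[ℝ] B 1 := E.incl 1
  let D1 : ℝ → B 2 →L[ℝ] B 1 := E.derivOp P 1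
  -- bounds of the operators
  obtain ⟨MD0, hMD0, hD0⟩ := exists_norm_derivOp_le hA 0
  obtain ⟨MD1, hMD1, hD1⟩ := exists_norm_derivOp_le hA 1
  obtain ⟨MD2, hMD2, hD2⟩ := exists_norm_derivOp_le hA 2
  obtain ⟨MI0, hMI0, hI0⟩ := exists_norm_le_norm_sub_transferOp hA 0
  obtain ⟨MI1, hMI1, hI1⟩ := exists_norm_le_norm_sub_transferOp hA 1
  have hL1 : ∀ c ∈ C, ∀ c' ∈ C, ∀ z : B 2,
      ‖E.lop P 1 c' (E.incl 1 z) - E.lop P 1 c (E.incl 1 z)‖ ≤ MD1 * |c' - c| * ‖z‖ := by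
    intro c hc c' hc' z
    have := norm_lop_sub_le hA hC hconv 1 hMD1 (fun c hc => hD1 c (hC c hc)) hc hc' z
    rw [lop, lop, incl_transferOp hA (hC c hc), incl_transferOp hA (hC c' hc')] at this
    exact this
  have hL2 : ∀ c ∈ C, ∀ c' ∈ C, ∀ z : B 3,
      ‖E.lop P 2 c' (E.incl 2 z) - E.lop P 2 c (E.incl 2 z)‖ ≤ MD2 * |c' - c| * ‖z‖ := by
    intro c hc c' hc' z
    have := norm_lop_sub_le hA hC hconv 2 hMD2 (fun c hc => hD2 c (hC c hc)) hc hc' z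
    rw [lop, lop, incl_transferOp hA (hC c hc), incl_transferOp hA (hC c' hc')] at this
    exact this
  obtain ⟨ML0, hML0, hDL0⟩ : ∃ M, 0 ≤ M ∧ ∀ c ∈ C, ∀ c' ∈ C, ∀ z : B 2,
      ‖E.derivOp P 0 c' (E.incl 1 z) - E.derivOp P 0 c (E.incl 1 z)‖ ≤ M * |c' - c| * ‖z‖ :=
    ⟨_, Finset.sum_nonneg fun k _ => by positivity, fun c hc c' hc' z =>
      norm_derivOp_sub_le (P := P) 0 (Z := B 2) (E.incl 1)
        (fun k => E.mulOp 2 (ofSmooth r (P.β k)))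
        (fun k z => (incl_mulOp hA 1 (P.β k) z).symm) hL1 hMD1 hc hc' z⟩
  obtain ⟨ML1, hML1, hDL1⟩ : ∃ M, 0 ≤ M ∧ ∀ c ∈ C, ∀ c' ∈ C, ∀ z : B 3,
      ‖E.derivOp P 1 c' (E.incl 2 z) - E.derivOp P 1 c (E.incl 2 z)‖ ≤ M * |c' - c| * ‖z‖ :=
    ⟨_, Finset.sum_nonneg fun k _ => by positivity, fun c hc c' hc' z =>
      norm_derivOp_sub_le (P := P) 1 (Z := B 3) (E.incl 2)
        (fun k => E.mulOp 3 (ofSmooth r (P.β k)))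
        (fun k z => (incl_mulOp hA 2 (P.β k) z).symm) hL2 hMD2 hc hc' z⟩
  have hofFun : ∀ (i : Fin 3) f, E.incl i (E.ofFun i.succ f) = E.ofFun i.castSucc f :=
    fun i f => E.toDistr_injective _ (by
      rw [E.toDistr_incl]
      exact LinearMap.ext fun φ => by rw [E.toDistr_ofFun, E.toDistr_ofFun])
  have hT1 := fun c hc c' hc' (z : B 3) => norm_lop_sub_sub_le hA hC hconv 1 (Z := B 3)
    (E.incl 2) (E.dense_ofFun 3) (hofFun 2) hML1 hDL1 (c := c) (c' := c') hc hc' z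
  have hT0 := fun c hc c' hc' (z : B 2) => norm_lop_sub_sub_le hA hC hconv 0 (Z := B 2)
    (E.incl 1) (E.dense_ofFun 2) (hofFun 1) hML0 hDL0 (c := c) (c' := c') hc hc' z
  -- the solutions of the differentiated equations
  have hu' : ∀ c, ∃ v : B 2, c ∈ C → v ∈ E.V 2 ∧
      v - E.lop P 2 c v = E.derivOp P 2 c (E.density P c) := fun c => by
    by_cases hc : c ∈ C
    · obtain ⟨v, hv, hv'⟩ := exists_sub_transferOp_eq hA (hC c hc) 1
        (mass_derivOp_one hA (hC c hc) 2 (E.density P c))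
      exact ⟨v, fun _ => ⟨hv, hv'⟩⟩
    · exact ⟨0, fun h => absurd h hc⟩
  choose u' hu' using hu'
  have hQV : ∀ c, E.secondOpUpper P c (E.density P c) ∈ E.V 1 := fun c => by
    rw [secondOpUpper, neg_apply, sum_apply]
    exact (E.V 1).neg_mem ((E.V 1).sum_mem fun k _ => partialOp_mem_V hA k 1 _)
  have hu'' : ∀ c, ∃ v : B 1, c ∈ C → v ∈ E.V 1 ∧
      v - E.lop P 1 c v = (2 : ℝ) • D1 c (u' c) +
        E.secondOpUpper P c (E.density P c) := fun c => by
    by_cases hc : c ∈ C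
    · obtain ⟨v, hv, hv'⟩ := exists_sub_transferOp_eq hA (hC c hc) 0
        ((E.V 1).add_mem ((E.V 1).smul_mem (2 : ℝ)
          (mass_derivOp_one hA (hC c hc) 1 (u' c))) (hQV c))
      exact ⟨v, fun _ => ⟨hv, hv'⟩⟩
    · exact ⟨0, fun h => absurd h hc⟩
  choose u'' hu'' using hu''
  set K0 := (Cs + K) * ‖E.ofFun 3 (oneFun d r)‖
  have hK0 : 0 ≤ K0 := by have := hA.one_le_Cs; have := hA.one_le_K; positivity
  have hub' : ∀ c ∈ C, ‖u' c‖ ≤ MI1 * (MD2 * K0) := fun c hc => by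
    have h1 := hI1 _ (hC c hc) (u' c) (hu' c hc).1
    refine h1.trans (mul_le_mul_of_nonneg_left ?_ hMI1)
    have h2 : u' c - E.transferOp 2 (P.shifted r c) (u' c) =
      E.derivOp P 2 c (E.density P c) := (hu' c hc).2
    refine (congrArg norm h2).trans_le ?_
    exact (hD2 c (hC c hc) _).trans (mul_le_mul_of_nonneg_left (hspec c hc).2.2.2 hMD2)
  obtain ⟨MQ, hMQ, hQb⟩ : ∃ M, 0 ≤ M ∧ ∀ c ∈ C, ∀ z, ‖E.secondOp P c z‖ ≤ M * ‖z‖ := by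
    refine ⟨∑ k, ‖E.partialOp k 0‖ * (MD1 * ‖E.mulOp 2 (ofSmooth r (P.β k))‖),
      Finset.sum_nonneg fun k _ => by positivity, fun c hc z => ?_⟩
    rw [secondOp, neg_apply, norm_neg, sum_apply, Finset.sum_mul]
    refine norm_sum_le_of_le _ fun k _ => ?_
    rw [mul_assoc]
    refine (ContinuousLinearMap.le_opNorm (E.partialOp k _) _).trans
      (mul_le_mul_of_nonneg_left ?_ (norm_nonneg _))
    rw [mul_assoc]
    exact (hD1 c (hC c hc) _).trans
      (mul_le_mul_of_nonneg_left (ContinuousLinearMap.le_opNorm _ _) hMD1)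
  obtain ⟨MQ', hMQ', hQb'⟩ : ∃ M, 0 ≤ M ∧ ∀ c ∈ C, ∀ z, ‖E.secondOpUpper P c z‖ ≤ M * ‖z‖ := by
    refine ⟨∑ k, ‖E.partialOp k 1‖ * (MD2 * ‖E.mulOp 3 (ofSmooth r (P.β k))‖),
      Finset.sum_nonneg fun k _ => by positivity, fun c hc z => ?_⟩
    rw [secondOpUpper, neg_apply, norm_neg, sum_apply, Finset.sum_mul]
    refine norm_sum_le_of_le _ fun k _ => ?_
    rw [mul_assoc]
    refine (ContinuousLinearMap.le_opNorm (E.partialOp k _) _).trans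
      (mul_le_mul_of_nonneg_left ?_ (norm_nonneg _))
    rw [mul_assoc]
    exact (hD2 c (hC c hc) _).trans
      (mul_le_mul_of_nonneg_left (ContinuousLinearMap.le_opNorm _ _) hMD2)
  have hub'' : ∀ c ∈ C, ‖u'' c‖ ≤ MI0 * (2 * (MD1 * (MI1 * (MD2 * K0))) + MQ' * K0) :=
    fun c hc => by
    have h1 := hI0 _ (hC c hc) (u'' c) (hu'' c hc).1
    refine h1.trans (mul_le_mul_of_nonneg_left ?_ hMI0)
    have h2 : u'' c - E.transferOp 1 (P.shifted r c) (u'' c) =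
      (2 : ℝ) • D1 c (u' c) + E.secondOpUpper P c (E.density P c) :=
      (hu'' c hc).2
    refine (congrArg norm h2).trans_le ?_
    refine norm_add_le_of_le ?_
      ((hQb' c hc _).trans (mul_le_mul_of_nonneg_left (hspec c hc).2.2.2 hMQ'))
    rw [norm_smul, Real.norm_ofNat]
    exact mul_le_mul_of_nonneg_left ((hD1 c (hC c hc) _).trans
      (mul_le_mul_of_nonneg_left (hub' c hc) hMD1)) zero_le_two
  refine ⟨u', u'',
    { map_V := fun v hv => (E.mass_incl 1 v).trans hv
      u_bound := ⟨K0, hK0, fun c hc => (hspec c hc).2.2.2⟩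
      u'_bound := ⟨_, by positivity, hub'⟩
      u''_bound := ⟨_, by positivity, hub''⟩
      sub_mem := fun c hc c' hc' => ?_
      u'_mem := fun c hc => (hu' c hc).1
      u''_mem := fun c hc => (hu'' c hc).1
      u_eq := fun c hc => ?_
      u'_eq := fun c hc => ?_
      u''_eq := fun c hc => ?_
      L_comm := fun c hc v => (incl_transferOp hA (hC c hc) 1 v).symm
      D_comm := fun c hc v => incl_derivOp_one hA (hC c hc) v
      L2_lip := ⟨MD2, hMD2, hL2⟩
      L1_lip := ⟨MD1, hMD1, hL1⟩
      L2_taylor := ⟨ML1, hML1, hT1⟩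
      L1_taylor := ⟨ML0, hML0, hT0⟩
      D1_lip := ⟨ML1, hML1, hDL1⟩
      D0_taylor := ?_
      D0_bound := ⟨MD0, hMD0, fun c hc => hD0 c (hC c hc)⟩
      D1_bound := ⟨MD1, hMD1, fun c hc => hD1 c (hC c hc)⟩
      Q0_bound := ⟨MQ, hMQ, hQb⟩
      inv1 := ⟨MI0, hMI0, fun c hc => hI0 _ (hC c hc)⟩
      inv2 := ⟨MI1, hMI1, fun c hc => hI1 _ (hC c hc)⟩
      weak_inv := fun ε hε => ?_ }⟩
  · have h1 : E.density P c' - E.density P c ∈ E.V 3 := by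
      rw [mem_V, map_sub]
      exact sub_eq_zero.2 ((hspec c' hc').1.trans (hspec c hc).1.symm)
    have h2 := (E.mass_incl 2 (E.density P c' - E.density P c)).trans h1
    rw [map_sub] at h2
    exact h2
  · refine (incl_transferOp hA (hC c hc) 2 (E.density P c)).symm.trans
      (congrArg (E.incl 2) (E.toDistr_injective 3 ?_))
    exact (toDistr_transferOp hA (hC c hc) 3 _).trans (hspec c hc).2.1
  · have h1 : (E.incl 1 (u' c - E.lop P 2 c (u' c)) : B 1) =
        E.incl 1 (E.derivOp P 2 c (E.density P c)) := congrArg (E.incl 1) (hu' c hc).2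
    rw [map_sub] at h1
    refine Eq.trans ?_ (h1.trans (incl_derivOp_two hA (hC c hc) _))
    exact congrArg (fun w : B 1 => j1 (u' c) - w)
      (incl_transferOp hA (hC c hc) 1 (u' c)).symm
  · rw [(hu'' c hc).2, map_add, map_smul]
    exact congrArg₂ (fun a b : B 0 => (2 : ℝ) • a + b) (incl_derivOp_one hA (hC c hc) (u' c))
      (incl_secondOpUpper hA (hC c hc) (E.density P c))
  · refine ⟨∑ k, ‖E.partialOp k 0‖ * (ML1 * ‖E.mulOp 3 (ofSmooth r (P.β k))‖),
      Finset.sum_nonneg fun k _ => by positivity, fun c hc c' hc' z => ?_⟩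
    have hcomm : ∀ k, (E.mulOp 1 (ofSmooth r (P.β k)) (E.incl 1 (E.incl 2 z)) : B 1) =
        E.incl 1 (E.incl 2 (E.mulOp 3 (ofSmooth r (P.β k)) z)) := fun k => by
      refine (incl_mulOp hA 1 (P.β k) (E.incl 2 z)).symm.trans (congrArg (E.incl 1) ?_)
      exact (incl_mulOp hA 2 (P.β k) z).symm
    have hLc : ∀ c ∈ C, ∀ y : B 3, (E.lop P 1 c (E.incl 1 (E.incl 2 y)) : B 1) =
        E.incl 1 (E.lop P 2 c (E.incl 2 y)) := fun c hc y =>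
      (incl_transferOp hA (hC c hc) 1 (E.incl 2 y)).symm
    have hexp : ∀ c ∈ C, (E.derivOp P 0 c (E.incl 1 (E.incl 2 z)) : B 0) =
        -∑ k, (E.partialOp k 0 (E.incl 1 (E.lop P 2 c
          (E.incl 2 (E.mulOp 3 (ofSmooth r (P.β k)) z)))) : B 0) := fun c hc => by
      have h1 : (E.derivOp P 0 c (E.incl 1 (E.incl 2 z)) : B 0) =
          -∑ k, (E.partialOp k 0 (E.lop P 1 c (E.mulOp 1 (ofSmooth r (P.β k))
            (E.incl 1 (E.incl 2 z)))) : B 0) := by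
        rw [derivOp, neg_apply, sum_apply]; rfl
      rw [h1]
      refine congrArg Neg.neg (Finset.sum_congr rfl fun k _ => congrArg (E.partialOp k 0) ?_)
      rw [hcomm]
      exact hLc c hc _
    have hQ : E.secondOp P c (E.incl 2 z) = -∑ k, (E.partialOp k 0 (E.derivOp P 1 c
        (E.incl 2 (E.mulOp 3 (ofSmooth r (P.β k)) z))) : B 0) := by
      rw [secondOp, neg_apply, sum_apply]
      refine congrArg Neg.neg (Finset.sum_congr rfl fun k _ => congrArg (E.partialOp k 0) ?_)
      exact congrArg (E.derivOp P 1 c) (incl_mulOp hA 2 (P.β k) z).symm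
    rw [hexp c hc, hexp c' hc', hQ]
    have hsum : -∑ k, (E.partialOp k 0 (E.incl 1 (E.lop P 2 c'
          (E.incl 2 (E.mulOp 3 (ofSmooth r (P.β k)) z)))) : B 0) -
        -∑ k, (E.partialOp k 0 (E.incl 1 (E.lop P 2 c
          (E.incl 2 (E.mulOp 3 (ofSmooth r (P.β k)) z)))) : B 0) -
        (c' - c) • -∑ k, (E.partialOp k 0 (E.derivOp P 1 c
          (E.incl 2 (E.mulOp 3 (ofSmooth r (P.β k)) z))) : B 0) =
        -∑ k, (E.partialOp k 0 (j1 (E.lop P 2 c'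
            (E.incl 2 (E.mulOp 3 (ofSmooth r (P.β k)) z))) -
          j1 (E.lop P 2 c (E.incl 2 (E.mulOp 3 (ofSmooth r (P.β k)) z))) -
          (c' - c) • D1 c (E.incl 2 (E.mulOp 3 (ofSmooth r (P.β k)) z))) : B 0) := by
      have h1 : ∀ k (a b e : B 1), (E.partialOp k 0 (a - b - (c' - c) • e) : B 0) =
          E.partialOp k 0 a - E.partialOp k 0 b - (c' - c) • E.partialOp k 0 e :=
        fun k a b e => by
          have := (E.partialOp k 0 : B 1 →L[ℝ] B 0).map_sub (a - b) ((c' - c) • e)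
          have h2 := (E.partialOp k 0 : B 1 →L[ℝ] B 0).map_sub a b
          have h3 := (E.partialOp k 0 : B 1 →L[ℝ] B 0).map_smul (c' - c) e
          refine this.trans ?_
          rw [h2, h3]
      refine Eq.trans ?_ (congrArg Neg.neg (Finset.sum_congr rfl fun k _ => (h1 k _ _ _).symm))
      rw [Finset.sum_sub_distrib, Finset.sum_sub_distrib, ← Finset.smul_sum, smul_neg]
      abel
    rw [hsum, norm_neg, Finset.sum_mul, Finset.sum_mul]
    refine norm_sum_le_of_le _ fun k _ => ?_
    refine (ContinuousLinearMap.le_opNorm _ _).trans ?_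
    rw [mul_assoc, mul_assoc]
    refine mul_le_mul_of_nonneg_left ((hT1 c hc c' hc' _).trans ?_) (norm_nonneg _)
    calc _ ≤ ML1 * (c' - c) ^ 2 * (‖E.mulOp 3 (ofSmooth r (P.β k))‖ * ‖z‖) := by
          gcongr; exact ContinuousLinearMap.le_opNorm _ _
      _ = _ := by ring
  · obtain ⟨M, hM, h⟩ := exists_norm_incl_le_add hA hε
    exact ⟨M, hM, fun c hc => h _ (hC c hc)⟩

end

end BanachScale

/-! ### The scalar bifurcation problem -/

/-- A critical zero of `f` with positive second derivative is a strict local minimum, also relative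
to an interval `C` in which it may be an endpoint. -/
theorem eventually_pos_of_second_deriv_pos {C : Set ℝ} (hC : C.OrdConnected) {f f1 : ℝ → ℝ}
    {f2 c0 : ℝ} (hc0 : c0 ∈ C) (hf : ∀ c ∈ C, HasDerivWithinAt f (f1 c) C c)
    (hf1 : HasDerivWithinAt f1 f2 C c0) (h0 : f c0 = 0) (h1 : f1 c0 = 0) (h2 : 0 < f2) :
    ∀ᶠ c in 𝓝[C \ {c0}] c0, 0 < f c := by
  have hs := (hasDerivWithinAt_iff_tendsto_slope.1 hf1).eventually (lt_mem_nhds h2)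
  obtain ⟨δ, hδ, hball⟩ := Metric.mem_nhdsWithin_iff.1 hs
  have hsign : ∀ c ∈ C, c ≠ c0 → |c - c0| < δ → 0 < f1 c * (c - c0) := fun c hc hne hd => by
    have h3 : 0 < slope f1 c0 c := hball ⟨by simpa [Real.dist_eq] using hd, hc, hne⟩
    rw [slope_def_field, h1, sub_zero] at h3
    have h4 : c - c0 ≠ 0 := sub_ne_zero.2 hne
    have : f1 c * (c - c0) = f1 c / (c - c0) * (c - c0) ^ 2 := by field_simp
    rw [this]; positivity
  have hder : ∀ x y, x ∈ C → y ∈ C → ∀ z ∈ Ioo x y, HasDerivAt f (f1 z) z :=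
    fun x y hx hy z hz => (hf z (hC.out hx hy ⟨hz.1.le, hz.2.le⟩)).hasDerivAt
      (mem_of_superset (Icc_mem_nhds hz.1 hz.2) (hC.out hx hy))
  have hcont : ContinuousOn f C := fun c hc => (hf c hc).continuousWithinAt
  refine Metric.mem_nhdsWithin_iff.2 ⟨δ, hδ, fun c ⟨hcb, hc, hne⟩ => ?_⟩
  have hd : |c - c0| < δ := by simpa [Real.dist_eq] using hcb
  rcases lt_or_gt_of_ne (show c ≠ c0 from hne) with hlt | hlt
  · obtain ⟨z, hz, hz'⟩ := exists_hasDerivAt_eq_slope f f1 hlt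
      (hcont.mono (hC.out hc hc0)) (hder c c0 hc hc0)
    have h3 := hsign z (hC.out hc hc0 ⟨hz.1.le, hz.2.le⟩) hz.2.ne (by
      rw [abs_lt] at hd ⊢; constructor <;> linarith [hz.1, hz.2])
    have h4 : f1 z < 0 := by nlinarith [hz.2]
    rw [hz', h0, div_neg_iff] at h4
    change 0 < f c
    rcases h4 with h4 | h4 <;> linarith
  · obtain ⟨z, hz, hz'⟩ := exists_hasDerivAt_eq_slope f f1 hlt
      (hcont.mono (hC.out hc0 hc)) (hder c0 c hc0 hc)
    have h3 := hsign z (hC.out hc0 hc ⟨hz.1.le, hz.2.le⟩) hz.1.ne' (by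
      rw [abs_lt] at hd ⊢; constructor <;> linarith [hz.1, hz.2])
    have h4 : 0 < f1 z := by nlinarith [hz.1]
    rw [hz', h0, div_pos_iff] at h4
    change 0 < f c
    rcases h4 with h4 | h4 <;> linarith

/-- The scalar problem `c = ν a(c)`, with `ν ∈ [0,νs]` and `c` in the interval spanned by `0` and
the numbers `ν t`, `t ∈ [m,M]`. Each solution is either transversal or a nondegenerate fold. -/
structure ScalarProblem (νs m M : ℝ) (C : Set ℝ) (a a1 a2 : ℝ → ℝ) : Prop where
  νs_pos : 0 < νs
  eq_Icc : C = Icc (min 0 (νs * m)) (max 0 (νs * M))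
  mem_Icc : ∀ c ∈ C, a c ∈ Icc m M
  hasDeriv : ∀ c ∈ C, HasDerivWithinAt a (a1 c) C c
  hasDeriv₂ : ∀ c ∈ C, HasDerivWithinAt a1 (a2 c) C c
  nondegenerate : ∀ ν ∈ Icc 0 νs, ∀ c ∈ C, c = ν * a c →
    1 - ν * a1 c ≠ 0 ∨ (a c ≠ 0 ∧ a2 c ≠ 0)

namespace ScalarProblem

variable {νs m M : ℝ} {C : Set ℝ} {a a1 a2 : ℝ → ℝ}

theorem ordConnected (R : ScalarProblem νs m M C a a1 a2) : C.OrdConnected := by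
  rw [R.eq_Icc]; exact ordConnected_Icc

theorem isCompact (R : ScalarProblem νs m M C a a1 a2) : IsCompact C := by
  rw [R.eq_Icc]; exact isCompact_Icc

theorem zero_mem (R : ScalarProblem νs m M C a a1 a2) : (0 : ℝ) ∈ C := by
  rw [R.eq_Icc]; exact ⟨min_le_left _ _, le_max_left _ _⟩

theorem continuousOn (R : ScalarProblem νs m M C a a1 a2) : ContinuousOn a C :=
  fun c hc => (R.hasDeriv c hc).continuousWithinAt

theorem hasDeriv_defect (R : ScalarProblem νs m M C a a1 a2) (ν : ℝ) {c : ℝ} (hc : c ∈ C) :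
    HasDerivWithinAt (fun c => c - ν * a c) (1 - ν * a1 c) C c :=
  (hasDerivWithinAt_id c C).sub ((R.hasDeriv c hc).const_mul ν)

theorem hasDeriv_defect₂ (R : ScalarProblem νs m M C a a1 a2) (ν : ℝ) {c : ℝ} (hc : c ∈ C) :
    HasDerivWithinAt (fun c => 1 - ν * a1 c) (-(ν * a2 c)) C c :=
  ((R.hasDeriv₂ c hc).const_mul ν).const_sub 1

/-- At a fold, `c - ν a(c)` has a strict extremum. -/
theorem eventually_fold (R : ScalarProblem νs m M C a a1 a2) {ν c0 : ℝ}
    (hc0 : c0 ∈ C) (h0 : c0 = ν * a c0) (h1 : 1 - ν * a1 c0 = 0) (h2 : a2 c0 ≠ 0) :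
    (∀ᶠ c in 𝓝[C \ {c0}] c0, 0 < c - ν * a c) ∨ (∀ᶠ c in 𝓝[C \ {c0}] c0, c - ν * a c < 0) := by
  have hν : ν ≠ 0 := by rintro rfl; simp at h1
  rcases lt_or_gt_of_ne (mul_ne_zero hν h2) with h | h
  · exact Or.inl (eventually_pos_of_second_deriv_pos R.ordConnected hc0
      (fun c hc => R.hasDeriv_defect ν hc) (R.hasDeriv_defect₂ ν hc0) (sub_eq_zero.2 h0) h1
      (by linarith))
  · refine Or.inr ((eventually_pos_of_second_deriv_pos R.ordConnected hc0
      (f := fun c => -(c - ν * a c)) (f1 := fun c => -(1 - ν * a1 c)) (f2 := - -(ν * a2 c0))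
      (fun c hc => (R.hasDeriv_defect ν hc).neg) (R.hasDeriv_defect₂ ν hc0).neg
      (neg_eq_zero.2 (sub_eq_zero.2 h0)) (neg_eq_zero.2 h1) (by linarith)).mono fun c hc => ?_)
    linarith

theorem eventually_defect_ne_zero (R : ScalarProblem νs m M C a a1 a2) {ν c0 : ℝ}
    (hν : ν ∈ Icc 0 νs) (hc0 : c0 ∈ C) (h0 : c0 = ν * a c0) :
    ∀ᶠ c in 𝓝[C \ {c0}] c0, c - ν * a c ≠ 0 := by
  by_cases h1 : 1 - ν * a1 c0 = 0
  · have h2 := ((R.nondegenerate ν hν c0 hc0 h0).resolve_left (not_not.2 h1)).2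
    rcases R.eventually_fold hc0 h0 h1 h2 with h | h
    · exact h.mono fun c hc => hc.ne'
    · exact h.mono fun c hc => hc.ne
  · exact (R.hasDeriv_defect ν hc0).eventually_ne h1

theorem finite_solutions (R : ScalarProblem νs m M C a a1 a2) {ν : ℝ} (hν : ν ∈ Icc 0 νs) :
    {c | c ∈ C ∧ c = ν * a c}.Finite := by
  by_contra hinf
  obtain ⟨c0, hc0, hacc⟩ := Set.Infinite.exists_accPt_of_subset_isCompact hinf R.isCompact
    fun c hc => hc.1
  have hcl : IsClosed {c | c ∈ C ∧ c = ν * a c} := by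
    have h1 : ContinuousOn (fun c => c - ν * a c) C :=
      fun c hc => (R.hasDeriv_defect ν hc).continuousWithinAt
    have h2 := h1.preimage_isClosed_of_isClosed R.isCompact.isClosed
      (isClosed_singleton (x := (0 : ℝ)))
    convert h2 using 1
    ext c
    simp [sub_eq_zero]
  have h0 : c0 = ν * a c0 := (hcl.closure_eq ▸ mem_closure_iff_clusterPt.2 hacc.clusterPt :
    c0 ∈ {c | c ∈ C ∧ c = ν * a c}).2
  have h1 := eventually_nhdsWithin_iff.1 (R.eventually_defect_ne_zero hν hc0 h0)
  obtain ⟨c, ⟨hne, hc, hc'⟩, h⟩ := ((accPt_iff_frequently.1 hacc).and_eventually h1).exists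
  exact h ⟨hc, hne⟩ (sub_eq_zero.2 hc')

/-- A curve of solutions of `c = ν a(c)`: the parameter interval, `ν` and `c`. A curve that consists
of solutions with `c ≠ 0` is parametrized by `c` itself; when `a(0) = 0`, the line `c = 0` is
parametrized by an interval to the right of `C`, so that the parameter always determines `c`. -/
structure IsCurve (νs M : ℝ) (C : Set ℝ) (a : ℝ → ℝ) (I : Set ℝ) (G γ : ℝ → ℝ) : Prop where
  nonempty : I.Nonempty
  ordConnected : I.OrdConnected
  nontrivial : I.Nontrivial ∨ ∀ y ∈ I, G y = νs
  diff_G : DifferentiableOn ℝ G I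
  diff_γ : DifferentiableOn ℝ γ I
  sol : ∀ y ∈ I, G y ∈ Icc 0 νs ∧ γ y ∈ C ∧ γ y = G y * a (γ y)
  finite : ∀ ν ∈ Icc 0 νs, {y | y ∈ I ∧ G y = ν}.Finite
  param : ∀ y ∈ I, (y ∈ C ∧ γ y = y) ∨ (max 0 (νs * M) < y ∧ γ y = 0)

/-- Near a solution with `a(c₀) = 0`, hence `c₀ = 0`, only the line `c = 0` solves the problem. -/
theorem exists_curve_of_eq_zero (R : ScalarProblem νs m M C a a1 a2) {ν0 : ℝ}
    (hν0 : ν0 ∈ Icc 0 νs) (ha : a 0 = 0) :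
    ∃ U ∈ 𝓝 (ν0, (0 : ℝ)), ∃ (I : Set ℝ) (G γ : ℝ → ℝ), IsCurve νs M C a I G γ ∧
      ∀ ν ∈ Icc 0 νs, ∀ c ∈ C, c = ν * a c → (ν, c) ∈ U → ∃ y ∈ I, G y = ν ∧ γ y = c := by
  have hne : 1 - ν0 * a1 0 ≠ 0 :=
    (R.nondegenerate ν0 hν0 0 R.zero_mem (by rw [ha, mul_zero])).resolve_right fun h => h.1 ha
  have ht : Tendsto (fun p : ℝ × ℝ => 1 - p.1 * slope a 0 p.2) (𝓝 ν0 ×ˢ 𝓝[C \ {0}] 0)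
      (𝓝 (1 - ν0 * a1 0)) :=
    tendsto_const_nhds.sub (tendsto_fst.mul
      ((hasDerivWithinAt_iff_tendsto_slope.1 (R.hasDeriv 0 R.zero_mem)).comp tendsto_snd))
  obtain ⟨s, hs, t, hts, hst⟩ := mem_prod_iff.1 (ht.eventually_ne hne)
  obtain ⟨t', ht', htt⟩ := mem_nhdsWithin_iff_exists_mem_nhds_inter.1 hts
  set q := max 0 (νs * M)
  refine ⟨s ×ˢ t', prod_mem_nhds hs ht', Icc (q + 1) (q + 1 + νs), fun y => y - (q + 1),
    fun _ => 0, ?_, fun ν hν c hc h0 hU => ?_⟩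
  · have := R.νs_pos
    exact
    { nonempty := nonempty_Icc.2 (by linarith)
      ordConnected := ordConnected_Icc
      nontrivial := Or.inl ⟨q + 1, by simp [this.le], q + 1 + νs, by simp [this.le], by simp [this.ne']⟩
      diff_G := (differentiable_id.sub_const _).differentiableOn
      diff_γ := differentiableOn_const 0
      sol := fun y hy => ⟨⟨by linarith [hy.1], by linarith [hy.2]⟩, R.zero_mem, by rw [ha, mul_zero]⟩
      finite := fun ν _ => (finite_singleton (ν + (q + 1))).subset fun y hy =>
        eq_add_of_sub_eq hy.2
      param := fun y hy => Or.inr ⟨by linarith [hy.1], rfl⟩ }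
  · have hc0 : c = 0 := by
      by_contra hcne
      refine hst ⟨hU.1, htt ⟨hU.2, hc, hcne⟩⟩ ?_
      change 1 - ν * slope a 0 c = 0
      rw [slope_def_field, ha, sub_zero, sub_zero]
      field_simp
      linarith
    exact ⟨ν + (q + 1), ⟨by linarith [hν.1], by linarith [hν.2]⟩, by ring, hc0.symm⟩

/-- Near a solution with `a(c₀) ≠ 0`, the solutions with `0 ≤ ν ≤ νs` form one interval in `c`: on
either side of `c₀`, the function `c / a(c)` does not take the values `0` and `νs`. -/
theorem exists_curve_of_ne_zero (R : ScalarProblem νs m M C a a1 a2) {ν0 c0 : ℝ}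
    (hν0 : ν0 ∈ Icc 0 νs) (hc0 : c0 ∈ C) (h0 : c0 = ν0 * a c0) (ha : a c0 ≠ 0) :
    ∃ U ∈ 𝓝 (ν0, c0), ∃ (I : Set ℝ) (G γ : ℝ → ℝ), IsCurve νs M C a I G γ ∧
      ∀ ν ∈ Icc 0 νs, ∀ c ∈ C, c = ν * a c → (ν, c) ∈ U → ∃ y ∈ I, G y = ν ∧ γ y = c := by
  have hpos := R.νs_pos
  set G : ℝ → ℝ := fun c => c / a c with hG
  have hG0 : G c0 = ν0 := by rw [hG]; field_simp; linarith
  -- the values `0` and `νs` of `c / a(c)` are taken at finitely many points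
  have hfin : ({c | c ∈ C ∧ c = 0 * a c} ∪ {c | c ∈ C ∧ c = νs * a c}).Finite :=
    (R.finite_solutions ⟨le_rfl, hpos.le⟩).union (R.finite_solutions ⟨hpos.le, le_rfl⟩)
  have hU1 : (({c | c ∈ C ∧ c = 0 * a c} ∪ {c | c ∈ C ∧ c = νs * a c}) \ {c0})ᶜ ∈ 𝓝 c0 :=
    (hfin.subset sdiff_subset).isClosed.isOpen_compl.mem_nhds (by simp)
  obtain ⟨W, hW, hWa⟩ := mem_nhdsWithin_iff_exists_mem_nhds_inter.1
    ((R.continuousOn c0 hc0).eventually_ne ha)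
  obtain ⟨δ, hδ, hball⟩ := Metric.mem_nhds_iff.1 (inter_mem hU1 hW)
  set U := Metric.ball c0 δ with hU
  have hUord : U.OrdConnected := (convex_ball c0 δ).ordConnected
  have hane : ∀ c ∈ C, c ∈ U → a c ≠ 0 := fun c hc hcU => hWa ⟨(hball hcU).2, hc⟩
  have hval : ∀ c ∈ C, c ∈ U → c ≠ c0 → G c ≠ 0 ∧ G c ≠ νs := fun c hc hcU hne => by
    have h1 := (hball hcU).1
    have h2 := hane c hc hcU
    simp only [mem_compl_iff, Set.mem_sdiff, mem_union, mem_ofPred_eq, mem_singleton_iff, not_and,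
      not_not] at h1
    refine ⟨fun h => hne (h1 (Or.inl ⟨hc, ?_⟩)), fun h => hne (h1 (Or.inr ⟨hc, ?_⟩))⟩
    · rw [zero_mul]; exact (div_eq_zero_iff.1 h).resolve_right h2
    · rw [← h, hG]; field_simp
  have hcont : ContinuousOn G (C ∩ U) := fun c hc =>
    (continuousWithinAt_id.div ((R.continuousOn c hc.1).mono inter_subset_left)
      (hane c hc.1 hc.2))
  set Z := {c | (c ∈ C ∧ G c ∈ Icc 0 νs) ∧ c ∈ U} with hZ
  -- by the intermediate value theorem, membership in `Z` propagates on either side of `c0`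
  have hprop : ∀ p q, uIcc p q ⊆ C ∩ U → c0 ∉ uIcc p q → G p ∈ Icc 0 νs → G q ∈ Icc 0 νs := by
    intro p q hpq hc0' hGp
    have hiv := intermediate_value_uIcc (hcont.mono hpq)
    have hno : ∀ v ∈ uIcc (G p) (G q), v ≠ 0 ∧ v ≠ νs := fun v hv => by
      obtain ⟨x, hx, rfl⟩ := hiv hv
      exact hval x (hpq hx).1 (hpq hx).2 fun h => hc0' (h ▸ hx)
    by_contra hGq
    rw [Set.mem_Icc, not_and_or, not_le, not_le] at hGq
    rcases hGq with h | h
    · exact (hno 0 (mem_uIcc.2 (Or.inr ⟨h.le, hGp.1⟩))).1 rfl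
    · exact (hno νs (mem_uIcc.2 (Or.inl ⟨hGp.2, h.le⟩))).2 rfl
  have hcZ : c0 ∈ Z := ⟨⟨hc0, hG0 ▸ hν0⟩, Metric.mem_ball_self hδ⟩
  have hord : Z.OrdConnected := by
    refine ⟨fun x hx y hy z hz => ?_⟩
    have hzC : z ∈ C := R.ordConnected.out hx.1.1 hy.1.1 hz
    have hzU : z ∈ U := hUord.out hx.2 hy.2 hz
    refine ⟨⟨hzC, ?_⟩, hzU⟩
    have hsub : ∀ w ∈ C, w ∈ U → uIcc w z ⊆ C ∩ U := fun w hw hwU =>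
      subset_inter (R.ordConnected.uIcc_subset hw hzC) (hUord.uIcc_subset hwU hzU)
    rcases lt_trichotomy z c0 with h | h | h
    · refine hprop x z (hsub x hx.1.1 hx.2) ?_ hx.1.2
      rw [uIcc_of_le hz.1]
      exact fun hmem => absurd hmem.2 (not_le.2 h)
    · exact h ▸ hcZ.1.2
    · refine hprop y z (hsub y hy.1.1 hy.2) ?_ hy.1.2
      rw [uIcc_of_ge hz.2]
      exact fun hmem => absurd hmem.1 (not_le.2 h)
  have hGt : Tendsto G (𝓝[C] c0) (𝓝 ν0) := by
    rw [← hG0]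
    exact continuousWithinAt_id.div (R.continuousOn c0 hc0) ha
  -- a point other than `c0` can only be missing if `c / a(c)` has a minimum, of value `νs`
  have hnontriv : Z.Nontrivial ∨ ∀ y ∈ Z, G y = νs := by
    by_contra hcon
    rw [not_or] at hcon
    obtain ⟨hsub, hex⟩ := hcon
    have hsing : ∀ x ∈ Z, x = c0 := fun x hx => not_nontrivial_iff.1 hsub hx hcZ
    have hlt : ν0 < νs := lt_of_le_of_ne hν0.2 fun h => hex fun y hy => by
      rw [hsing y hy, hG0, h]
    have hev : ∀ᶠ x in 𝓝[C] c0, x ∈ U ∧ G x < νs :=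
      (eventually_nhdsWithin_of_eventually_nhds (Metric.ball_mem_nhds c0 hδ)).and
        (hGt.eventually (gt_mem_nhds hlt))
    by_cases hcz : c0 = 0
    · subst hcz
      have ha' := R.mem_Icc 0 hc0
      have hcont0 : ContinuousWithinAt a C 0 := R.continuousOn 0 hc0
      rcases lt_or_gt_of_ne ha with hneg | hposa
      · have hm : νs * m < 0 := mul_neg_of_pos_of_neg hpos (ha'.1.trans_lt hneg)
        have hle : 𝓝[<] (0 : ℝ) ≤ 𝓝[C] 0 := by
          refine nhdsWithin_le_iff.2 ?_
          filter_upwards [Ioo_mem_nhdsLT hm] with x hx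
          rw [R.eq_Icc]
          exact ⟨(min_le_right _ _).trans hx.1.le, hx.2.le.trans (le_max_left _ _)⟩
        obtain ⟨x, ⟨⟨hxU, hxlt⟩, hxa⟩, hxC, hx0⟩ :=
          (((hev.and (hcont0.eventually (gt_mem_nhds hneg))).filter_mono hle).and
            ((eventually_mem_nhdsWithin.filter_mono hle).and
              (eventually_mem_nhdsWithin (s := Iio (0 : ℝ))))).exists
        exact (show x < 0 from hx0).ne
          (hsing x ⟨⟨hxC, div_nonneg_of_nonpos (le_of_lt hx0) hxa.le, hxlt.le⟩, hxU⟩)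
      · have hm : 0 < νs * M := mul_pos hpos (hposa.trans_le ha'.2)
        have hle : 𝓝[>] (0 : ℝ) ≤ 𝓝[C] 0 := by
          refine nhdsWithin_le_iff.2 ?_
          filter_upwards [Ioo_mem_nhdsGT hm] with x hx
          rw [R.eq_Icc]
          exact ⟨(min_le_left _ _).trans hx.1.le, hx.2.le.trans (le_max_right _ _)⟩
        obtain ⟨x, ⟨⟨hxU, hxlt⟩, hxa⟩, hxC, hx0⟩ :=
          (((hev.and (hcont0.eventually (lt_mem_nhds hposa))).filter_mono hle).and
            ((eventually_mem_nhdsWithin.filter_mono hle).and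
              (eventually_mem_nhdsWithin (s := Ioi (0 : ℝ))))).exists
        exact (show 0 < x from hx0).ne'
          (hsing x ⟨⟨hxC, div_nonneg (le_of_lt hx0) hxa.le, hxlt.le⟩, hxU⟩)
    · have hν0pos : 0 < ν0 := lt_of_le_of_ne hν0.1 fun h => hcz (by rw [h0, ← h, zero_mul])
      have hacc : AccPt c0 (𝓟 C) := R.ordConnected.isPreconnected.preperfect_of_nontrivial
        ⟨c0, hc0, 0, R.zero_mem, hcz⟩ c0 hc0
      have hev' := eventually_nhdsWithin_iff.1 (hev.and (hGt.eventually (lt_mem_nhds hν0pos)))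
      obtain ⟨x, ⟨hne, hxC⟩, hx⟩ :=
        ((accPt_iff_frequently.1 hacc).and_eventually hev').exists
      obtain ⟨⟨hxU, hxlt⟩, hxpos⟩ := hx hxC
      exact hne (hsing x ⟨⟨hxC, hxpos.le, hxlt.le⟩, hxU⟩)
  have hZC : Z ⊆ C := fun y hy => hy.1.1
  refine ⟨univ ×ˢ U, prod_mem_nhds univ_mem (Metric.ball_mem_nhds c0 hδ), Z, G, id,
    { nonempty := ⟨c0, hcZ⟩
      ordConnected := hord
      nontrivial := hnontriv
      diff_G := fun y hy => ((differentiableWithinAt_id.div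
        ((R.hasDeriv y (hZC hy)).differentiableWithinAt.mono hZC)
        (hane y (hZC hy) hy.2)))
      diff_γ := differentiableOn_id
      sol := fun y hy => ⟨hy.1.2, hZC hy, ?_⟩
      finite := fun ν hν => (R.finite_solutions hν).subset fun y hy => ⟨hZC hy.1, ?_⟩
      param := fun y hy => Or.inl ⟨hZC hy, rfl⟩ }, fun ν hν c hc hcν hcU => ?_⟩
  · have := hane y (hZC hy) hy.2
    simp only [id, hG]
    field_simp
  · have := hane y (hZC hy.1) hy.1.2
    rw [← hy.2, hG]
    field_simp
  · have h1 := hane c hc hcU.2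
    have h2 : G c = ν := by rw [hG]; field_simp; linarith
    exact ⟨c, ⟨⟨hc, h2 ▸ hν⟩, hcU.2⟩, h2, rfl⟩

/-- The solution set is a finite union of curves, by compactness. -/
theorem exists_curves (R : ScalarProblem νs m M C a a1 a2) :
    ∃ (N : ℕ) (I : Fin N → Set ℝ) (G γ : Fin N → ℝ → ℝ),
      (∀ k, IsCurve νs M C a (I k) (G k) (γ k)) ∧
      ∀ ν ∈ Icc 0 νs, ∀ c ∈ C, c = ν * a c → ∃ k, ∃ y ∈ I k, G k y = ν ∧ γ k y = c := by
  set S : Set (ℝ × ℝ) := {p | p ∈ Icc 0 νs ×ˢ C ∧ p.2 - p.1 * a p.2 = 0} with hS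
  have hcpt : IsCompact S := by
    have h1 : IsCompact (Icc 0 νs ×ˢ C) := isCompact_Icc.prod R.isCompact
    have h2 : ContinuousOn (fun p : ℝ × ℝ => p.2 - p.1 * a p.2) (Icc 0 νs ×ˢ C) :=
      continuousOn_snd.sub (continuousOn_fst.mul
        (R.continuousOn.comp continuousOn_snd fun p hp => hp.2))
    exact h1.of_isClosed_subset (h2.preimage_isClosed_of_isClosed h1.isClosed
      (isClosed_singleton (x := (0 : ℝ)))) fun p hp => hp.1
  have hloc : ∀ p ∈ S, ∃ U ∈ 𝓝 p, ∃ (I : Set ℝ) (G γ : ℝ → ℝ), IsCurve νs M C a I G γ ∧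
      ∀ ν ∈ Icc 0 νs, ∀ c ∈ C, c = ν * a c → (ν, c) ∈ U → ∃ y ∈ I, G y = ν ∧ γ y = c := by
    rintro ⟨ν0, c0⟩ ⟨⟨hν0, hc0⟩, h0⟩
    have h0 : c0 = ν0 * a c0 := sub_eq_zero.1 h0
    by_cases ha : a c0 = 0
    · have hcz : c0 = 0 := by rw [h0, ha, mul_zero]
      rw [hcz] at ha ⊢
      exact R.exists_curve_of_eq_zero hν0 ha
    · exact R.exists_curve_of_ne_zero hν0 hc0 h0 ha
  choose! U hU I G γ hcurve hcover using hloc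
  obtain ⟨t, htS, ht⟩ := hcpt.elim_nhds_subcover U hU
  refine ⟨t.card, fun k => I (t.equivFin.symm k), fun k => G (t.equivFin.symm k),
    fun k => γ (t.equivFin.symm k), fun k => hcurve _ (htS _ (t.equivFin.symm k).2),
    fun ν hν c hc h0 => ?_⟩
  have hmem : (ν, c) ∈ S := ⟨⟨hν, hc⟩, sub_eq_zero.2 h0⟩
  obtain ⟨p, hp, hpU⟩ := mem_iUnion₂.1 (ht hmem)
  obtain ⟨y, hy⟩ := hcover p (htS p hp) ν hν c hc h0 hpU
  exact ⟨t.equivFin ⟨p, hp⟩, y, by simpa using hy⟩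

theorem exists_zero_of_mul_nonpos (R : ScalarProblem νs m M C a a1 a2) {ν x y : ℝ} (hxy : x ≤ y)
    (hx : x ∈ C) (hy : y ∈ C)
    (h : (x - ν * a x ≤ 0 ∧ 0 ≤ y - ν * a y) ∨ (0 ≤ x - ν * a x ∧ y - ν * a y ≤ 0)) :
    ∃ c ∈ Icc x y, c ∈ C ∧ c = ν * a c := by
  have hcont : ContinuousOn (fun c => c - ν * a c) (uIcc x y) := fun c hc =>
    ((R.hasDeriv_defect ν (R.ordConnected.uIcc_subset hx hy hc)).continuousWithinAt).mono
      (R.ordConnected.uIcc_subset hx hy)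
  obtain ⟨c, hc, hc0⟩ := intermediate_value_uIcc hcont (mem_uIcc.2 (h.imp_right And.symm))
  exact ⟨c, uIcc_of_le hxy ▸ hc, R.ordConnected.uIcc_subset hx hy hc, sub_eq_zero.1 hc0⟩

/-- A fold at a parameter `0 < ν < νs` produces three solutions at a nearby parameter: two that
emerge from the fold, and a third one because `c - ν a(c)` is nonpositive at the left end of `C`
and nonnegative at its right end. -/
theorem exists_three_solutions (R : ScalarProblem νs m M C a a1 a2) {ν0 c0 : ℝ}
    (hν0 : ν0 ∈ Ioo 0 νs) (hc0 : c0 ∈ C) (h0 : c0 = ν0 * a c0) (h1 : 1 - ν0 * a1 c0 = 0) :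
    ∃ ν1 ∈ Ioo 0 νs, ∃ x y z, x < y ∧ y < z ∧ (x ∈ C ∧ x = ν1 * a x) ∧ (y ∈ C ∧ y = ν1 * a y) ∧
      (z ∈ C ∧ z = ν1 * a z) := by
  have hνI : ν0 ∈ Icc 0 νs := ⟨hν0.1.le, hν0.2.le⟩
  obtain ⟨ha, ha2⟩ := (R.nondegenerate ν0 hνI c0 hc0 h0).resolve_left (not_not.2 h1)
  set p := min 0 (νs * m) with hp
  set q := max 0 (νs * M) with hq
  have hCpq : C = Icc p q := R.eq_Icc
  have hpC : p ∈ C := by rw [hCpq]; exact ⟨le_rfl, (min_le_left _ _).trans (le_max_left _ _)⟩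
  have hqC : q ∈ C := by rw [hCpq]; exact ⟨(min_le_left _ _).trans (le_max_left _ _), le_rfl⟩
  have hac := R.mem_Icc c0 hc0
  have hend : ∀ ν ∈ Ioo 0 νs, p - ν * a p ≤ 0 ∧ 0 ≤ q - ν * a q := fun ν hν => by
    have hap := R.mem_Icc p hpC
    have haq := R.mem_Icc q hqC
    constructor
    · rcases le_total 0 m with hm | hm
      · nlinarith [min_le_left 0 (νs * m), hν.1, mul_nonneg hν.1.le (hm.trans hap.1)]
      · nlinarith [min_le_right 0 (νs * m), hν.1, hν.2,
          mul_le_mul_of_nonneg_left hap.1 hν.1.le, mul_le_mul_of_nonpos_right hν.2.le hm]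
    · rcases le_total M 0 with hM | hM
      · nlinarith [le_max_left 0 (νs * M), hν.1,
          mul_nonpos_of_nonneg_of_nonpos hν.1.le (haq.2.trans hM)]
      · nlinarith [le_max_right 0 (νs * M), hν.1, hν.2,
          mul_le_mul_of_nonneg_left haq.2 hν.1.le, mul_le_mul_of_nonneg_right hν.2.le hM]
  -- `c0` is an interior point of `C`
  have hint : C ∈ 𝓝 c0 := by
    rw [hCpq]
    rcases lt_or_gt_of_ne ha with hneg | hposa
    · have hm : m < 0 := hac.1.trans_lt hneg
      refine Icc_mem_nhds ?_ ?_
      · refine (min_le_right _ _).trans_lt ?_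
        nlinarith [mul_le_mul_of_nonneg_left hac.1 hν0.1.le, mul_lt_mul_of_neg_right hν0.2 hm]
      · refine lt_of_lt_of_le ?_ (le_max_left _ _)
        rw [h0]; exact mul_neg_of_pos_of_neg hν0.1 hneg
    · have hM : 0 < M := hposa.trans_le hac.2
      refine Icc_mem_nhds ?_ ?_
      · refine (min_le_left _ _).trans_lt ?_
        rw [h0]; exact mul_pos hν0.1 hposa
      · refine lt_of_lt_of_le ?_ (le_max_right _ _)
        nlinarith [mul_le_mul_of_nonneg_left hac.2 hν0.1.le, mul_lt_mul_of_pos_right hν0.2 hM]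
  have hnear : ∀ s : ℝ, s ≠ 0 → ∀ x y, (x - ν0 * a x) * s > 0 → (y - ν0 * a y) * s > 0 →
      ∃ ν1 ∈ Ioo 0 νs, (c0 - ν1 * a c0) * s < 0 ∧ (x - ν1 * a x) * s > 0 ∧
        (y - ν1 * a y) * s > 0 := by
    intro s hs x y hx hy
    have hcts : ∀ w, Continuous fun ν : ℝ => (w - ν * a w) * s := fun w => by fun_prop
    have hev : ∀ᶠ ν in 𝓝 ν0, ν ∈ Ioo 0 νs ∧ (x - ν * a x) * s > 0 ∧ (y - ν * a y) * s > 0 :=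
      Filter.Eventually.and (Ioo_mem_nhds hν0.1 hν0.2)
        ((((hcts x).tendsto ν0).eventually (lt_mem_nhds hx)).and
          (((hcts y).tendsto ν0).eventually (lt_mem_nhds hy)))
    obtain ⟨δ, hδ, hb⟩ := Metric.eventually_nhds_iff.1 hev
    -- moving `ν` in the direction of the sign of `a(c0) s` lowers the value at `c0`
    have has : 0 < |a c0 * s| := abs_pos.2 (mul_ne_zero ha hs)
    set e := δ / (2 * |a c0 * s|) * (a c0 * s) with he
    have hee : |e| = δ / 2 := by
      rw [he, abs_mul, abs_of_pos (by positivity)]; field_simp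
    obtain ⟨h3, h4, h5⟩ := hb (y := ν0 + e) (by
      rw [Real.dist_eq, add_sub_cancel_left, hee]; linarith)
    refine ⟨ν0 + e, h3, ?_, h4, h5⟩
    have h6 : (c0 - (ν0 + e) * a c0) * s = -(δ / (2 * |a c0 * s|) * (a c0 * s) ^ 2) := by
      have : (c0 - (ν0 + e) * a c0) = -(e * a c0) := by linarith
      rw [this, he]; ring
    rw [h6, neg_lt_zero]
    have := sq_pos_of_pos has
    rw [sq_abs] at this
    positivity
  -- two points on both sides of `c0`, at which the defect has the sign `s`
  have hpts : ∀ Q : ℝ → Prop, (∀ᶠ c in 𝓝[C \ {c0}] c0, Q c) →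
      ∃ x ∈ C, ∃ y ∈ C, x < c0 ∧ c0 < y ∧ Q x ∧ Q y := fun Q hQ => by
    have hQ' := eventually_nhdsWithin_iff.1 hQ
    have hl : ∀ᶠ c in 𝓝[<] c0, c ∈ C ∧ Q c ∧ c < c0 := by
      filter_upwards [nhdsWithin_le_nhds hint, nhdsWithin_le_nhds hQ', self_mem_nhdsWithin]
        with c h1 h2 h3 using ⟨h1, h2 ⟨h1, (show c < c0 from h3).ne⟩, h3⟩
    have hr : ∀ᶠ c in 𝓝[>] c0, c ∈ C ∧ Q c ∧ c0 < c := by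
      filter_upwards [nhdsWithin_le_nhds hint, nhdsWithin_le_nhds hQ', self_mem_nhdsWithin]
        with c h1 h2 h3 using ⟨h1, h2 ⟨h1, (show c0 < c from h3).ne'⟩, h3⟩
    obtain ⟨x, hx, hx', hx''⟩ := hl.exists
    obtain ⟨y, hy, hy', hy''⟩ := hr.exists
    exact ⟨x, hx, y, hy, hx'', hy'', hx', hy'⟩
  rcases R.eventually_fold hc0 h0 h1 ha2 with hev | hev
  · obtain ⟨x, hx, y, hy, hxc, hcy, hQx, hQy⟩ := hpts _ hev
    obtain ⟨ν1, hν1, h2, h3, h4⟩ := hnear 1 one_ne_zero x y (by simpa using hQx)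
      (by simpa using hQy)
    rw [mul_one] at h2 h3 h4
    have hpx : p ≤ x := by rw [hCpq] at hx; exact hx.1
    obtain ⟨u, hu, hu'⟩ := R.exists_zero_of_mul_nonpos hpx hpC hx
      (Or.inl ⟨(hend ν1 hν1).1, h3.le⟩)
    obtain ⟨v, hv, hv'⟩ := R.exists_zero_of_mul_nonpos hxc.le hx hc0 (Or.inr ⟨h3.le, h2.le⟩)
    obtain ⟨w, hw, hw'⟩ := R.exists_zero_of_mul_nonpos hcy.le hc0 hy (Or.inl ⟨h2.le, h4.le⟩)
    have hux : u ≠ x := by rintro rfl; linarith [hu'.2]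
    have hvc : v ≠ c0 := by rintro rfl; linarith [hv'.2]
    exact ⟨ν1, hν1, u, v, w, (lt_of_le_of_ne hu.2 hux).trans_le hv.1,
      (lt_of_le_of_ne hv.2 hvc).trans_le hw.1, hu', hv', hw'⟩
  · obtain ⟨x, hx, y, hy, hxc, hcy, hQx, hQy⟩ := hpts _ hev
    obtain ⟨ν1, hν1, h2, h3, h4⟩ := hnear (-1) (by norm_num) x y (by linarith) (by linarith)
    have hyq : y ≤ q := by rw [hCpq] at hy; exact hy.2
    obtain ⟨u, hu, hu'⟩ := R.exists_zero_of_mul_nonpos (ν := ν1) hxc.le hx hc0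
      (Or.inl ⟨by linarith, by linarith⟩)
    obtain ⟨v, hv, hv'⟩ := R.exists_zero_of_mul_nonpos (ν := ν1) hcy.le hc0 hy
      (Or.inr ⟨by linarith, by linarith⟩)
    obtain ⟨w, hw, hw'⟩ := R.exists_zero_of_mul_nonpos (ν := ν1) hyq hy hqC
      (Or.inl ⟨by linarith, (hend ν1 hν1).2⟩)
    have huc : u ≠ c0 := by rintro rfl; linarith [hu'.2]
    have hvy : v ≠ y := by rintro rfl; linarith [hv'.2]
    exact ⟨ν1, hν1, u, v, w, (lt_of_le_of_ne hu.2 huc).trans_le hv.1,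
      (lt_of_le_of_ne hv.2 hvy).trans_le hw.1, hu', hv', hw'⟩

end ScalarProblem

theorem hasFDerivWithinAt_comp_smulRight {V X : Type*} [NormedAddCommGroup V]
    [NormedSpace ℝ V] [NormedAddCommGroup X] [NormedSpace ℝ X] {g : ℝ → X} {g' : X} {C : Set ℝ}
    {f : V → ℝ} {f' : V →L[ℝ] ℝ} {s : Set V} {x : V} (hg : HasDerivWithinAt g g' C (f x))
    (hf : HasFDerivWithinAt f f' s x) (hs : MapsTo f s C) :
    HasFDerivWithinAt (fun y => g (f y)) (f'.smulRight g') s x := by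
  have h := hg.hasFDerivWithinAt.comp x hf hs
  have e : (ContinuousLinearMap.toSpanSingleton ℝ g').comp f' = f'.smulRight g' := by
    ext y; simp
  exact e ▸ h

/-- Rank one perturbations `φ ↦ φ - l(φ) w` of the identity are invertible if `l(w) ≠ 1`. -/
theorem exists_equiv_sub_smul {V : Type*} [NormedAddCommGroup V] [NormedSpace ℝ V]
    (l : V →L[ℝ] ℝ) (w : V) (h : 1 - l w ≠ 0) : ∃ e : V ≃L[ℝ] V, ∀ φ, e φ = φ - l φ • w := by
  refine ⟨ContinuousLinearEquiv.equivOfInverse (ContinuousLinearMap.id ℝ V - l.smulRight w)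
    (ContinuousLinearMap.id ℝ V + (1 - l w)⁻¹ • l.smulRight w) (fun φ => ?_) (fun φ => ?_),
    fun φ => by simp⟩
  · have h1 : (1 - l w)⁻¹ * (l φ - l φ * l w) = l φ := by field_simp
    simp [smul_smul, h1]
  · have h1 : (1 - l w)⁻¹ * (l φ) * l w - (1 - l w)⁻¹ * l φ = - l φ := by field_simp; ring
    simp only [add_apply, ContinuousLinearMap.id_apply, smul_apply,
      ContinuousLinearMap.smulRight_apply, sub_apply, map_add, map_smul,
      smul_smul]
    have h2 : (1 - l w)⁻¹ * l φ = l φ + (1 - l w)⁻¹ * l φ * l w := by linarith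
    rw [smul_sub, smul_smul]
    nth_rewrite 1 [h2]
    rw [add_smul]
    abel

namespace BanachScale

variable {d r : ℕ} {B : Fin 4 → Type*} [∀ i, NormedAddCommGroup (B i)] [∀ i, NormedSpace ℝ (B i)]

/-! ### Unique differentiability on the set of probability densities -/

theorem zero_mem_shiftedW {E : BanachScale d r B} {Ks : ℝ} {h : B 1} (hh : h ∈ E.W Ks) :
    (0 : E.V 1) ∈ E.shiftedW Ks h := by
  rw [shiftedW, mem_ofPred_eq, Submodule.coe_zero, add_zero]; exact hh

theorem convex_W (E : BanachScale d r B) (Ks : ℝ) : Convex ℝ (E.W Ks) := by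
  intro x hx y hy s t hs ht hst
  refine ⟨?_, fun φ hφ => ?_, ?_⟩
  · calc ‖s • x + t • y‖ ≤ s * ‖x‖ + t * ‖y‖ := by
          refine (norm_add_le _ _).trans_eq ?_
          rw [norm_smul, norm_smul, Real.norm_of_nonneg hs, Real.norm_of_nonneg ht]
      _ ≤ s * Ks + t * Ks :=
          add_le_add (mul_le_mul_of_nonneg_left hx.1 hs) (mul_le_mul_of_nonneg_left hy.1 ht)
      _ = Ks := by rw [← add_mul, hst, one_mul]
  · have h1 := hx.2.1 φ hφ
    have h2 := hy.2.1 φ hφ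
    rw [map_add, map_smul, map_smul]
    exact add_nonneg (mul_nonneg hs h1) (mul_nonneg ht h2)
  · have h1 : E.toDistr 1 x (oneFun d r) = 1 := hx.2.2
    have h2 : E.toDistr 1 y (oneFun d r) = 1 := hy.2.2
    simp [Distr.mass, h1, h2, hst]

theorem convex_shiftedW (E : BanachScale d r B) (Ks : ℝ) (h : B 1) :
    Convex ℝ (E.shiftedW Ks h) := by
  intro x hx y hy s t hs ht hst
  have h1 := E.convex_W Ks hx hy hs ht hst
  have h2 : s • (h + (x : B 1)) + t • (h + (y : B 1)) =
      h + ((s • x + t • y : E.V 1) : B 1) := by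
    have : h = s • h + t • h := by rw [← add_smul, hst, one_smul]
    conv_rhs => rw [this]
    simp only [smul_add, Submodule.coe_add, Submodule.coe_smul]
    abel
  rw [h2] at h1
  exact h1

/-- Derivatives within `W` along `V` are unique: the differences of elements of `W` span a dense
subspace of `V`, as `1 + t f ∈ W` for each function `f` of zero mean and small `t`. -/
theorem uniqueDiffOn_shiftedW (E : BanachScale d r B) {Ks : ℝ}
    (hKs : ‖E.ofFun 1 (oneFun d r)‖ < Ks) {h : B 1} (hh : h ∈ E.W Ks) :
    UniqueDiffOn ℝ (E.shiftedW Ks h) := by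
  intro x hx
  refine ⟨?_, subset_closure hx⟩
  set e := E.ofFun 1 (oneFun d r) with he
  have he1 : E.toDistr 1 e (oneFun d r) = 1 := E.mass_ofFun_one 1
  set l := E.testFun 1 (oneFun d r) with hl
  let p : B 1 →L[ℝ] E.V 1 := (ContinuousLinearMap.id ℝ (B 1) - l.smulRight e).codRestrict (E.V 1)
    fun g => by
      change E.toDistr 1 (g - l g • e) (oneFun d r) = 0
      simp [he1, hl]
  have hp : Function.Surjective p := fun v => ⟨v, Subtype.ext (by
    have : l v = 0 := v.2
    change (v : B 1) - l v • e = v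
    rw [this, zero_smul, sub_zero])⟩
  have hdense : DenseRange (p ∘ E.ofFun 1) := hp.denseRange.comp (E.dense_ofFun 1) p.continuous
  refine hdense.mono ?_
  rintro _ ⟨f, rfl⟩
  set f0 : torusFun d r := f - l (E.ofFun 1 f) • oneFun d r with hf0
  have hpf : ((p (E.ofFun 1 f) : E.V 1) : B 1) = E.ofFun 1 f0 := by
    change E.ofFun 1 f - l (E.ofFun 1 f) • e = _
    rw [hf0, map_sub, map_smul]
  obtain ⟨K, hK⟩ := isCompact_univ.exists_bound_of_continuousOn
    (continuous_of_mem_torusFun f0.2).continuousOn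
  have hK0 : 0 ≤ K := (norm_nonneg _).trans (hK 0 (mem_univ _))
  set t := min (1 / (K + 1)) ((Ks - ‖e‖) / (‖E.ofFun 1 f0‖ + 1)) with ht
  have ht0 : 0 < t := lt_min (by positivity) (div_pos (by linarith) (by positivity))
  have hdiff : e - h ∈ E.V 1 := by
    have : E.toDistr 1 h (oneFun d r) = 1 := hh.2.2
    change E.toDistr 1 (e - h) (oneFun d r) = 0
    simp [he1, this]
  set y1 : E.V 1 := ⟨e - h, hdiff⟩
  set y2 : E.V 1 := y1 + t • p (E.ofFun 1 f)
  have hy1 : y1 ∈ E.shiftedW Ks h := by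
    have h1 : h + (y1 : B 1) = e := add_sub_cancel h e
    change h + (y1 : B 1) ∈ E.W Ks
    rw [h1]
    exact ⟨hKs.le, E.nonneg_ofFun 1 fun _ => zero_le_one, he1⟩
  have hy2 : y2 ∈ E.shiftedW Ks h := by
    have h1 : h + (y2 : B 1) = E.ofFun 1 (oneFun d r + t • f0) := by
      change h + ((e - h) + t • ((p (E.ofFun 1 f) : E.V 1) : B 1)) = _
      rw [hpf, map_add, map_smul]; abel
    have hm0 : E.toDistr 1 (E.ofFun 1 f0) (oneFun d r) = 0 := by
      rw [← hpf]; exact (p (E.ofFun 1 f)).2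
    change h + (y2 : B 1) ∈ E.W Ks
    rw [h1]
    refine ⟨?_, E.nonneg_ofFun 1 fun z => ?_, ?_⟩
    · rw [map_add, map_smul]
      refine (norm_add_le _ _).trans ?_
      rw [norm_smul, Real.norm_of_nonneg ht0.le]
      have h2 : t * ‖E.ofFun 1 f0‖ ≤ Ks - ‖e‖ := by
        calc t * ‖E.ofFun 1 f0‖ ≤ (Ks - ‖e‖) / (‖E.ofFun 1 f0‖ + 1) * (‖E.ofFun 1 f0‖ + 1) :=
              mul_le_mul (min_le_right _ _) (by linarith) (norm_nonneg _)
                (div_nonneg (by linarith) (by positivity))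
          _ = Ks - ‖e‖ := by field_simp
      linarith
    · change 0 ≤ 1 + t * f0.1 z
      have h2 : -K ≤ f0.1 z := (abs_le.1 (hK z (mem_univ _))).1
      have h3 : t * K ≤ 1 := by
        calc t * K ≤ 1 / (K + 1) * (K + 1) :=
              mul_le_mul (min_le_left _ _) (by linarith) hK0 (by positivity)
          _ = 1 := by field_simp
      nlinarith
    · change E.toDistr 1 (E.ofFun 1 (oneFun d r + t • f0)) (oneFun d r) = 1
      rw [map_add, map_smul]
      simp [hm0, he1, ← he]
  have hcone : ∀ y ∈ E.shiftedW Ks h, y - x ∈ tangentConeAt ℝ (E.shiftedW Ks h) x := fun y hy =>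
    mem_tangentConeAt_of_segment_subset ((E.convex_shiftedW Ks h).segment_subset hx hy)
  have heq : (p ∘ E.ofFun 1) f = t⁻¹ • ((y2 - x) - (y1 - x)) := by
    have : (y2 - x) - (y1 - x) = t • p (E.ofFun 1 f) := by
      simp only [y2]; abel
    rw [this, smul_smul, inv_mul_cancel₀ ht0.ne', one_smul]; rfl
  rw [heq]
  exact Submodule.smul_mem _ _ (Submodule.sub_mem _ (Submodule.subset_span (hcone _ hy2))
    (Submodule.subset_span (hcone _ hy1)))

/-! ### The derivatives of `F` -/

/-- The invariant density of `T + c β`, as an element of `B_1`. -/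
def density₁ (E : BanachScale d r B) (P : CoupledSystem d) (c : ℝ) : B 1 :=
  E.incl 1 (E.incl 2 (E.density P c))

/-- The functional `h ↦ ∫ α h` on `B_1`. -/
def obs (E : BanachScale d r B) (P : CoupledSystem d) : B 1 →L[ℝ] ℝ :=
  E.testFun 1 (ofSmooth r P.α)

theorem toDistr_density₁ (E : BanachScale d r B) (P : CoupledSystem d) (c : ℝ) :
    E.toDistr 1 (E.density₁ P c) = E.toDistr 3 (E.density P c) :=
  (E.toDistr_incl 1 (E.incl 2 (E.density P c))).trans (E.toDistr_incl 2 (E.density P c))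

section

variable {E : BanachScale d r B} {P : CoupledSystem d} {𝒯 : Set (TorusMap d r)}
  {νs Cs K θ : ℝ} {cbar chat nbar : ℕ}

theorem density₁_mem_W [∀ i, CompleteSpace (B i)]
    (hA : E.StandingAssumptions P 𝒯 νs Cs K θ cbar chat nbar) {Ks : ℝ}
    (hKs : (Cs + K) * ‖E.ofFun 3 (oneFun d r)‖ ≤ Ks) {c : ℝ} (hc : P.shifted r c ∈ 𝒯) :
    E.density₁ P c ∈ E.W Ks := by
  obtain ⟨h1, -, h3, h4⟩ := density_spec hA hc
  refine ⟨?_, ?_, ?_⟩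
  · exact (((E.norm_incl_le 1 _).trans (E.norm_incl_le 2 _)).trans h4).trans hKs
  · rw [toDistr_density₁]; exact h3
  · rw [toDistr_density₁]; exact h1

theorem transfer_density₁ [∀ i, CompleteSpace (B i)]
    (hA : E.StandingAssumptions P 𝒯 νs Cs K θ cbar chat nbar) {c : ℝ}
    (hc : P.shifted r c ∈ 𝒯) :
    transfer (P.shifted r c) (E.toDistr 1 (E.density₁ P c)) = E.toDistr 1 (E.density₁ P c) := by
  rw [toDistr_density₁]; exact (density_spec hA hc).2.1

theorem eq_density₁ [∀ i, CompleteSpace (B i)]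
    (hA : E.StandingAssumptions P 𝒯 νs Cs K θ cbar chat nbar) {c : ℝ}
    (hc : P.shifted r c ∈ 𝒯) {g : B 1} (hm : (E.toDistr 1 g).mass = 1)
    (hg : transfer (P.shifted r c) (E.toDistr 1 g) = E.toDistr 1 g) : g = E.density₁ P c := by
  refine eq_of_invariant hA hc 0 (hm.trans ?_) hg (transfer_density₁ hA hc)
  exact ((congrArg Distr.mass (E.toDistr_density₁ P c)).trans (density_spec hA hc).1).symm

theorem H_eq_density₁ [∀ i, CompleteSpace (B i)]
    (hA : E.StandingAssumptions P 𝒯 νs Cs K θ cbar chat nbar) {Ks : ℝ}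
    (hKs : (Cs + K) * ‖E.ofFun 3 (oneFun d r)‖ ≤ Ks) {ν : ℝ} {h : B 1}
    (hc : P.shifted r (ν * E.obs P h) ∈ 𝒯) :
    E.H P Ks ν h = E.density₁ P (ν * E.obs P h) := by
  have h1 : E.H P Ks ν h ∈ E.W Ks ∧
      transfer (P.map ν (E.toDistr 1 h)) (E.toDistr 1 (E.H P Ks ν h)) =
        E.toDistr 1 (E.H P Ks ν h) :=
    Classical.epsilon_spec (p := fun g : B 1 => g ∈ E.W Ks ∧
      transfer (P.map ν (E.toDistr 1 h)) (E.toDistr 1 g) = E.toDistr 1 g)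
      ⟨_, density₁_mem_W hA hKs hc, transfer_density₁ hA hc⟩
  exact eq_density₁ hA hc h1.1.2.2 h1.2

/-- `φ ↦ ν ∫ α (h + φ)` is affine, with this linear part. -/
def paramDeriv (E : BanachScale d r B) (P : CoupledSystem d) (ν : ℝ) : E.V 1 →L[ℝ] ℝ :=
  ν • (E.obs P).comp (E.V 1).subtypeL

theorem paramDeriv_apply (E : BanachScale d r B) (P : CoupledSystem d) (ν : ℝ) (φ : E.V 1) :
    E.paramDeriv P ν φ = ν * E.obs P (φ : B 1) := rfl

theorem hasFDerivWithinAt_param {ν : ℝ} {h : B 1} (s : Set (E.V 1)) (φ : E.V 1) :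
    HasFDerivWithinAt (fun φ : E.V 1 => ν * E.obs P (h + (φ : B 1))) (E.paramDeriv P ν) s φ := by
  have h1 : (fun φ : E.V 1 => ν * E.obs P (h + (φ : B 1))) =
      fun φ => ν * E.obs P h + E.paramDeriv P ν φ := by
    funext φ; rw [map_add, paramDeriv_apply]; ring
  rw [h1]
  exact ((E.paramDeriv P ν).hasFDerivAt.const_add _).hasFDerivWithinAt

theorem hasFDerivWithinAt_F [∀ i, CompleteSpace (B i)]
    (hA : E.StandingAssumptions P 𝒯 νs Cs K θ cbar chat nbar) {Ks : ℝ}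
    (hKs : (Cs + K) * ‖E.ofFun 3 (oneFun d r)‖ ≤ Ks) {C : Set ℝ}
    (hC : ∀ c ∈ C, P.shifted r c ∈ 𝒯) {ν : ℝ} (hmap : ∀ g ∈ E.W Ks, ν * E.obs P g ∈ C)
    {w : ℝ → B 1} (hw : ∀ c ∈ C, HasDerivWithinAt (E.density₁ P) (w c) C c)
    {h : B 1} {φ : E.V 1} (hφ : φ ∈ E.shiftedW Ks h) :
    HasFDerivWithinAt (fun φ : E.V 1 => E.F P Ks ν (h + (φ : B 1)))
      ((E.V 1).subtypeL - (E.paramDeriv P ν).smulRight (w (ν * E.obs P (h + (φ : B 1)))))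
      (E.shiftedW Ks h) φ := by
  have h1 := hasFDerivWithinAt_comp_smulRight
    (f := fun φ : E.V 1 => ν * E.obs P (h + (φ : B 1)))
    (hw _ (hmap _ hφ)) (hasFDerivWithinAt_param (P := P) (ν := ν) (h := h) (E.shiftedW Ks h) φ)
    (fun ψ hψ => hmap _ hψ)
  have h2 : HasFDerivWithinAt (fun φ : E.V 1 => h + (φ : B 1)) (E.V 1).subtypeL
      (E.shiftedW Ks h) φ := ((E.V 1).subtypeL.hasFDerivAt.const_add h).hasFDerivWithinAt
  have h3 : ∀ ψ ∈ E.shiftedW Ks h, E.F P Ks ν (h + (ψ : B 1)) =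
      (h + (ψ : B 1)) - E.density₁ P (ν * E.obs P (h + (ψ : B 1))) := fun ψ hψ => by
    rw [F, H_eq_density₁ hA hKs (hC _ (hmap _ hψ))]
  exact (h2.sub h1).congr h3 (h3 φ hφ)

/-- `D_h F(ν,h)` is a rank one perturbation of the identity. -/
theorem DhF_apply [∀ i, CompleteSpace (B i)]
    (hA : E.StandingAssumptions P 𝒯 νs Cs K θ cbar chat nbar) {Ks : ℝ}
    (hKs : (Cs + K) * ‖E.ofFun 3 (oneFun d r)‖ ≤ Ks) (hKs' : ‖E.ofFun 1 (oneFun d r)‖ < Ks)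
    {C : Set ℝ} (hC : ∀ c ∈ C, P.shifted r c ∈ 𝒯) {ν : ℝ}
    (hmap : ∀ g ∈ E.W Ks, ν * E.obs P g ∈ C)
    {w : ℝ → B 1} (hw : ∀ c ∈ C, HasDerivWithinAt (E.density₁ P) (w c) C c)
    {h : B 1} (hh : h ∈ E.W Ks) (φ : E.V 1) :
    E.DhF P Ks ν h φ = φ - E.paramDeriv P ν φ • w (ν * E.obs P h) := by
  have h0 := E.zero_mem_shiftedW hh
  have h1 := (hasFDerivWithinAt_F hA hKs hC hmap hw h0).fderivWithin
    (E.uniqueDiffOn_shiftedW hKs' hh 0 h0)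
  rw [DhF, h1]
  simp

theorem D2hF_apply [∀ i, CompleteSpace (B i)]
    (hA : E.StandingAssumptions P 𝒯 νs Cs K θ cbar chat nbar) {Ks : ℝ}
    (hKs : (Cs + K) * ‖E.ofFun 3 (oneFun d r)‖ ≤ Ks) (hKs' : ‖E.ofFun 1 (oneFun d r)‖ < Ks)
    {C : Set ℝ} (hC : ∀ c ∈ C, P.shifted r c ∈ 𝒯) {ν : ℝ}
    (hmap : ∀ g ∈ E.W Ks, ν * E.obs P g ∈ C)
    {w : ℝ → B 1} (hw : ∀ c ∈ C, HasDerivWithinAt (E.density₁ P) (w c) C c)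
    {z : ℝ → B 0} (hz : ∀ c ∈ C, HasDerivWithinAt (fun c => (E.incl 0 (w c) : B 0)) (z c) C c)
    {h : B 1} (hh : h ∈ E.W Ks) (φ ψ : E.V 1) :
    E.D2hF P Ks ν h φ ψ =
      -((E.paramDeriv P ν φ * E.paramDeriv P ν ψ) • z (ν * E.obs P h)) := by
  let j : B 1 →L[ℝ] B 0 := E.incl 0
  set s := E.shiftedW Ks h
  set l := E.paramDeriv P ν
  have hu := E.uniqueDiffOn_shiftedW hKs' hh
  have h0 : (0 : E.V 1) ∈ s := E.zero_mem_shiftedW hh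
  have h1 : ∀ φ ∈ s, fderivWithin ℝ (fun φ : E.V 1 => j (E.F P Ks ν (h + (φ : B 1)))) s φ =
      j.comp (E.V 1).subtypeL - l.smulRight (j (w (ν * E.obs P (h + (φ : B 1))))) :=
    fun φ hφ => by
    have h2 := (j.hasFDerivAt.comp_hasFDerivWithinAt φ
      (hasFDerivWithinAt_F hA hKs hC hmap hw hφ)).fderivWithin (hu φ hφ)
    refine h2.trans ?_
    ext ψ
    simp [l]
  have h3 := hasFDerivWithinAt_comp_smulRight
    (f := fun φ : E.V 1 => ν * E.obs P (h + (φ : B 1)))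
    (hz _ (hmap _ h0)) (hasFDerivWithinAt_param (P := P) (ν := ν) (h := h) s 0)
    (fun ψ hψ => hmap _ hψ)
  have h4 : HasFDerivWithinAt
      (fun φ : E.V 1 => j.comp (E.V 1).subtypeL -
        l.smulRight (j (w (ν * E.obs P (h + (φ : B 1))))))
      (-((ContinuousLinearMap.smulRightL ℝ (E.V 1) (B 0) l).comp
        (l.smulRight (z (ν * E.obs P (h + ((0 : E.V 1) : B 1))))))) s 0 :=
    ((ContinuousLinearMap.smulRightL ℝ (E.V 1) (B 0) l).hasFDerivAt.comp_hasFDerivWithinAt 0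
      h3).const_sub _
  have h5 : E.D2hF P Ks ν h = _ := (h4.congr h1 (h1 0 h0)).fderivWithin (hu 0 h0)
  rw [h5]
  simp [smul_smul, l]

/-- Regularity of a zero of `F`, in terms of the scalar problem. -/
theorem isRegular_iff [∀ i, CompleteSpace (B i)]
    (hA : E.StandingAssumptions P 𝒯 νs Cs K θ cbar chat nbar) {Ks : ℝ}
    (hKs : (Cs + K) * ‖E.ofFun 3 (oneFun d r)‖ ≤ Ks) (hKs' : ‖E.ofFun 1 (oneFun d r)‖ < Ks)
    {C : Set ℝ} (hC : ∀ c ∈ C, P.shifted r c ∈ 𝒯) {ν : ℝ}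
    (hmap : ∀ g ∈ E.W Ks, ν * E.obs P g ∈ C)
    {w : ℝ → B 1} (hw : ∀ c ∈ C, HasDerivWithinAt (E.density₁ P) (w c) C c)
    (hwV : ∀ c ∈ C, w c ∈ E.V 1) {h : B 1} (hh : h ∈ E.W Ks) :
    E.IsRegular P Ks ν h ↔ 1 - ν * E.obs P (w (ν * E.obs P h)) ≠ 0 := by
  set v : E.V 1 := ⟨w (ν * E.obs P h), hwV _ (hmap h hh)⟩
  have hv : E.paramDeriv P ν v = ν * E.obs P (w (ν * E.obs P h)) := rfl
  have hD : ∀ φ : E.V 1, E.DhF P Ks ν h φ = ((φ - E.paramDeriv P ν φ • v : E.V 1) : B 1) :=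
    DhF_apply hA hKs hKs' hC hmap hw hh
  rw [← hv]
  constructor
  · rintro ⟨e, he⟩ h0
    have h1 : E.paramDeriv P ν v = 1 := by linarith
    have h2 : e v = 0 := Subtype.ext (by rw [he, hD, h1, one_smul, sub_self])
    rw [(map_eq_zero_iff e e.injective).1 h2, map_zero] at h1
    exact zero_ne_one h1
  · intro h0
    obtain ⟨e, he⟩ := exists_equiv_sub_smul (E.paramDeriv P ν) v h0
    exact ⟨e, fun φ => by rw [he, hD]⟩

/-- At a fold, both `∫ α h` and the second derivative of `c ↦ ∫ α h_c` are nonzero, since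
`D_h² F(φ,φ) = -ν² (∫ α φ)² h_c''` for each `φ`. -/
theorem IsFold.ne_zero [∀ i, CompleteSpace (B i)]
    (hA : E.StandingAssumptions P 𝒯 νs Cs K θ cbar chat nbar) {Ks : ℝ}
    (hKs : (Cs + K) * ‖E.ofFun 3 (oneFun d r)‖ ≤ Ks) (hKs' : ‖E.ofFun 1 (oneFun d r)‖ < Ks)
    {C : Set ℝ} (hC : ∀ c ∈ C, P.shifted r c ∈ 𝒯) {ν : ℝ}
    (hmap : ∀ g ∈ E.W Ks, ν * E.obs P g ∈ C)
    {w : ℝ → B 1} (hw : ∀ c ∈ C, HasDerivWithinAt (E.density₁ P) (w c) C c)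
    {z : ℝ → B 0} (hz : ∀ c ∈ C, HasDerivWithinAt (fun c => (E.incl 0 (w c) : B 0)) (z c) C c)
    {h : B 1} (hh : h ∈ E.W Ks) (hf : E.IsFold P Ks νs ν h) :
    E.obs P h ≠ 0 ∧ E.testFun 0 (ofSmooth r P.α) (z (ν * E.obs P h)) ≠ 0 := by
  refine ⟨hf.nontrivial, fun h0 => hf.second_order ?_⟩
  rw [D2hF_apply hA hKs hKs' hC hmap hw hz hh, ← testFun_apply, map_neg, map_smul, h0, smul_zero,
    neg_zero]

end

end BanachScale

/-! ### From the coupled system to the scalar problem -/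

theorem three_le_encard {X : Type*} {s : Set X} {x y z : X} (hx : x ∈ s) (hy : y ∈ s) (hz : z ∈ s)
    (hxy : x ≠ y) (hxz : x ≠ z) (hyz : y ≠ z) : 3 ≤ s.encard := by
  rw [← encard_eq_three.2 ⟨x, y, z, hxy, hxz, hyz, rfl⟩]
  refine encard_le_encard ?_
  rintro w (rfl | rfl | rfl) <;> assumption

/-- The parameter on a curve of solutions determines `c`, across all curves. -/
theorem ScalarProblem.IsCurve.param_eq {νs M : ℝ} {m : ℝ} {C : Set ℝ} {a a1 a2 : ℝ → ℝ}
    (R : ScalarProblem νs m M C a a1 a2) {I I' : Set ℝ} {G G' γ γ' : ℝ → ℝ}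
    (h : ScalarProblem.IsCurve νs M C a I G γ) (h' : ScalarProblem.IsCurve νs M C a I' G' γ')
    {y : ℝ} (hy : y ∈ I) (hy' : y ∈ I') : γ y = γ' y := by
  have hC : ∀ y ∈ C, ¬ max 0 (νs * M) < y := fun y hy => by
    rw [R.eq_Icc] at hy; exact not_lt.2 hy.2
  rcases h.param y hy with ⟨h1, h2⟩ | ⟨h1, h2⟩ <;> rcases h'.param y hy' with ⟨h3, h4⟩ | ⟨h3, h4⟩
  · rw [h2, h4]
  · exact absurd h3 (hC y h1)
  · exact absurd h1 (hC y h3)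
  · rw [h2, h4]

/-- `ν t` lies in the interval of the scalar problem for `ν ∈ [0,νs]` and `t ∈ [m,M]`. -/
theorem mul_mem_paramInterval {νs m M ν t : ℝ} (hν : ν ∈ Icc 0 νs) (ht : t ∈ Icc m M) :
    ν * t ∈ Icc (min 0 (νs * m)) (max 0 (νs * M)) := by
  constructor
  · rcases le_total 0 m with hm | hm
    · exact (min_le_left _ _).trans (mul_nonneg hν.1 (hm.trans ht.1))
    · exact (min_le_right _ _).trans ((mul_le_mul_of_nonpos_right hν.2 hm).trans
        (mul_le_mul_of_nonneg_left ht.1 hν.1))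
  · rcases le_total M 0 with hM | hM
    · exact (mul_nonpos_of_nonneg_of_nonpos hν.1 (ht.2.trans hM)).trans (le_max_left _ _)
    · exact ((mul_le_mul_of_nonneg_left ht.2 hν.1).trans
        (mul_le_mul_of_nonneg_right hν.2 hM)).trans (le_max_right _ _)

namespace BanachScale

variable {d r : ℕ} {B : Fin 4 → Type*} [∀ i, NormedAddCommGroup (B i)] [∀ i, NormedSpace ℝ (B i)]
  {E : BanachScale d r B} {P : CoupledSystem d} {𝒯 : Set (TorusMap d r)}
  {νs Cs K θ : ℝ} {cbar chat nbar : ℕ}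

theorem obs_mem_Icc {m M : ℝ} (hm : ∀ x, m ≤ P.α.1 x) (hM : ∀ x, P.α.1 x ≤ M) {g : B 1}
    (hg : (E.toDistr 1 g).Nonneg) (hg1 : (E.toDistr 1 g).mass = 1) : E.obs P g ∈ Icc m M := by
  have hg1 : E.toDistr 1 g (oneFun d r) = 1 := hg1
  constructor
  · have := hg (ofSmooth r P.α - m • oneFun d r) fun x => by
      change 0 ≤ P.α.1 x - m * 1
      linarith [hm x]
    rw [map_sub, map_smul, hg1, smul_eq_mul, mul_one] at this
    exact sub_nonneg.1 this
  · have := hg (M • oneFun d r - ofSmooth r P.α) fun x => by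
      change 0 ≤ M * 1 - P.α.1 x
      linarith [hM x]
    rw [map_sub, map_smul, hg1, smul_eq_mul, mul_one] at this
    exact sub_nonneg.1 this

/-- Every map `T + c β` with `c` in the interval of the scalar problem is some `T_{ν,μ}`, with `μ` a
Dirac mass at a point where `α` is maximal or minimal. -/
theorem shifted_mem (hA : E.StandingAssumptions P 𝒯 νs Cs K θ cbar chat nbar)
    (x1 x2 : UnitAddTorus (Fin d)) {c : ℝ}
    (hc : c ∈ Icc (min 0 (νs * P.α.1 x1)) (max 0 (νs * P.α.1 x2))) : P.shifted r c ∈ 𝒯 := by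
  have hdirac : ∀ ν ∈ Icc 0 νs, ∀ x, P.shifted r (ν * P.α.1 x) ∈ 𝒯 := fun ν hν x => by
    have := hA.map_mem ν hν (Measure.dirac x) inferInstance
    rwa [integral_dirac] at this
  have hpos := hA.νs_pos
  rcases lt_trichotomy c 0 with h | h | h
  · have h1 : νs * P.α.1 x1 ≤ c := (min_le_iff.1 hc.1).resolve_left (not_le.2 h)
    have h2 : P.α.1 x1 < 0 := neg_of_mul_neg_right (h1.trans_lt h) hpos.le
    have h3 := hdirac (c / P.α.1 x1) ⟨div_nonneg_of_nonpos h.le h2.le, by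
      rw [div_le_iff_of_neg h2]; exact h1⟩ x1
    rwa [div_mul_cancel₀ _ h2.ne] at h3
  · have h3 := hdirac 0 ⟨le_rfl, hpos.le⟩ x1
    rwa [zero_mul, ← h] at h3
  · have h1 : c ≤ νs * P.α.1 x2 := (le_max_iff.1 hc.2).resolve_left (not_le.2 h)
    have h2 : 0 < P.α.1 x2 := pos_of_mul_pos_right (h.trans_le h1) hpos.le
    have h3 := hdirac (c / P.α.1 x2) ⟨div_nonneg h.le h2.le, by
      rw [div_le_iff₀ h2]; exact h1⟩ x2
    rwa [div_mul_cancel₀ _ h2.ne'] at h3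

/-- If every zero of `F` is regular or a nondegenerate fold, then `a(c) = ∫ α h_c` defines a scalar
problem with nondegenerate solutions. -/
theorem exists_scalarProblem [∀ i, CompleteSpace (B i)]
    (hA : E.StandingAssumptions P 𝒯 νs Cs K θ cbar chat nbar) {Ks : ℝ}
    (hKs : (Cs + K) * ‖E.ofFun 3 (oneFun d r)‖ ≤ Ks) (hKs' : ‖E.ofFun 1 (oneFun d r)‖ < Ks)
    (hzero : ∀ ν ∈ Icc 0 νs, ∀ h ∈ E.W Ks, E.F P Ks ν h = 0 →
        E.IsRegular P Ks ν h ∨ E.IsFold P Ks νs ν h) :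
    ∃ (m M : ℝ) (C : Set ℝ) (a1 a2 : ℝ → ℝ),
      ScalarProblem νs m M C (fun c => E.obs P (E.density₁ P c)) a1 a2 ∧
      (∀ c ∈ C, P.shifted r c ∈ 𝒯) ∧
      (∀ ν ∈ Icc 0 νs, ∀ g ∈ E.W Ks, ν * E.obs P g ∈ C) ∧
      DifferentiableOn ℝ (E.density₁ P) C ∧
      ∀ ν ∈ Icc 0 νs, ∀ h ∈ E.W Ks,
        (E.IsRegular P Ks ν h ↔ 1 - ν * a1 (ν * E.obs P h) ≠ 0) := by
  have hαc := continuous_of_mem_torusFun P.α.2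
  obtain ⟨x1, -, hx1⟩ := isCompact_univ.exists_isMinOn univ_nonempty hαc.continuousOn
  obtain ⟨x2, -, hx2⟩ := isCompact_univ.exists_isMaxOn univ_nonempty hαc.continuousOn
  have hx1 : ∀ x, P.α.1 x1 ≤ P.α.1 x := fun x => hx1 (mem_univ x)
  have hx2 : ∀ x, P.α.1 x ≤ P.α.1 x2 := fun x => hx2 (mem_univ x)
  set C := Icc (min 0 (νs * P.α.1 x1)) (max 0 (νs * P.α.1 x2)) with hCdef
  have hC : ∀ c ∈ C, P.shifted r c ∈ 𝒯 := fun c hc => shifted_mem hA x1 x2 hc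
  have hobs : ∀ g ∈ E.W Ks, E.obs P g ∈ Icc (P.α.1 x1) (P.α.1 x2) := fun g hg =>
    obs_mem_Icc hx1 hx2 hg.2.1 hg.2.2
  have hmap : ∀ ν ∈ Icc 0 νs, ∀ g ∈ E.W Ks, ν * E.obs P g ∈ C := fun ν hν g hg =>
    mul_mem_paramInterval hν (hobs g hg)
  obtain ⟨u', u'', R⟩ := exists_linearResponse hA hC (convex_Icc _ _)
  let w : ℝ → B 1 := fun c => E.incl 1 (u' c)
  let z : ℝ → B 0 := fun c => E.incl 0 (u'' c)
  have hw : ∀ c ∈ C, HasDerivWithinAt (E.density₁ P) (w c) C c := fun c hc => R.hasDerivWithinAt hc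
  have hz : ∀ c ∈ C, HasDerivWithinAt (fun c => (E.incl 0 (w c) : B 0)) (z c) C c :=
    fun c hc => R.hasDerivWithinAt_deriv hc
  have hwV : ∀ c ∈ C, w c ∈ E.V 1 := fun c hc => R.map_V _ (R.u'_mem c hc)
  have hW : ∀ c ∈ C, E.density₁ P c ∈ E.W Ks := fun c hc => density₁_mem_W hA hKs (hC c hc)
  refine ⟨P.α.1 x1, P.α.1 x2, C, fun c => E.obs P (w c),
    fun c => E.testFun 0 (ofSmooth r P.α) (z c),
    { νs_pos := hA.νs_pos
      eq_Icc := rfl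
      mem_Icc := fun c hc => hobs _ (hW c hc)
      hasDeriv := fun c hc => (E.obs P).hasFDerivAt.comp_hasDerivWithinAt c (hw c hc)
      hasDeriv₂ := fun c hc => ?_
      nondegenerate := fun ν hν c hc h0 => ?_ }, hC, hmap,
    fun c hc => (hw c hc).differentiableWithinAt,
    fun ν hν h hh => isRegular_iff hA hKs hKs' hC (hmap ν hν) hw hwV hh⟩
  · have h1 := (E.testFun 0 (ofSmooth r P.α)).hasFDerivAt.comp_hasDerivWithinAt c (hz c hc)
    refine h1.congr_of_eventuallyEq (Eventually.of_forall fun c => ?_) ?_ <;>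
    exact (LinearMap.congr_fun (E.toDistr_incl 0 (w c)) _).symm
  · have h0' : ν * E.obs P (E.density₁ P c) = c := h0.symm
    have hF : E.F P Ks ν (E.density₁ P c) = 0 := by
      rw [F, H_eq_density₁ hA hKs (by rw [h0']; exact hC c hc), h0', sub_self]
    rcases hzero ν hν _ (hW c hc) hF with h | h
    · left
      have h1 := (isRegular_iff hA hKs hKs' hC (hmap ν hν) hw hwV (hW c hc)).1 h
      rwa [h0'] at h1
    · right
      have h1 := h.ne_zero hA hKs hKs' hC (hmap ν hν) hw hz (hW c hc)
      rwa [h0'] at h1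

end BanachScale

end MeanField

end

theorem mainTheorem2 {d r : ℕ} (hr : 12 < r) {B : Fin 4 → Type*}
    [∀ i, NormedAddCommGroup (B i)] [∀ i, NormedSpace ℝ (B i)] [∀ i, CompleteSpace (B i)]
    (E : MeanField.BanachScale d r B) (P : MeanField.CoupledSystem d)
    (𝒯 : Set (MeanField.TorusMap d r)) (νs Cs K θ : ℝ) (cbar chat nbar : ℕ)
    (hA : E.StandingAssumptions P 𝒯 νs Cs K θ cbar chat nbar) :
    ∃ K₀ : ℝ, ∀ Ks ≥ K₀,
      (∀ ν ∈ Set.Icc 0 νs, ∀ h ∈ E.W Ks, E.F P Ks ν h = 0 →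
        E.IsRegular P Ks ν h ∨ E.IsFold P Ks νs ν h) →
      ∃ (N : ℕ) (I : Fin N → Set ℝ) (G : Fin N → ℝ → ℝ) (hc : Fin N → ℝ → B 1),
        (∀ k, (I k).Nonempty ∧ (I k).OrdConnected ∧
          ((I k).Nontrivial ∨ ∀ y ∈ I k, G k y = νs)) ∧
        (∀ k, DifferentiableOn ℝ (G k) (I k) ∧ DifferentiableOn ℝ (hc k) (I k)) ∧
        (∀ k, ∀ y ∈ I k, G k y ∈ Set.Icc 0 νs) ∧
        (∀ ν ∈ Set.Icc 0 νs, ∀ h : B 1, E.IsFixed P 𝒯 ν h →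
          ∃ k, ∃ y ∈ I k, G k y = ν ∧ hc k y = h) ∧
        (∀ k, ∀ y ∈ I k, hc k y ∈ E.W Ks ∧ E.IsFixed P 𝒯 (G k y) (hc k y) ∧
          ∃ g : B 3, E.toDistr 3 g = E.toDistr 1 (hc k y)) ∧
        (∀ k, ∀ ν ∈ Set.Icc 0 νs, {y | y ∈ I k ∧ G k y = ν}.Finite) ∧
        ((∃ ν ∈ Set.Ioo 0 νs, ∃ h ∈ E.W Ks, E.F P Ks ν h = 0 ∧ ¬ E.IsRegular P Ks ν h) →
          ∃ ν₁ ∈ Set.Ioo 0 νs,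
            3 ≤ (⋃ k, {y | y ∈ I k ∧ G k y = ν₁}).encard ∧
            3 ≤ {h | ∃ k, ∃ y ∈ I k, G k y = ν₁ ∧ hc k y = h}.encard) := by
  refine ⟨(Cs + K) * ‖E.ofFun 3 (MeanField.oneFun d r)‖ +
    ‖E.ofFun 1 (MeanField.oneFun d r)‖ + 1, fun Ks hKs0 hzero => ?_⟩
  have h1K := hA.one_le_K
  have h1C := hA.one_le_Cs
  have hn3 : 0 ≤ (Cs + K) * ‖E.ofFun 3 (MeanField.oneFun d r)‖ := by positivity
  have hn1 := norm_nonneg (E.ofFun 1 (MeanField.oneFun d r))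
  have hKs : (Cs + K) * ‖E.ofFun 3 (MeanField.oneFun d r)‖ ≤ Ks := by linarith
  have hKs' : ‖E.ofFun 1 (MeanField.oneFun d r)‖ < Ks := by linarith
  obtain ⟨m, M, C, a1, a2, R, hC, hmap, hdiff, hreg⟩ :=
    MeanField.BanachScale.exists_scalarProblem hA hKs hKs' hzero
  obtain ⟨N, I, G, γ, hcurve, hcover⟩ := R.exists_curves
  have hW : ∀ c ∈ C, E.density₁ P c ∈ E.W Ks := fun c hc =>
    MeanField.BanachScale.density₁_mem_W hA hKs (hC c hc)
  refine ⟨N, I, G, fun k y => E.density₁ P (γ k y),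
    fun k => ⟨(hcurve k).nonempty, (hcurve k).ordConnected, (hcurve k).nontrivial⟩,
    fun k => ⟨(hcurve k).diff_G, hdiff.comp (hcurve k).diff_γ
      fun y hy => ((hcurve k).sol y hy).2.1⟩,
    fun k y hy => ((hcurve k).sol y hy).1, fun ν hν h hfix => ?_, fun k y hy => ?_,
    fun k => (hcurve k).finite, ?_⟩
  · obtain ⟨hm, hT, hinv⟩ := hfix
    have heq : h = E.density₁ P (ν * E.obs P h) :=
      MeanField.BanachScale.eq_density₁ hA hT hm hinv
    have hhW : h ∈ E.W Ks := heq ▸ MeanField.BanachScale.density₁_mem_W hA hKs hT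
    obtain ⟨k, y, hy, hG, hγ⟩ := hcover ν hν _ (hmap ν hν h hhW) (by rw [← heq])
    exact ⟨k, y, hy, hG, (congrArg (E.density₁ P) hγ).trans heq.symm⟩
  · obtain ⟨-, hγC, hγ⟩ := (hcurve k).sol y hy
    have hmapeq : P.map (G k y) (E.toDistr 1 (E.density₁ P (γ k y))) = P.shifted r (γ k y) :=
      congrArg (P.shifted r) hγ.symm
    refine ⟨hW _ hγC, ⟨(hW _ hγC).2.2, ?_, ?_⟩, E.density P (γ k y),
      (E.toDistr_density₁ P (γ k y)).symm⟩
    · rw [hmapeq]; exact hC _ hγC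
    · rw [MeanField.CoupledSystem.nonlinearTransfer, hmapeq]
      exact MeanField.BanachScale.transfer_density₁ hA (hC _ hγC)
  · rintro ⟨ν, hν, h, hh, hF, hnr⟩
    have hνI : ν ∈ Set.Icc 0 νs := ⟨hν.1.le, hν.2.le⟩
    have hcC := hmap ν hνI h hh
    have heq : h = E.density₁ P (ν * E.obs P h) := by
      rw [MeanField.BanachScale.F, MeanField.BanachScale.H_eq_density₁ hA hKs (hC _ hcC)] at hF
      exact sub_eq_zero.1 hF
    obtain ⟨ν₁, hν₁, x, y, z, hxy, hyz, hx, hy, hz⟩ := R.exists_three_solutions hν hcC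
      (by rw [← heq]) (not_not.1 fun hne => hnr ((hreg ν hνI h hh).2 hne))
    have hν₁I : ν₁ ∈ Set.Icc 0 νs := ⟨hν₁.1.le, hν₁.2.le⟩
    obtain ⟨k1, y1, h11, h12, h13⟩ := hcover ν₁ hν₁I x hx.1 hx.2
    obtain ⟨k2, y2, h21, h22, h23⟩ := hcover ν₁ hν₁I y hy.1 hy.2
    obtain ⟨k3, y3, h31, h32, h33⟩ := hcover ν₁ hν₁I z hz.1 hz.2
    -- distinct solutions `c` have distinct parameters and distinct densities
    have hpar : ∀ {k k' : Fin N} {s s' c c' : ℝ}, s ∈ I k → s' ∈ I k' → γ k s = c →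
        γ k' s' = c' → c ≠ c' → s ≠ s' := by
      rintro k k' s s' c c' hs hs' rfl rfl hne rfl
      exact hne ((hcurve k).param_eq R (hcurve k') hs hs')
    have hden : ∀ {c c' : ℝ}, c = ν₁ * E.obs P (E.density₁ P c) →
        c' = ν₁ * E.obs P (E.density₁ P c') → c ≠ c' → E.density₁ P c ≠ E.density₁ P c' :=
      fun h1 h2 hne he => hne (by rw [h1, he, ← h2])
    refine ⟨ν₁, hν₁, MeanField.three_le_encard (x := y1) (y := y2) (z := y3)
        (Set.mem_iUnion.2 ⟨k1, h11, h12⟩) (Set.mem_iUnion.2 ⟨k2, h21, h22⟩)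
        (Set.mem_iUnion.2 ⟨k3, h31, h32⟩) (hpar h11 h21 h13 h23 hxy.ne)
        (hpar h11 h31 h13 h33 (hxy.trans hyz).ne) (hpar h21 h31 h23 h33 hyz.ne),
      MeanField.three_le_encard (x := E.density₁ P x) (y := E.density₁ P y)
        (z := E.density₁ P z) ⟨k1, y1, h11, h12, congrArg (E.density₁ P) h13⟩ ⟨k2, y2, h21, h22, congrArg (E.density₁ P) h23⟩
        ⟨k3, y3, h31, h32, congrArg (E.density₁ P) h33⟩ (hden hx.2 hy.2 hxy.ne)
        (hden hx.2 hz.2 (hxy.trans hyz).ne) (hden hy.2 hz.2 hyz.ne)⟩
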